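/- Let $k$ be a commutative ring with $1$, let $X$ be a set and let $\sigma\colon X\times X\to X\times X$ be a bijection satisfying the braid equation $(\mathrm{Id}\times\sigma)(\sigma\times\mathrm{Id})(\mathrm{Id}\times\sigma)=(\sigma\times\mathrm{Id})(\mathrm{Id}\times\sigma)(\sigma\times\mathrm{Id})$. Let $M$ be the monoid generated by $X$ with relations $xy=zt$ whenever $\sigma(x,y)=(z,t)$, and let $A=k[M]$. Let $B$ be the $k$-algebra generated by symbols $x,x',e_x$ $(x\in X)$ with relations $$xy=zt,\quad xy'=z't,\quad x'y'=z't',\quad xe_y=e_zt,\quad e_xy'=z'e_t\qquad\text{whenever }\sigma(x,y)=(z,t),$$ graded by $|x|=|x'|=0$, $|e_x|=1$, and let $d$ be the superderivation of $B$ with $d(x)=d(x')=0$, $d(e_x)=x-x'$. For $a\in A$ write $a'$ and $a$ for its images in $B$ under the algebra maps $A\to B$ given by $x\mapsto x'$ and $x\mapsto x$; let $A'$ be the image of the first. The map $\sigma$ extends to a braiding of $M$, hence, linearly, of $A$, and to braidings between $A$ and $TA=\bigoplus_n A^{\otimes n}$. The lift $T_s$ of a permutation $s$ to the positive braid monoid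 (along a shortest word for $s$) acts on tensor powers, each generator acting by $-\sigma$; write $T_s^{-\sigma}$ for this action. The quantum shuffle product $\mathbin{\ast}_{-\sigma}$ on $TA$ is $$u\,\mathbin{\ast}_{-\sigma}\,w=\sum_{s\in \mathrm{Sh}_{p,q}}T^{-\sigma}_s(u\otimes w)\qquad(u\in A^{\otimes p},\ w\in A^{\otimes q}),$$ where $\mathrm{Sh}_{p,q}$ is the set of permutations of $p+q$ letters that are increasing on the first $p$ and on the last $q$ letters. Let $\mathrm{Bar}=A\otimes TA\otimes A$, where $A\otimes A^{\otimes n}\otimes A$ has degree $n$, with the bar differential $b'(a_0\otimes\cdots\otimes a_{n+1})=\sum_{i=0}^{n}(-1)^i a_0\otimes\cdots\otimes a_ia_{i+1}\otimes\cdots\otimes a_{n+1}$ for $n\ge 1$ and $b'=0$ on $A\otimes A$, and with the product of the braided tensor product $A\otimes_\sigma(TA,\mathbin{\ast}_{-\sigma})\otimes_\sigma A$: in $(a\otimes u\otimes c)(\tilde a\otimes\tilde u\otimes\tilde c)$ the factor $c$ is moved past $\tilde a\otimes\tilde u$ and then $u$ past the image of $\tilde a$, by $\sigma$ (with no sign),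 and adjacent factors are multiplied. Then: 1. $(B,-d)$ and $(\mathrm{Bar},b')$ are differential graded algebras. 2. For $x_1,\dots,x_n\in X$ one has $x_1\,\mathbin{\ast}_{-\sigma}\cdots \mathbin{\ast}_{-\sigma}\,x_n=\sum_{s\in\mathbb S_n}T_s^{-\sigma}(x_1\otimes\cdots\otimes x_n)$ (the quantum symmetrizer) in $A^{\otimes n}$. 3. There is a unique $k$-linear map $\widetilde{\mathrm{Id}}\colon B\to A\otimes TA\otimes A$ with $$\widetilde{\mathrm{Id}}(a_1'e_{x_1}\cdots e_{x_n}a_2)=a_1\otimes(x_1\,\mathbin{\ast}_{-\sigma}\cdots \mathbin{\ast}_{-\sigma}\,x_n)\otimes a_2$$ for all $a_1,a_2\in A$, $n\ge 0$, $x_1,\dots,x_n\in X$. It is $A'$-$A$-linear, it is a morphism of differential graded algebras $(B,-d)\to(\mathrm{Bar},b')$, in particular a chain map, and it lifts the identity of $A$: it is compatible with the augmentations $B\to A$ $(x,x'\mapsto x,\ e_x\mapsto 0)$ and $\mathrm{Bar}\to A$ (multiplication on $A\otimes A$, zero in positive degrees). 4. Let $V$ be the free $k$-module on $X$ with the braiding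 $x\otimes y\mapsto -z\otimes t$ for $\sigma(x,y)=(z,t)$, and let $\mathfrak B=T(V)/I$ be its Nichols algebra, where $I$ is the largest homogeneous ideal of $T(V)$ concentrated in degrees $\ge 2$ which is a coideal for the braided coproduct (for which the elements of $V$ are primitive) and is compatible with the braiding of $T(V)$. Then $A\otimes\mathfrak B\otimes A$ carries a differential graded algebra structure, with unit $1\otimes 1\otimes 1$ and with the grading of $\mathfrak B$, such that $\widetilde{\mathrm{Id}}$ is a composite of morphisms of differential graded algebras $$(B,-d)\longrightarrow A\otimes\mathfrak B\otimes A\longrightarrow(\mathrm{Bar},b'),$$ the first of which is $a_1'e_{x_1}\cdots e_{x_n}a_2\mapsto a_1\otimes[x_1\otimes\cdots\otimes x_n]\otimes a_2$. -/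

import Mathlib

open scoped TensorProduct
open Module

noncomputable section

namespace YangBaxter

universe u v w

/-! ## Set-theoretical solutions and the operators on words they define -/

/-- A set-theoretical solution `σ` of the Yang-Baxter equation on `X`: a bijection of `X × X`
satisfying the braid equation (spelled out on a triple `(x, y, z)`). -/
structure Solution (X : Type v) where
  /-- the bijection `σ` -/
  toEquiv : X × X ≃ X × X
  /-- `(Id × σ)(σ × Id)(Id × σ) = (σ × Id)(Id × σ)(σ × Id)` -/
  braid :
    ((Prod.map id toEquiv) ∘ (Equiv.prodAssoc X X X) ∘ (Prod.map toEquiv id) ∘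
        (Equiv.prodAssoc X X X).symm ∘ (Prod.map id toEquiv)) =
      ((Equiv.prodAssoc X X X) ∘ (Prod.map toEquiv id) ∘ (Equiv.prodAssoc X X X).symm ∘
        (Prod.map id toEquiv) ∘ (Equiv.prodAssoc X X X) ∘ (Prod.map toEquiv id) ∘
        (Equiv.prodAssoc X X X).symm)

section Words

variable {Y : Type w} (r : Y × Y → Y × Y)

/-- Move the letter `x` from left to right through a word, applying `r` at each crossing:
the result is the new word followed by the letter that comes out on the right. -/
def passLetter : Y → List Y → List Y × Y
  | x, [] => ([], x)
  | x, y :: l =>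
    ((r (x, y)).1 :: (passLetter (r (x, y)).2 l).1, (passLetter (r (x, y)).2 l).2)

/-- Move a whole word `u` from left to right through a word `l` (the last letter of `u` first):
this is the extension of the braiding `r` to words, `(u, l) ↦ (l', u')`. -/
def passWord : List Y → List Y → List Y × List Y
  | [], l => (l, [])
  | x :: u, l =>
    ((passLetter r x (passWord u l).1).1,
      (passLetter r x (passWord u l).1).2 :: (passWord u l).2)

/-- Move a word from left to right through a single letter `y`: the result is the letter that
comes out on the left, and the new word. -/
def passLetterLeft : List Y → Y → Y × List Y
  | [], y => (y, [])
  | x :: u, y =>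
    ((r (x, (passLetterLeft u y).1)).1,
      (r (x, (passLetterLeft u y).1)).2 :: (passLetterLeft u y).2)

/-- The generator `σ_{i+1}` of the braid monoid acting on a word: apply `r` to the letters in the
(zero-based) positions `i` and `i + 1`. -/
def braidAt : ℕ → List Y → List Y
  | 0, x :: y :: l => (r (x, y)).1 :: (r (x, y)).2 :: l
  | i + 1, x :: l => x :: braidAt i l
  | _, l => l

/-- For a permutation `s` given by its list of values `[s 0, s 1, …, s (n-1)]`, a shortest word
`[i₁, …, iₘ]` in the simple transpositions with `s = τ_{iₘ} ⋯ τ_{i₁}`: first sort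
all the strands but the first one, then let the first strand cross the strands which end on its
left. Every inverted pair of strands crosses exactly once, so the length is the number of
inversions of `s`. -/
def reducedWord : List ℕ → List ℕ
  | [] => []
  | j :: t => (reducedWord t).map (· + 1) ++ List.range (t.countP (· < j))

/-- The reduced word of a permutation `s` of `{0, …, n-1}`. -/
def permWord {n : ℕ} (s : Equiv.Perm (Fin n)) : List ℕ :=
  reducedWord (List.ofFn fun i => (s i : ℕ))

/-- The action on words of the lift `T_s` of `s` to the positive braid monoid: the composite of
the generators `braidAt` along the reduced word of `s`. -/
def permAct {n : ℕ} (s : Equiv.Perm (Fin n)) (l : List Y) : List Y :=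
  (permWord s).foldl (fun l i => braidAt r i l) l

end Words

/-- The set `Sh_{p,q}` of shuffles: permutations of `p + q` letters which are increasing on the
first `p` and on the last `q` letters. -/
def shuffles (p q : ℕ) : Finset (Equiv.Perm (Fin (p + q))) := by
  classical
  exact Finset.univ.filter fun s =>
    ∀ i j : Fin (p + q), i < j → ((j : ℕ) < p ∨ p ≤ (i : ℕ)) → s i < s j

/-! ## The structure monoid and its braiding -/

section Monoid

variable {X : Type v} (S : Solution X)

/-- The defining relations `x y ∼ z t` for `σ (x, y) = (z, t)`. -/
inductive MonoidRel : FreeMonoid X → FreeMonoid X → Prop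
  | rel (x y : X) : MonoidRel (FreeMonoid.of x * FreeMonoid.of y)
      (FreeMonoid.of (S.toEquiv (x, y)).1 * FreeMonoid.of (S.toEquiv (x, y)).2)

/-- The monoid `M` generated by `X` with relations `x y = z t` for `σ (x, y) = (z, t)`. -/
abbrev StructureMonoid : Type v := PresentedMonoid (MonoidRel S)

/-- The class in `M` of a word in `X`. -/
def mkWord (l : List X) : StructureMonoid S := PresentedMonoid.mk (MonoidRel S) (FreeMonoid.ofList l)

/-- The class in `M` of a letter. -/
def mkLetter (x : X) : StructureMonoid S := PresentedMonoid.of (MonoidRel S) x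

theorem mkWord_append (u l : List X) : mkWord S (u ++ l) = mkWord S u * mkWord S l := rfl

theorem mkWord_pair (x y : X) :
    mkWord S [x, y] = mkWord S [(S.toEquiv (x, y)).1, (S.toEquiv (x, y)).2] :=
  PresentedMonoid.mk_eq_mk_of_rel (MonoidRel.rel x y)

theorem passWord_append_left {Y : Type w} (r : Y × Y → Y × Y) (u v l : List Y) :
    passWord r (u ++ v) l =
      ((passWord r u (passWord r v l).1).1,
        (passWord r u (passWord r v l).1).2 ++ (passWord r v l).2) := by
  induction u with
  | nil => rfl
  | cons x u ih => simp [passWord, ih]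

theorem passLetter_append {Y : Type w} (r : Y × Y → Y × Y) (x : Y) (l m : List Y) :
    passLetter r x (l ++ m) =
      ((passLetter r x l).1 ++ (passLetter r (passLetter r x l).2 m).1,
        (passLetter r (passLetter r x l).2 m).2) := by
  induction l generalizing x with
  | nil => rfl
  | cons y l ih => simp [passLetter, ih]

theorem passWord_append_right {Y : Type w} (r : Y × Y → Y × Y) (u l m : List Y) :
    passWord r u (l ++ m) =
      ((passWord r u l).1 ++ (passWord r (passWord r u l).2 m).1,
        (passWord r (passWord r u l).2 m).2) := by
  induction u with
  | nil => rfl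
  | cons x u ih => simp [passWord, ih, passLetter_append]

theorem Solution.braid_apply (x y z : X) :
    let a := S.toEquiv (y, z)
    let b := S.toEquiv (x, a.1)
    let c := S.toEquiv (b.2, a.2)
    let a' := S.toEquiv (x, y)
    let b' := S.toEquiv (a'.2, z)
    let c' := S.toEquiv (a'.1, b'.1)
    c'.1 = b.1 ∧ c'.2 = c.1 ∧ b'.2 = c.2 := by
  have h := congrFun S.braid (x, y, z)
  simp only [Function.comp, Prod.map, Equiv.prodAssoc_apply, Equiv.prodAssoc_symm_apply, id,
    Prod.mk.injEq] at h
  exact ⟨h.1.symm, (congrArg Prod.fst h.2).symm, (congrArg Prod.snd h.2).symm⟩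

theorem passWord_pair_left (x y : X) (l : List X) :
    (passWord S.toEquiv [x, y] l).1 =
        (passWord S.toEquiv [(S.toEquiv (x, y)).1, (S.toEquiv (x, y)).2] l).1 ∧
      mkWord S (passWord S.toEquiv [x, y] l).2 =
        mkWord S (passWord S.toEquiv [(S.toEquiv (x, y)).1, (S.toEquiv (x, y)).2] l).2 := by
  induction l generalizing x y with
  | nil => exact ⟨rfl, mkWord_pair S x y⟩
  | cons z l ih =>
    obtain ⟨h1, h2, h3⟩ := S.braid_apply x y z
    simp only [passWord, passLetter] at ih ⊢
    have := ih (S.toEquiv (x, (S.toEquiv (y, z)).1)).2 (S.toEquiv (y, z)).2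
    rw [h1, h2, h3]
    exact ⟨by rw [this.1], this.2⟩

theorem passLetter_pair_right (x y z : X) :
    mkWord S (passLetter S.toEquiv x [y, z]).1 =
        mkWord S (passLetter S.toEquiv x [(S.toEquiv (y, z)).1, (S.toEquiv (y, z)).2]).1 ∧
      (passLetter S.toEquiv x [y, z]).2 =
        (passLetter S.toEquiv x [(S.toEquiv (y, z)).1, (S.toEquiv (y, z)).2]).2 := by
  obtain ⟨h1, h2, h3⟩ := S.braid_apply x y z
  simp only [passLetter]
  rw [← h1, ← h2, ← h3]
  exact ⟨mkWord_pair S _ _, rfl⟩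

theorem passLetter_congr_right {l m : List X}
    (h : conGen (MonoidRel S) (FreeMonoid.ofList l) (FreeMonoid.ofList m)) :
    ∀ x, mkWord S (passLetter S.toEquiv x l).1 = mkWord S (passLetter S.toEquiv x m).1 ∧
      (passLetter S.toEquiv x l).2 = (passLetter S.toEquiv x m).2 := by
  suffices H : ∀ a b : FreeMonoid X, ConGen.Rel (MonoidRel S) a b → ∀ x,
      mkWord S (passLetter S.toEquiv x a.toList).1 = mkWord S (passLetter S.toEquiv x b.toList).1 ∧
      (passLetter S.toEquiv x a.toList).2 = (passLetter S.toEquiv x b.toList).2 from H _ _ h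
  intro a b hab
  induction hab with
  | of a b h => obtain ⟨y, z⟩ := h; exact fun x => passLetter_pair_right S x y z
  | refl a => exact fun x => ⟨rfl, rfl⟩
  | symm _ ih => exact fun x => ⟨(ih x).1.symm, (ih x).2.symm⟩
  | trans _ _ ih1 ih2 => exact fun x => ⟨(ih1 x).1.trans (ih2 x).1, (ih1 x).2.trans (ih2 x).2⟩
  | mul _ _ ih1 ih2 =>
    intro x
    simp only [FreeMonoid.toList_mul, passLetter_append, mkWord_append]
    rw [(ih1 x).1, (ih1 x).2, (ih2 _).1, (ih2 _).2]
    exact ⟨rfl, rfl⟩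

theorem mkWord_eq_iff (l m : List X) : mkWord S l = mkWord S m ↔
    conGen (MonoidRel S) (FreeMonoid.ofList l) (FreeMonoid.ofList m) :=
  PresentedMonoid.mk_eq_mk_iff

theorem passWord_congr_right {l m : List X} (h : mkWord S l = mkWord S m) (u : List X) :
    mkWord S (passWord S.toEquiv u l).1 = mkWord S (passWord S.toEquiv u m).1 ∧
      (passWord S.toEquiv u l).2 = (passWord S.toEquiv u m).2 := by
  induction u with
  | nil => exact ⟨h, rfl⟩
  | cons x u ih =>
    have := passLetter_congr_right S ((mkWord_eq_iff S _ _).1 ih.1) x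
    simp only [passWord]
    rw [this.1, this.2, ih.2]
    exact ⟨rfl, rfl⟩

theorem passWord_congr_left {u v : List X} (h : mkWord S u = mkWord S v) (l : List X) :
    (passWord S.toEquiv u l).1 = (passWord S.toEquiv v l).1 ∧
      mkWord S (passWord S.toEquiv u l).2 = mkWord S (passWord S.toEquiv v l).2 := by
  suffices H : ∀ a b : FreeMonoid X, ConGen.Rel (MonoidRel S) a b → ∀ l,
      (passWord S.toEquiv a.toList l).1 = (passWord S.toEquiv b.toList l).1 ∧
      mkWord S (passWord S.toEquiv a.toList l).2 = mkWord S (passWord S.toEquiv b.toList l).2 from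
    H _ _ ((mkWord_eq_iff S _ _).1 h) l
  intro a b hab
  induction hab with
  | of a b h => obtain ⟨y, z⟩ := h; exact passWord_pair_left S y z
  | refl a => exact fun x => ⟨rfl, rfl⟩
  | symm _ ih => exact fun x => ⟨(ih x).1.symm, (ih x).2.symm⟩
  | trans _ _ ih1 ih2 => exact fun x => ⟨(ih1 x).1.trans (ih2 x).1, (ih1 x).2.trans (ih2 x).2⟩
  | mul _ _ ih1 ih2 =>
    intro x
    simp only [FreeMonoid.toList_mul, passWord_append_left, mkWord_append]
    rw [(ih2 x).1, (ih1 _).1, (ih1 _).2, (ih2 x).2]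
    exact ⟨rfl, rfl⟩

/-- The extension of `σ` to a braiding `M × M → M × M` of the structure monoid. -/
def braidM (p : StructureMonoid S × StructureMonoid S) :
    StructureMonoid S × StructureMonoid S :=
  Quotient.lift₂ (s₁ := (conGen (MonoidRel S)).toSetoid) (s₂ := (conGen (MonoidRel S)).toSetoid)
    (fun u l : FreeMonoid X =>
      (mkWord S (passWord S.toEquiv u.toList l.toList).1,
        mkWord S (passWord S.toEquiv u.toList l.toList).2))
    (fun a₁ b₁ a₂ b₂ h₁ h₂ => by
      have e₁ : mkWord S a₁.toList = mkWord S a₂.toList := (mkWord_eq_iff S _ _).2 h₁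
      have e₂ : mkWord S b₁.toList = mkWord S b₂.toList := (mkWord_eq_iff S _ _).2 h₂
      have h := passWord_congr_left S e₁ b₁.toList
      have h' := passWord_congr_right S e₂ a₂.toList
      simp only [Prod.mk.injEq]
      exact ⟨by rw [h.1, h'.1], by rw [h.2, h'.2]⟩)
    p.1 p.2

theorem braidM_mkWord (u l : List X) :
    braidM S (mkWord S u, mkWord S l) =
      (mkWord S (passWord S.toEquiv u l).1, mkWord S (passWord S.toEquiv u l).2) := rfl

end Monoid

/-! ## Tensor algebras with a basis of letters: words, quantum shuffles, quantum symmetrizers -/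

section Tensor

variable {k : Type u} [CommRing k] {Y : Type w} {V : Type*} [AddCommMonoid V] [Module k V]

/-- The basis of `T(V)` consisting of the words in a basis of `V`. -/
def wordBasis (b : Basis Y k V) : Basis (List Y) k (TensorAlgebra k V) :=
  b.tensorAlgebra.reindex FreeMonoid.toList

theorem wordBasis_apply (b : Basis Y k V) (l : List Y) :
    wordBasis b l = (l.map fun y => TensorAlgebra.ι k (b y)).prod := by
  have h : wordBasis b l = (TensorAlgebra.equivFreeAlgebra b).symm
      (MonoidAlgebra.lift k (FreeAlgebra k Y) (FreeMonoid Y) (FreeMonoid.lift (FreeAlgebra.ι k))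
        (MonoidAlgebra.single (FreeMonoid.ofList l) 1)) := by
    simp only [wordBasis, Basis.reindex_apply, Basis.tensorAlgebra, Basis.map_apply,
      FreeAlgebra.basisFreeMonoid, Finsupp.coe_basisSingleOne]
    rfl
  rw [h, MonoidAlgebra.lift_single, one_smul, FreeMonoid.lift_apply, map_list_prod, List.map_map]
  congr 1
  refine List.map_congr_left fun y _ => ?_
  simp

variable (r : Y × Y → Y × Y)

/-- `T_s^{-r}` on the word `l`: each of the generators of the braid monoid acts by `-r`. -/
def negPermOp (b : Basis Y k V) {n : ℕ} (s : Equiv.Perm (Fin n)) (l : List Y) :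
    TensorAlgebra k V :=
  (-1 : k) ^ (permWord s).length • wordBasis b (permAct r s l)

/-- The quantum shuffle product of `-r` on `T(V)`: the bilinear map which sends words `u`, `l` of
lengths `p`, `q` to the sum of `T_s^{-r} (u l)` over the shuffles `s ∈ Sh_{p,q}`. -/
def negShuffle (b : Basis Y k V) :
    TensorAlgebra k V →ₗ[k] TensorAlgebra k V →ₗ[k] TensorAlgebra k V :=
  (wordBasis b).constr k fun u => (wordBasis b).constr k fun l =>
    ∑ s ∈ shuffles u.length l.length, negPermOp r b s (u ++ l)

/-- The iterated quantum shuffle product of the letters of a word. -/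
def iteratedShuffle (b : Basis Y k V) (l : List Y) : TensorAlgebra k V :=
  l.foldr (fun y t => negShuffle r b (TensorAlgebra.ι k (b y)) t) 1

/-- The quantum symmetrizer of `-r` on a word `l` of length `n`: the sum of `T_s^{-r} l` over all
permutations `s` of `n` letters. -/
def negSymmetrizer (b : Basis Y k V) (l : List Y) : TensorAlgebra k V :=
  ∑ s : Equiv.Perm (Fin l.length), negPermOp r b s l

/-- The extension to `T(V)` of the braiding `-r` of `V`:
`u ⊗ l ↦ (-1) ^ (|u| |l|) l' ⊗ u'` for words `u`, `l`. -/
def negBraiding (b : Basis Y k V) :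
    TensorAlgebra k V ⊗[k] TensorAlgebra k V →ₗ[k] TensorAlgebra k V ⊗[k] TensorAlgebra k V :=
  ((wordBasis b).tensorProduct (wordBasis b)).constr k fun p =>
    (-1 : k) ^ (p.1.length * p.2.length) •
      (wordBasis b (passWord r p.1 p.2).1 ⊗ₜ[k] wordBasis b (passWord r p.1 p.2).2)

/-- The product of the braided tensor product `T(V) ⊗ T(V)` for the braiding `-r`:
`(a ⊗ b)(c ⊗ d) = a · braiding (b ⊗ c) · d`. -/
def negBraidedMul (b : Basis Y k V) (s t : TensorAlgebra k V ⊗[k] TensorAlgebra k V) :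
    TensorAlgebra k V ⊗[k] TensorAlgebra k V :=
  (TensorProduct.map (LinearMap.mul' k (TensorAlgebra k V))
      (LinearMap.mul' k (TensorAlgebra k V)))
    ((TensorProduct.assoc k _ _ _).symm
      ((TensorProduct.map LinearMap.id
        ((TensorProduct.assoc k _ _ _).toLinearMap ∘ₗ
          (TensorProduct.map (negBraiding r b) LinearMap.id) ∘ₗ
          (TensorProduct.assoc k _ _ _).symm.toLinearMap))
        ((TensorProduct.assoc k _ _ _) (s ⊗ₜ[k] t))))

/-- The braided coproduct of `T(V)` for the braiding `-r`: it is multiplicative for the braided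
tensor product, and the letters are primitive, `Δ y = y ⊗ 1 + 1 ⊗ y`. -/
def negCoproduct (b : Basis Y k V) :
    TensorAlgebra k V →ₗ[k] TensorAlgebra k V ⊗[k] TensorAlgebra k V :=
  (wordBasis b).constr k fun l =>
    l.foldr (fun y t => negBraidedMul r b
      (TensorAlgebra.ι k (b y) ⊗ₜ[k] 1 + 1 ⊗ₜ[k] TensorAlgebra.ι k (b y)) t) (1 ⊗ₜ[k] 1)

/-- The homogeneous component `V^{⊗ n}` of `T(V)`. -/
def tensorDeg (k : Type u) [CommRing k] (V : Type*) [AddCommMonoid V] [Module k V] (n : ℕ) :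
    Submodule k (TensorAlgebra k V) :=
  LinearMap.range (TensorAlgebra.ι k : V →ₗ[k] TensorAlgebra k V) ^ n

/-- The image of `I ⊗ T(V)` in `T(V) ⊗ T(V)`. -/
def tensorLeft (I : Ideal (TensorAlgebra k V)) :
    Submodule k (TensorAlgebra k V ⊗[k] TensorAlgebra k V) :=
  Submodule.span k {z | ∃ a ∈ I, ∃ c, z = a ⊗ₜ[k] c}

/-- The image of `T(V) ⊗ I` in `T(V) ⊗ T(V)`. -/
def tensorRight (I : Ideal (TensorAlgebra k V)) :
    Submodule k (TensorAlgebra k V ⊗[k] TensorAlgebra k V) :=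
  Submodule.span k {z | ∃ c, ∃ a ∈ I, z = c ⊗ₜ[k] a}

/-- Homogeneous braided Hopf ideals of `T(V)` (for the braiding `-r` of `V`) which are
concentrated in degrees at least two. -/
structure IsBraidedHopfIdeal (b : Basis Y k V) (I : Ideal (TensorAlgebra k V)) : Prop where
  twoSided : ∀ a ∈ I, ∀ c, a * c ∈ I
  homogeneous : ∀ a ∈ I, a ∈ Submodule.span k
    {c | c ∈ I ∧ ∃ n, c ∈ tensorDeg k V n}
  deg_two : ∀ a ∈ I, a ∈ ⨆ n : ℕ, tensorDeg k V (n + 2)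
  coideal : ∀ a ∈ I, negCoproduct r b a ∈ tensorLeft I ⊔ tensorRight I
  braid_left : ∀ z ∈ tensorLeft I, negBraiding r b z ∈ tensorRight I
  braid_right : ∀ z ∈ tensorRight I, negBraiding r b z ∈ tensorLeft I

/-- The defining ideal of the Nichols algebra of `(V, -r)`: the largest homogeneous braided Hopf
ideal of `T(V)` concentrated in degrees at least two (the sum of all of them). -/
def nicholsIdeal (b : Basis Y k V) : Ideal (TensorAlgebra k V) :=
  sSup {I | IsBraidedHopfIdeal r b I}

instance nicholsIdeal_isTwoSided (b : Basis Y k V) : (nicholsIdeal r b).IsTwoSided := by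
  refine ⟨fun {a} c ha => ?_⟩
  have : nicholsIdeal r b ≤ Submodule.comap
      (LinearMap.toSpanSingleton (TensorAlgebra k V) (TensorAlgebra k V) c)
      (nicholsIdeal r b) := by
    refine sSup_le fun I hI x hx => ?_
    exact (le_sSup (a := I) hI : I ≤ nicholsIdeal r b) (hI.twoSided x hx c)
  exact this ha

/-- The Nichols algebra of the braided module `(V, -r)`. -/
abbrev NicholsAlgebra (b : Basis Y k V) : Type _ := TensorAlgebra k V ⧸ nicholsIdeal r b

end Tensor

/-! ## Differential graded algebras -/

section DG

variable {k : Type u} [CommRing k]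

/-- `(E, mul, one)` with the grading `gr` and the map `d` of degree `-1` is a (unital, associative)
differential graded `k`-algebra. -/
structure IsDGAlgebra {E : Type*} [AddCommMonoid E] [Module k E] (mul : E →ₗ[k] E →ₗ[k] E) (one : E)
    (gr : ℕ → Submodule k E) (d : E →ₗ[k] E) : Prop where
  mul_assoc : ∀ a b c, mul (mul a b) c = mul a (mul b c)
  one_mul : ∀ a, mul one a = a
  mul_one : ∀ a, mul a one = a
  decomposition : DirectSum.IsInternal gr
  one_mem : one ∈ gr 0
  mul_mem : ∀ m n, ∀ a ∈ gr m, ∀ b ∈ gr n, mul a b ∈ gr (m + n)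
  d_zero : ∀ a ∈ gr 0, d a = 0
  d_mem : ∀ n, ∀ a ∈ gr (n + 1), d a ∈ gr n
  d_d : ∀ a, d (d a) = 0
  leibniz : ∀ n, ∀ a ∈ gr n, ∀ b, d (mul a b) = mul (d a) b + (-1 : k) ^ n • mul a (d b)

/-- `f` is a morphism of differential graded algebras. -/
structure IsDGAlgebraHom {E F : Type*} [AddCommMonoid E] [Module k E] [AddCommMonoid F] [Module k F]
    (mulE : E →ₗ[k] E →ₗ[k] E) (oneE : E) (grE : ℕ → Submodule k E) (dE : E →ₗ[k] E)
    (mulF : F →ₗ[k] F →ₗ[k] F) (oneF : F) (grF : ℕ → Submodule k F) (dF : F →ₗ[k] F)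
    (f : E →ₗ[k] F) : Prop where
  map_one : f oneE = oneF
  map_mul : ∀ a b, f (mulE a b) = mulF (f a) (f b)
  map_mem : ∀ n, ∀ a ∈ grE n, f a ∈ grF n
  map_d : ∀ a, f (dE a) = dF (f a)

/-- The grading of `A ⊗ T ⊗ A` induced by a grading of `T`. -/
def sandwichGrading (A : Type*) [Ring A] [Algebra k A] {T : Type*} [AddCommMonoid T] [Module k T]
    (P : ℕ → Submodule k T) (n : ℕ) : Submodule k ((A ⊗[k] T) ⊗[k] A) :=
  Submodule.span k {z | ∃ a : A, ∃ t ∈ P n, ∃ c : A, z = (a ⊗ₜ[k] t) ⊗ₜ[k] c}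

end DG

/-! ## The algebras `A` and `B` -/

section Algebras

variable (k : Type u) [CommRing k] {X : Type v} (S : Solution X)

/-- The algebra `A = k[M]`. -/
abbrev AlgA : Type (max u v) := MonoidAlgebra k (StructureMonoid S)

/-- The basis `M` of `A`. -/
abbrev basisA : Basis (StructureMonoid S) k (AlgA k S) := MonoidAlgebra.basis (StructureMonoid S) k

/-- The generators `x`, `x'`, `e_x` of `B`. -/
inductive Gen (X : Type v) : Type v
  | pl (x : X) : Gen X
  | pr (x : X) : Gen X
  | ee (x : X) : Gen X

/-- The degrees of the generators. -/
def Gen.deg {X : Type v} : Gen X → ℕ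
  | .pl _ => 0
  | .pr _ => 0
  | .ee _ => 1

/-- The relations of `B`: for `σ (x, y) = (z, t)`,
`xy = zt`, `xy' = z't`, `x'y' = z't'`, `x e_y = e_z t`, `e_x y' = z' e_t`. -/
inductive RelB : FreeAlgebra k (Gen X) → FreeAlgebra k (Gen X) → Prop
  | pl_pl (x y : X) : RelB
      (FreeAlgebra.ι k (.pl x) * FreeAlgebra.ι k (.pl y))
      (FreeAlgebra.ι k (.pl (S.toEquiv (x, y)).1) * FreeAlgebra.ι k (.pl (S.toEquiv (x, y)).2))
  | pl_pr (x y : X) : RelB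
      (FreeAlgebra.ι k (.pl x) * FreeAlgebra.ι k (.pr y))
      (FreeAlgebra.ι k (.pr (S.toEquiv (x, y)).1) * FreeAlgebra.ι k (.pl (S.toEquiv (x, y)).2))
  | pr_pr (x y : X) : RelB
      (FreeAlgebra.ι k (.pr x) * FreeAlgebra.ι k (.pr y))
      (FreeAlgebra.ι k (.pr (S.toEquiv (x, y)).1) * FreeAlgebra.ι k (.pr (S.toEquiv (x, y)).2))
  | pl_ee (x y : X) : RelB
      (FreeAlgebra.ι k (.pl x) * FreeAlgebra.ι k (.ee y))
      (FreeAlgebra.ι k (.ee (S.toEquiv (x, y)).1) * FreeAlgebra.ι k (.pl (S.toEquiv (x, y)).2))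
  | ee_pr (x y : X) : RelB
      (FreeAlgebra.ι k (.ee x) * FreeAlgebra.ι k (.pr y))
      (FreeAlgebra.ι k (.pr (S.toEquiv (x, y)).1) * FreeAlgebra.ι k (.ee (S.toEquiv (x, y)).2))

/-- The algebra `B = B(X, σ)`. -/
def AlgB : Type (max u v) := RingQuot (RelB k S)

instance : Ring (AlgB k S) := inferInstanceAs (Ring (RingQuot (RelB k S)))

instance : Algebra k (AlgB k S) := inferInstanceAs (Algebra k (RingQuot (RelB k S)))

/-- The quotient map from the free algebra onto `B`. -/
def mkB : FreeAlgebra k (Gen X) →ₐ[k] AlgB k S := RingQuot.mkAlgHom k (RelB k S)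

theorem mkB_rel {a b : FreeAlgebra k (Gen X)} (h : RelB k S a b) : mkB k S a = mkB k S b :=
  RingQuot.mkAlgHom_rel k h

/-- The universal property of `B`. -/
def liftB {C : Type*} [Semiring C] [Algebra k C] (F : FreeAlgebra k (Gen X) →ₐ[k] C)
    (h : ∀ ⦃a b⦄, RelB k S a b → F a = F b) : AlgB k S →ₐ[k] C :=
  RingQuot.liftAlgHom k ⟨F, h⟩

theorem liftB_mkB {C : Type*} [Semiring C] [Algebra k C] (F : FreeAlgebra k (Gen X) →ₐ[k] C)
    (h : ∀ ⦃a b⦄, RelB k S a b → F a = F b) (a : FreeAlgebra k (Gen X)) :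
    liftB k S F h (mkB k S a) = F a :=
  RingQuot.liftAlgHom_mkAlgHom_apply k F h a

/-- A generator as an element of `B`. -/
def genB (g : Gen X) : AlgB k S := mkB k S (FreeAlgebra.ι k g)

/-- The element `e_{x₁} ⋯ e_{xₙ}` of `B`. -/
def eWord (l : List X) : AlgB k S := (l.map fun x => genB k S (.ee x)).prod

theorem genB_rel {g₁ g₂ h₁ h₂ : Gen X}
    (h : RelB k S (FreeAlgebra.ι k g₁ * FreeAlgebra.ι k g₂)
      (FreeAlgebra.ι k h₁ * FreeAlgebra.ι k h₂)) :
    genB k S g₁ * genB k S g₂ = genB k S h₁ * genB k S h₂ := by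
  have := mkB_rel k S h
  rw [map_mul, map_mul] at this
  exact this

/-- The algebra map `A → B`, `x ↦ x`. -/
def inclA : AlgA k S →ₐ[k] AlgB k S :=
  MonoidAlgebra.lift k (AlgB k S) (StructureMonoid S)
    (PresentedMonoid.lift (fun x => genB k S (.pl x)) (by
      rintro _ _ ⟨x, y⟩
      simpa using genB_rel k S (RelB.pl_pl x y)))

/-- The algebra map `A → B`, `x ↦ x'`; its image is `A'`, so `a'` is `inclA' a`. -/
def inclA' : AlgA k S →ₐ[k] AlgB k S :=
  MonoidAlgebra.lift k (AlgB k S) (StructureMonoid S)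
    (PresentedMonoid.lift (fun x => genB k S (.pr x)) (by
      rintro _ _ ⟨x, y⟩
      simpa using genB_rel k S (RelB.pr_pr x y)))

/-- The homogeneous component of degree `n` of `B`. -/
def gradingB (n : ℕ) : Submodule k (AlgB k S) :=
  Submodule.span k {b | ∃ l : List (Gen X), (l.map Gen.deg).sum = n ∧ b = (l.map (genB k S)).prod}

/-- The upper triangular matrix `!![γ g, d g; 0, g]` attached to a generator `g`, where `γ` is the
parity automorphism. -/
def diffMatrixGen : Gen X → Matrix (Fin 2) (Fin 2) (AlgB k S)
  | .pl x => !![genB k S (.pl x), 0; 0, genB k S (.pl x)]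
  | .pr x => !![genB k S (.pr x), 0; 0, genB k S (.pr x)]
  | .ee x => !![-genB k S (.ee x), genB k S (.pl x) - genB k S (.pr x); 0, genB k S (.ee x)]

/-- The algebra map `b ↦ !![γ b, d b; 0, b]`; multiplicativity of such matrices is
`γ (b c) = γ b * γ c` together with the Leibniz rule `d (b c) = d b * c + γ b * d c`. -/
def diffMatrix : AlgB k S →ₐ[k] Matrix (Fin 2) (Fin 2) (AlgB k S) :=
  liftB k S (FreeAlgebra.lift k (diffMatrixGen k S)) (by
    intro a b h
    induction h with
    | pl_pl x y =>
      have h := genB_rel k S (RelB.pl_pl x y)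
      simp [diffMatrixGen, h]
    | pl_pr x y =>
      have h := genB_rel k S (RelB.pl_pr x y)
      simp [diffMatrixGen, h]
    | pr_pr x y =>
      have h := genB_rel k S (RelB.pr_pr x y)
      simp [diffMatrixGen, h]
    | pl_ee x y =>
      have h := genB_rel k S (RelB.pl_ee x y)
      have h1 := genB_rel k S (RelB.pl_pl x y)
      have h2 := genB_rel k S (RelB.pl_pr x y)
      simp [diffMatrixGen, h, mul_sub, sub_mul, h1, h2]
    | ee_pr x y =>
      have h := genB_rel k S (RelB.ee_pr x y)
      have h1 := genB_rel k S (RelB.pr_pr x y)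
      have h2 := genB_rel k S (RelB.pl_pr x y)
      simp [diffMatrixGen, h, mul_sub, sub_mul, h1, h2])

/-- The superderivation `d` of `B` with `d x = d x' = 0` and `d e_x = x - x'`. -/
def diffB : AlgB k S →ₗ[k] AlgB k S where
  toFun b := diffMatrix k S b 0 1
  map_add' a b := by simp
  map_smul' c a := by simp

theorem diffMatrix_genB (g : Gen X) : diffMatrix k S (genB k S g) = diffMatrixGen k S g := by
  simp [diffMatrix, genB, liftB_mkB]

theorem diffB_ee (x : X) : diffB k S (genB k S (.ee x)) = genB k S (.pl x) - genB k S (.pr x) := by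
  change diffMatrix k S (genB k S (.ee x)) 0 1 = _
  rw [diffMatrix_genB]
  rfl

/-- The values of the augmentation on the generators. -/
def augGen : Gen X → AlgA k S
  | .pl x => MonoidAlgebra.of k (StructureMonoid S) (mkLetter S x)
  | .pr x => MonoidAlgebra.of k (StructureMonoid S) (mkLetter S x)
  | .ee _ => 0

/-- The augmentation `B → A`, `x ↦ x`, `x' ↦ x`, `e_x ↦ 0`. -/
def augB : AlgB k S →ₐ[k] AlgA k S :=
  liftB k S (FreeAlgebra.lift k (augGen k S)) (by
    have key : ∀ x y : X, mkLetter S x * mkLetter S y =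
        mkLetter S (S.toEquiv (x, y)).1 * mkLetter S (S.toEquiv (x, y)).2 :=
      fun x y => mkWord_pair S x y
    intro a b h
    induction h with
    | pl_pl x y =>
      rw [map_mul, map_mul]
      simp only [FreeAlgebra.lift_ι_apply, augGen]
      rw [← map_mul, ← map_mul, key x y]
    | pl_pr x y =>
      rw [map_mul, map_mul]
      simp only [FreeAlgebra.lift_ι_apply, augGen]
      rw [← map_mul, ← map_mul, key x y]
    | pr_pr x y =>
      rw [map_mul, map_mul]
      simp only [FreeAlgebra.lift_ι_apply, augGen]
      rw [← map_mul, ← map_mul, key x y]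
    | pl_ee x y => simp [augGen]
    | ee_pr x y => simp [augGen])

end Algebras

/-! ## The bar resolution `A ⊗ T(A) ⊗ A` and its braided product -/

section Bar

variable (k : Type u) [CommRing k] {X : Type v} (S : Solution X)

/-- The module `A ⊗ T(A) ⊗ A`. -/
abbrev Bar : Type (max u v) := (AlgA k S ⊗[k] TensorAlgebra k (AlgA k S)) ⊗[k] AlgA k S

/-- The basis element `m ⊗ (u₁ ⊗ ⋯ ⊗ uₙ) ⊗ m'` of `A ⊗ T(A) ⊗ A`, where `m, uᵢ, m' ∈ M`. -/
def barBasis : Basis ((StructureMonoid S × List (StructureMonoid S)) × StructureMonoid S) k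
    (Bar k S) :=
  ((basisA k S).tensorProduct (wordBasis (basisA k S))).tensorProduct (basisA k S)

/-- Multiply the entries in the (zero-based) positions `i` and `i + 1` of a list. -/
def mergeAt {M : Type*} [Mul M] : ℕ → List M → List M
  | 0, a :: b :: l => a * b :: l
  | i + 1, a :: l => a :: mergeAt i l
  | _, l => l

/-- The value of the bar differential `b'` on a basis element
`a₀ ⊗ (u₁ ⊗ ⋯ ⊗ uₙ) ⊗ a_{n+1}`, namely
`∑_{i=0}^{n} (-1)^i a₀ ⊗ ⋯ ⊗ aᵢ a_{i+1} ⊗ ⋯ ⊗ a_{n+1}` for `n ≥ 1`, and `0` for `n = 0`. -/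
def barDiffFun (m : StructureMonoid S) (u : List (StructureMonoid S)) (m' : StructureMonoid S) :
    Bar k S :=
  match u with
  | [] => 0
  | a :: l =>
    barBasis k S ((m * a, l), m') +
      ∑ i ∈ Finset.range l.length,
        (-1 : k) ^ (i + 1) • barBasis k S ((m, mergeAt i (a :: l)), m') +
      (-1 : k) ^ (l.length + 1) • barBasis k S
        ((m, (a :: l).dropLast), (a :: l).getLast (List.cons_ne_nil a l) * m')

/-- The bar differential `b'`. -/
def barDiff : Bar k S →ₗ[k] Bar k S :=
  (barBasis k S).constr k fun p => barDiffFun k S p.1.1 p.1.2 p.2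

/-- The augmentation of the bar resolution: multiplication `A ⊗ A → A` in degree zero, and zero
in positive degrees. -/
def barAug : Bar k S →ₗ[k] AlgA k S :=
  (barBasis k S).constr k fun p =>
    match p.1.2 with
    | [] => MonoidAlgebra.of k (StructureMonoid S) (p.1.1 * p.2)
    | _ :: _ => 0

/-- The unit `1 ⊗ 1 ⊗ 1`. -/
def barOne : Bar k S := (1 ⊗ₜ[k] 1) ⊗ₜ[k] 1

/-- The grading of the bar resolution: `A ⊗ A^{⊗ n} ⊗ A` is the component of degree `n`. -/
def barGrading : ℕ → Submodule k (Bar k S) :=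
  sandwichGrading (AlgA k S) (tensorDeg k (AlgA k S))

/-- The product of the braided tensor product `A ⊗_σ (T(A), quantum shuffle of -σ) ⊗_σ A`.
For `(a ⊗ u ⊗ c) * (a' ⊗ u' ⊗ c')`, first `c` is moved to the right through `a'` and `u'`, then `u`
is moved to the right through the letter which came from `a'`, and finally adjacent factors are
multiplied. (The letters in the outer factors have degree zero, so no sign arises from moving
them.) -/
def barMul : Bar k S →ₗ[k] Bar k S →ₗ[k] Bar k S :=
  (barBasis k S).constr k fun p => (barBasis k S).constr k fun q =>
    let c₁ := braidM S (p.2, q.1.1)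
    let c₂ := passLetter (braidM S) c₁.2 q.1.2
    let c₃ := passLetterLeft (braidM S) p.1.2 c₁.1
    (MonoidAlgebra.of k (StructureMonoid S) (p.1.1 * c₃.1) ⊗ₜ[k]
        negShuffle (braidM S) (basisA k S) (wordBasis (basisA k S) c₃.2)
          (wordBasis (basisA k S) c₂.1)) ⊗ₜ[k]
      MonoidAlgebra.of k (StructureMonoid S) (c₂.2 * q.2)

/-- The basis of `V = ⊕ k e_x`. -/
abbrev basisV (X : Type v) : Basis X k (X →₀ k) := Finsupp.basisSingleOne

/-- The Nichols algebra `𝔅` of the braiding `x ⊗ y ↦ -(z ⊗ t)` of `V = ⊕ k x`, where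
`σ (x, y) = (z, t)`. -/
abbrev Nichols : Type (max u v) := NicholsAlgebra (k := k) S.toEquiv (basisV k X)

/-- The class in the Nichols algebra of a word in `X`. -/
def nicholsWord (l : List X) : Nichols k S :=
  Ideal.Quotient.mk _ (wordBasis (basisV k X) l)

/-- The module `A ⊗ 𝔅 ⊗ A`. -/
abbrev NicholsBar : Type (max u v) := (AlgA k S ⊗[k] Nichols k S) ⊗[k] AlgA k S

/-- The element `1 ⊗ 1 ⊗ 1` of `A ⊗ 𝔅 ⊗ A`. -/
def nicholsBarOne : NicholsBar k S := (1 ⊗ₜ[k] 1) ⊗ₜ[k] 1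

/-- The grading of `A ⊗ 𝔅 ⊗ A` induced by the grading of `T(V)`. -/
def nicholsBarGrading : ℕ → Submodule k (NicholsBar k S) :=
  sandwichGrading (AlgA k S) fun n =>
    (tensorDeg k (X →₀ k) n).map
      (Ideal.Quotient.mkₐ k (nicholsIdeal (k := k) S.toEquiv (basisV k X))).toLinearMap

end Bar

end YangBaxter

end

open YangBaxter

/-!
The comparison map is an algebra map from `B`, determined by its values on generators; everything
else is a compatibility of the quantum shuffle product with the bar differential, on one side, and
with the coproduct of the tensor algebra, on the other.

*Shuffles.* Splitting the shuffles of two nonempty words according to the word which provides the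
first letter gives the recursion `negShuffle_cons_cons`:
`x u * y v = x (u * y v) ± y' (u' * v)`, where `y'` and `u'` arise by moving `y` to the left through
`x u`. Together with the Yang-Baxter equation on words it yields associativity by induction on the
total length (`negShuffle_assoc`); the same recursion for permutations instead of shuffles
identifies iterated shuffles of letters with the quantum symmetrizer
(`iteratedShuffle_eq_negSymmetrizer`).

*The bar resolution.* Let `s` be the contracting homotopy `a ⊗ u ⊗ c ↦ 1 ⊗ a u ⊗ c`, so that
`b' s + s b' = Id - η ε`, and let `γ` be the parity automorphism. The shuffle recursion becomes
`s p * s q = s (p * s q - s (γ p) * q)` (`barHomotopy_mul_barHomotopy`). Applying `b'` to the right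
hand side, and using the Leibniz rule for products of smaller degree, gives the Leibniz rule for
`s p * s q`. The outer factors are handled by the facts that `b'` commutes with `1 ⊗ 1 ⊗ c` on the
left and with `a ⊗ 1 ⊗ 1` on the right; the former is proved with `s`, the latter with the mirror
image of `s` (`barDiff_mul_right_factor`, `barDiff_mul_left_factor`). They rest on the fact that the
structure monoid is commutative up to its braiding (`braidM_comm`). The result is
`isDGAlgebra_bar`.

*The algebra `B`.* The relations move primed letters to the left and unprimed ones to the right, so
the elements `a' e_{x₁} ⋯ e_{xₙ} c` span `B`; they are independent because the rewriting defines a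
representation of `B` on the free module which they index (`basisB`). This gives the grading of `B`
(`isDGAlgebra_algB`) and the uniqueness of the comparison map. That `comparison` is a chain map has
to be checked only for products with a generator on the left (`comparison_diffB`).

*The Nichols algebra.* In `B`, moving `x` to the right and `y'` to the left past a word in the
`e_x` are instances of the braiding of `T(V)` (`pl_mul_eMap`, `eMap_mul_pr`), and the differential
of such a word is expressed by its braided coproduct (`diffB_eMap`). Hence the span of the elements
`a' i c`, with `i` in the ideal that defines the Nichols algebra, is a homogeneous two-sided ideal
of `B` stable under `d`; it is the kernel of the surjection of `B` onto `A ⊗ 𝔅 ⊗ A`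
(`nicholsProj_eq_zero_iff`), so the latter inherits the structure of a differential graded algebra
(`exists_isDGAlgebra_of_surjective`). The quantum symmetrizer, too, factors through the coproduct
(`shuffleMap_eq`), so by induction on the degree it vanishes on the ideal (`shuffleMap_of_mem`),
and the comparison map factors through `A ⊗ 𝔅 ⊗ A` (`exists_nichols_factorization`).
-/

noncomputable section

namespace YangBaxter

universe u v w

/-! ### The Yang-Baxter equation on words -/

section WordLemmas

variable {Y : Type w} {r : Y × Y → Y × Y}

/-- The Yang-Baxter equation for a map `r`, written out in the three components; bijectivity is not
required. -/
def IsYBE (r : Y × Y → Y × Y) : Prop :=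
  ∀ x y z : Y,
    (r ((r (x, y)).1, (r ((r (x, y)).2, z)).1)).1 = (r (x, (r (y, z)).1)).1 ∧
    (r ((r (x, y)).1, (r ((r (x, y)).2, z)).1)).2 =
      (r ((r (x, (r (y, z)).1)).2, (r (y, z)).2)).1 ∧
    (r ((r (x, y)).2, z)).2 = (r ((r (x, (r (y, z)).1)).2, (r (y, z)).2)).2

variable (r) in
/-- The action of a word in the generators of the positive braid monoid on words. -/
def braidList (R : List ℕ) (l : List Y) : List Y := R.foldl (fun l i => braidAt r i l) l

@[simp] theorem braidList_nil (l : List Y) : braidList r [] l = l := rfl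

@[simp] theorem braidList_cons (i : ℕ) (R : List ℕ) (l : List Y) :
    braidList r (i :: R) l = braidList r R (braidAt r i l) := rfl

theorem braidList_append (R R' : List ℕ) (l : List Y) :
    braidList r (R ++ R') l = braidList r R' (braidList r R l) := by
  simp [braidList, List.foldl_append]

theorem permAct_eq {n : ℕ} (s : Equiv.Perm (Fin n)) (l : List Y) :
    permAct r s l = braidList r (permWord s) l := rfl

@[simp] theorem length_braidAt (i : ℕ) (l : List Y) : (braidAt r i l).length = l.length := by
  induction i generalizing l with
  | zero => rcases l with _ | ⟨x, _ | ⟨y, l⟩⟩ <;> simp [braidAt]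
  | succ i ih => rcases l with _ | ⟨x, l⟩ <;> simp [braidAt, ih]

@[simp] theorem length_braidList (R : List ℕ) (l : List Y) :
    (braidList r R l).length = l.length := by
  induction R generalizing l with
  | nil => rfl
  | cons i R ih => simp [ih]

@[simp] theorem length_permAct {n : ℕ} (s : Equiv.Perm (Fin n)) (l : List Y) :
    (permAct r s l).length = l.length := length_braidList _ _

@[simp] theorem length_passLetter (x : Y) (l : List Y) :
    (passLetter r x l).1.length = l.length := by
  induction l generalizing x with
  | nil => rfl
  | cons y l ih => simp [passLetter, ih]

@[simp] theorem length_passLetterLeft (u : List Y) (y : Y) :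
    (passLetterLeft r u y).2.length = u.length := by
  induction u with
  | nil => rfl
  | cons x u ih => simp [passLetterLeft, ih]

theorem passWord_singleton_left (x : Y) (l : List Y) :
    passWord r [x] l = ((passLetter r x l).1, [(passLetter r x l).2]) := rfl

theorem passWord_singleton_right (u : List Y) (y : Y) :
    passWord r u [y] = ([(passLetterLeft r u y).1], (passLetterLeft r u y).2) := by
  induction u with
  | nil => rfl
  | cons x u ih => simp [passWord, passLetterLeft, ih, passLetter]

theorem passLetterLeft_append (u v : List Y) (y : Y) :
    passLetterLeft r (u ++ v) y =
      ((passLetterLeft r u (passLetterLeft r v y).1).1,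
        (passLetterLeft r u (passLetterLeft r v y).1).2 ++ (passLetterLeft r v y).2) := by
  induction u with
  | nil => rfl
  | cons x u ih => simp [passLetterLeft, ih]

theorem passWord_nil_right (u : List Y) : passWord r u [] = ([], u) := by
  induction u with
  | nil => rfl
  | cons x u ih => simp [passWord, ih, passLetter]

/-- Two letters moved through a word cross before it or after it, with the same result. -/
theorem passLetter_pair (h : IsYBE r) (x y : Y) (l : List Y) :
    (passLetter r (r (x, y)).1 (passLetter r (r (x, y)).2 l).1).1 =
        (passLetter r x (passLetter r y l).1).1 ∧
      ((passLetter r (r (x, y)).1 (passLetter r (r (x, y)).2 l).1).2,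
        (passLetter r (r (x, y)).2 l).2) =
      r ((passLetter r x (passLetter r y l).1).2, (passLetter r y l).2) := by
  induction l generalizing x y with
  | nil => exact ⟨rfl, rfl⟩
  | cons z l ih =>
    obtain ⟨h1, h2, h3⟩ := h x y z
    simp only [passLetter]
    obtain ⟨i1, i2⟩ := ih (r (x, (r (y, z)).1)).2 (r (y, z)).2
    rw [h1, h2, h3, i1, ← i2]
    exact ⟨rfl, rfl⟩

/-- A letter coming from the left and a letter coming from the right through a word cross before
or after it, with the same result. -/
theorem passLetter_passLetterLeft (h : IsYBE r) (c : Y) (l : List Y) (z : Y) :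
    (passLetterLeft r (passLetter r c l).1 (r ((passLetter r c l).2, z)).1).1 =
        (r (c, (passLetterLeft r l z).1)).1 ∧
      (passLetterLeft r (passLetter r c l).1 (r ((passLetter r c l).2, z)).1).2 =
        (passLetter r (r (c, (passLetterLeft r l z).1)).2 (passLetterLeft r l z).2).1 ∧
      (r ((passLetter r c l).2, z)).2 =
        (passLetter r (r (c, (passLetterLeft r l z).1)).2 (passLetterLeft r l z).2).2 := by
  induction l generalizing c with
  | nil => exact ⟨rfl, rfl, rfl⟩
  | cons y l ih =>
    obtain ⟨h1, h2, h3⟩ := h c y (passLetterLeft r l z).1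
    obtain ⟨i1, i2, i3⟩ := ih (r (c, y)).2
    simp only [passLetter, passLetterLeft]
    rw [i1, i2, i3, h1, h2, h3]
    exact ⟨rfl, rfl, rfl⟩

theorem passLetter_braidAt (h : IsYBE r) (c : Y) (i : ℕ) (l : List Y) :
    passLetter r c (braidAt r i l) = (braidAt r i (passLetter r c l).1, (passLetter r c l).2) := by
  induction i generalizing l c with
  | zero =>
    rcases l with _ | ⟨x, _ | ⟨y, l⟩⟩
    · rfl
    · rfl
    · obtain ⟨h1, h2, h3⟩ := h c x y
      simp only [braidAt, passLetter]
      rw [h1, h2, h3]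
  | succ i ih =>
    rcases l with _ | ⟨x, l⟩
    · rfl
    · simp [braidAt, passLetter, ih]

theorem passLetterLeft_braidAt (h : IsYBE r) (i : ℕ) (l : List Y) (z : Y) :
    passLetterLeft r (braidAt r i l) z =
      ((passLetterLeft r l z).1, braidAt r i (passLetterLeft r l z).2) := by
  induction i generalizing l with
  | zero =>
    rcases l with _ | ⟨x, _ | ⟨y, l⟩⟩
    · rfl
    · rfl
    · obtain ⟨h1, h2, h3⟩ := h x y (passLetterLeft r l z).1
      simp only [braidAt, passLetterLeft]
      rw [h1, h2, h3]
  | succ i ih =>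
    rcases l with _ | ⟨x, l⟩
    · rfl
    · simp [braidAt, passLetterLeft, ih]

theorem passLetter_permAct (h : IsYBE r) (c : Y) {n : ℕ} (s : Equiv.Perm (Fin n)) (l : List Y) :
    passLetter r c (permAct r s l) =
      (permAct r s (passLetter r c l).1, (passLetter r c l).2) := by
  simp only [permAct_eq]
  generalize permWord s = R
  induction R generalizing l with
  | nil => rfl
  | cons i R ih => simp [ih, passLetter_braidAt h]

theorem passLetterLeft_permAct (h : IsYBE r) {n : ℕ} (s : Equiv.Perm (Fin n)) (l : List Y)
    (z : Y) : passLetterLeft r (permAct r s l) z =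
      ((passLetterLeft r l z).1, permAct r s (passLetterLeft r l z).2) := by
  simp only [permAct_eq]
  generalize permWord s = R
  induction R generalizing l with
  | nil => rfl
  | cons i R ih => simp [ih, passLetterLeft_braidAt h]

/-! ### Reduced words of permutations -/

theorem braidList_map_succ (R : List ℕ) (x : Y) (l : List Y) :
    braidList r (R.map (· + 1)) (x :: l) = x :: braidList r R l := by
  induction R generalizing l with
  | nil => rfl
  | cons i R ih => simp [braidAt, ih]

theorem range_succ_eq_cons (n : ℕ) : List.range (n + 1) = 0 :: (List.range n).map (· + 1) :=
  List.range_succ_eq_map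

theorem braidList_range_succ (n : ℕ) (x y : Y) (l : List Y) :
    braidList r (List.range (n + 1)) (x :: y :: l) =
      (r (x, y)).1 :: braidList r (List.range n) ((r (x, y)).2 :: l) := by
  rw [range_succ_eq_cons, braidList_cons, braidAt, braidList_map_succ]

theorem reducedWord_map {f : ℕ → ℕ} (hf : StrictMono f) (t : List ℕ) :
    reducedWord (t.map f) = reducedWord t := by
  induction t with
  | nil => rfl
  | cons j t ih =>
    simp only [List.map_cons, reducedWord, ih, List.countP_map]
    congr 3
    funext x
    simp [hf.lt_iff_lt]

/-- If the strand in position `i` ends in position zero, then it may cross the `i` strands on its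
left before all the other crossings. -/
theorem braidList_reducedWord_insertIdx (t : List ℕ) (ht : ∀ a ∈ t, 0 < a) (u l : List Y) (y : Y)
    (hu : u.length ≤ t.length) :
    braidList r (reducedWord (t.insertIdx u.length 0)) (u ++ y :: l) =
      (passLetterLeft r u y).1 :: braidList r (reducedWord t) ((passLetterLeft r u y).2 ++ l) := by
  induction u generalizing t with
  | nil =>
    have h0 : t.countP (fun x => decide (x < 0)) = 0 := by simp
    simp [reducedWord, passLetterLeft, braidList_map_succ]
  | cons x u ih =>
    rcases t with _ | ⟨a, t⟩
    · simp at hu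
    · have ha : 0 < a := ht a (by simp)
      have hu' : u.length ≤ t.length := by simpa using hu
      have hc : (t.insertIdx u.length 0).countP (· < a) = t.countP (· < a) + 1 := by
        rw [(List.perm_insertIdx 0 t hu').countP_eq]
        simp [ha]
      simp only [List.length_cons, List.insertIdx_succ_cons, reducedWord, List.cons_append,
        braidList_append, braidList_map_succ, hc]
      rw [ih t (fun b hb => ht b (by simp [hb])) hu', braidList_range_succ]
      simp [passLetterLeft, braidList_map_succ]

theorem length_reducedWord_insertIdx (t : List ℕ) (ht : ∀ a ∈ t, 0 < a) (i : ℕ)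
    (hi : i ≤ t.length) :
    (reducedWord (t.insertIdx i 0)).length = i + (reducedWord t).length := by
  induction i generalizing t with
  | zero => simp [reducedWord]
  | succ i ih =>
    rcases t with _ | ⟨a, t⟩
    · simp at hi
    · have ha : 0 < a := ht a (by simp)
      have hi' : i ≤ t.length := by simpa using hi
      have hc : (t.insertIdx i 0).countP (· < a) = t.countP (· < a) + 1 := by
        rw [(List.perm_insertIdx 0 t hi').countP_eq]
        simp [ha]
      simp only [List.insertIdx_succ_cons, reducedWord, List.length_append, List.length_map,
        ih t (fun b hb => ht b (by simp [hb])) hi', List.length_range, hc]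
      omega

/-- The list of values of a permutation. -/
def permValues {n : ℕ} (s : Equiv.Perm (Fin n)) : List ℕ := List.ofFn fun i => (s i : ℕ)

theorem permWord_eq {n : ℕ} (s : Equiv.Perm (Fin n)) : permWord s = reducedWord (permValues s) :=
  rfl

theorem reducedWord_range_map (n : ℕ) (f : ℕ → ℕ) (hf : StrictMono f) :
    reducedWord ((List.range n).map f) = [] := by
  rw [reducedWord_map hf]
  induction n with
  | zero => rfl
  | succ n ih =>
    rw [range_succ_eq_cons, reducedWord, reducedWord_map (fun a b h => Nat.succ_lt_succ h), ih]
    simp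

theorem permWord_one (n : ℕ) : permWord (1 : Equiv.Perm (Fin n)) = [] := by
  have : permValues (1 : Equiv.Perm (Fin n)) = (List.range n).map id := by
    simp [permValues, List.ofFn_eq_map, List.map_coe_finRange_eq_range]
  rw [permWord_eq, this, reducedWord_range_map n id strictMono_id]

/-- The permutation of `n + 1` letters which sends `i` to `j` and is given by `s` on the other
letters. -/
def insertPerm {n : ℕ} (i j : Fin (n + 1)) (s : Equiv.Perm (Fin n)) :
    Equiv.Perm (Fin (n + 1)) :=
  (finSuccEquiv' i).trans (s.optionCongr.trans (finSuccEquiv' j).symm)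

@[simp] theorem insertPerm_self {n : ℕ} (i j : Fin (n + 1)) (s : Equiv.Perm (Fin n)) :
    insertPerm i j s i = j := by
  simp [insertPerm]

@[simp] theorem insertPerm_succAbove {n : ℕ} (i j : Fin (n + 1)) (s : Equiv.Perm (Fin n))
    (a : Fin n) : insertPerm i j s (i.succAbove a) = j.succAbove (s a) := by
  simp [insertPerm]

theorem insertPerm_bijective_left (n : ℕ) (j : Fin (n + 1)) :
    Function.Bijective fun p : Fin (n + 1) × Equiv.Perm (Fin n) => insertPerm p.1 j p.2 := by
  rw [Fintype.bijective_iff_injective_and_card]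
  refine ⟨?_, by simp [Fintype.card_perm, Nat.factorial_succ]⟩
  rintro ⟨i, s⟩ ⟨i', s'⟩ h
  have hi : i = i' := by
    apply (insertPerm i j s).injective
    have : insertPerm i j s i' = insertPerm i' j s' i' := congrArg (· i') h
    rw [this]; simp
  subst hi
  have hs : s = s' := by
    ext a : 1
    have := congrArg (· (i.succAbove a)) h
    simpa using this
  rw [hs]

theorem insertPerm_bijective_right (n : ℕ) (i : Fin (n + 1)) :
    Function.Bijective fun p : Fin (n + 1) × Equiv.Perm (Fin n) => insertPerm i p.1 p.2 := by
  rw [Fintype.bijective_iff_injective_and_card]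
  refine ⟨?_, by simp [Fintype.card_perm, Nat.factorial_succ]⟩
  rintro ⟨j, s⟩ ⟨j', s'⟩ h
  have hj : j = j' := by
    have := congrArg (· i) h
    simpa using this
  subst hj
  have hs : s = s' := by
    ext a : 1
    have := congrArg (· (i.succAbove a)) h
    simpa using this
  rw [hs]

theorem permValues_insertPerm_zero_right {n : ℕ} (i : Fin (n + 1)) (s : Equiv.Perm (Fin n)) :
    permValues (insertPerm i 0 s) = ((permValues s).map (· + 1)).insertIdx i 0 := by
  apply List.ext_getElem
  · rw [List.length_insertIdx_of_le_length] <;> simp [permValues]; omega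
  · intro m h1 h2
    rw [List.getElem_insertIdx]
    have hm : m < n + 1 := by simpa [permValues] using h1
    obtain ⟨m, rfl⟩ : ∃ m' : Fin (n + 1), (m' : ℕ) = m := ⟨⟨m, hm⟩, rfl⟩
    simp only [permValues, List.getElem_ofFn, List.getElem_map, Fin.eta]
    rcases Fin.eq_self_or_eq_succAbove i m with rfl | ⟨a, rfl⟩
    · simp
    · rw [insertPerm_succAbove]
      rcases lt_or_ge a.castSucc i with hai | hai
      · have : ((i.succAbove a : Fin (n + 1)) : ℕ) = a := by
          rw [Fin.succAbove_of_castSucc_lt _ _ hai]; rfl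
        have h3 : (a : ℕ) < i := hai
        simp [this, h3]
      · have : ((i.succAbove a : Fin (n + 1)) : ℕ) = a + 1 := by
          rw [Fin.succAbove_of_le_castSucc _ _ hai]; rfl
        have h3 : (i : ℕ) ≤ a := hai
        have h4 : ¬ ((a : ℕ) + 1 < i) := by omega
        have h5 : ¬ ((a : ℕ) + 1 = i) := by omega
        simp [this, h4, h5]

/-- If the first strand ends in position `j`, it crosses the `j` strands on its right after these
have been sorted. -/
theorem permWord_insertPerm_zero_left {n : ℕ} (j : Fin (n + 1)) (s : Equiv.Perm (Fin n)) :
    permWord (insertPerm 0 j s) = (permWord s).map (· + 1) ++ List.range j := by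
  have hv : permValues (insertPerm 0 j s) =
      (j : ℕ) :: (permValues s).map (fun a => if a < (j : ℕ) then a else a + 1) := by
    rw [permValues, List.ofFn_succ, insertPerm_self, permValues, List.map_ofFn]
    congr 2
    funext a
    rw [← Fin.succAbove_zero, insertPerm_succAbove]
    simp only [Function.comp, Fin.succAbove, Fin.lt_def, Fin.val_castSucc]
    split_ifs <;> rfl
  have hm : StrictMono (fun a => if a < (j : ℕ) then a else a + 1) := by
    intro a b hab
    simp only
    split_ifs <;> omega
  rw [permWord_eq, hv, reducedWord, reducedWord_map hm, permWord_eq]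
  congr 2
  have hP : (permValues s).Perm (List.range n) := by
    have : permValues s = (List.ofFn s).map (fun i : Fin n => (i : ℕ)) := by
      rw [permValues, List.map_ofFn]; rfl
    rw [this, ← List.map_coe_finRange_eq_range]
    apply List.Perm.map
    rw [List.ofFn_eq_map]
    exact (Equiv.Perm.map_finRange_perm s)
  rw [List.countP_map, hP.countP_eq]
  have hcomp : ((fun x : ℕ => decide (x < (j : ℕ))) ∘ fun a => if a < (j : ℕ) then a else a + 1) =
      fun x => decide (x < (j : ℕ)) := by
    funext a
    simp only [Function.comp]
    split_ifs with h
    · rfl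
    · simp [h]; omega
  rw [hcomp]
  have hjn : (j : ℕ) ≤ n := by omega
  generalize (j : ℕ) = i at hjn
  obtain ⟨m, hm⟩ := Nat.exists_eq_add_of_le hjn
  rw [hm, List.range_add, List.countP_append, List.countP_eq_length.2, List.countP_eq_zero.2]
  · simp
  · intro a ha; simp at ha ⊢; omega
  · intro a ha; simpa using ha

end WordLemmas

/-! ### The recursion for shuffles -/

section Shuffles

/-- Permutations of `n` letters which are increasing on the first `p` and on the last `n - p`
letters. -/
def IsShuffle {n : ℕ} (p : ℕ) (s : Equiv.Perm (Fin n)) : Prop :=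
  ∀ i j : Fin n, i < j → ((j : ℕ) < p ∨ p ≤ (i : ℕ)) → s i < s j

open Classical in
theorem shuffles_eq (p q : ℕ) : shuffles p q = Finset.univ.filter (IsShuffle p) := by
  ext s
  simp [shuffles, IsShuffle]

theorem isShuffle_one {n : ℕ} (p : ℕ) : IsShuffle p (1 : Equiv.Perm (Fin n)) :=
  fun _ _ h _ => h

theorem eq_one_of_strictMono {n : ℕ} {s : Equiv.Perm (Fin n)} (h : StrictMono s) : s = 1 := by
  ext i : 1
  have := Subsingleton.elim (h.orderIsoOfSurjective s s.surjective) (OrderIso.refl _)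
  exact congrArg (fun f : Fin n ≃o Fin n => f i) this

theorem shuffles_zero_left (q : ℕ) : shuffles 0 q = {1} := by
  classical
  rw [shuffles_eq]
  ext s
  simp only [Finset.mem_filter, Finset.mem_univ, true_and, Finset.mem_singleton]
  refine ⟨fun h => eq_one_of_strictMono fun i j hij => h i j hij (Or.inr (Nat.zero_le _)), ?_⟩
  rintro rfl
  exact isShuffle_one 0

theorem shuffles_zero_right (p : ℕ) : shuffles p 0 = {1} := by
  classical
  rw [shuffles_eq]
  ext s
  simp only [Finset.mem_filter, Finset.mem_univ, true_and, Finset.mem_singleton]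
  refine ⟨fun h => eq_one_of_strictMono fun i j hij => h i j hij (Or.inl j.2), ?_⟩
  rintro rfl
  exact isShuffle_one p

theorem isShuffle_insertPerm_zero {n p : ℕ} (s : Equiv.Perm (Fin n)) :
    IsShuffle (p + 1) (insertPerm 0 0 s) ↔ IsShuffle p s := by
  have e : ∀ a : Fin n, insertPerm 0 0 s a.succ = (s a).succ := fun a => by
    rw [← Fin.succAbove_zero, insertPerm_succAbove]
  constructor
  · intro h i j hij hp
    have := h i.succ j.succ (by simpa using hij) (by simpa using hp)
    simpa [e] using this
  · intro h i j hij hp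
    refine Fin.cases (fun hij _ => ?_) (fun i hij hp => ?_) i hij hp
    · obtain ⟨b, rfl⟩ := Fin.exists_succ_eq.2 hij.ne'
      rw [insertPerm_self, e]
      exact Fin.succ_pos _
    · obtain ⟨b, rfl⟩ := Fin.exists_succ_eq.2 (Fin.pos_of_ne_zero (Fin.ne_zero_of_lt hij)).ne'
      rw [e, e]
      simpa using h i b (by simpa using hij) (by simpa using hp)

theorem isShuffle_insertPerm_middle {n p : ℕ} (m : Fin (n + 1)) (hm : (m : ℕ) = p)
    (s : Equiv.Perm (Fin n)) : IsShuffle p (insertPerm m 0 s) ↔ IsShuffle p s := by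
  have e : ∀ a : Fin n, insertPerm m 0 s (m.succAbove a) = (s a).succ := fun a => by
    rw [insertPerm_succAbove, Fin.succAbove_zero]
  have v : ∀ a : Fin n, ((m.succAbove a : Fin (n + 1)) : ℕ) = if (a : ℕ) < p then (a : ℕ) else
      a + 1 := fun a => by
    simp only [Fin.succAbove, Fin.lt_def, Fin.val_castSucc, hm]
    split_ifs <;> rfl
  constructor
  · intro h i j hij hp
    have := h (m.succAbove i) (m.succAbove j) (by simpa using hij) (by
      rw [v, v]; split_ifs <;> omega)
    simpa [e] using this
  · intro h i j hij hp
    rcases Fin.eq_self_or_eq_succAbove m i with rfl | ⟨a, rfl⟩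
    · rcases Fin.eq_self_or_eq_succAbove i j with rfl | ⟨b, rfl⟩
      · exact absurd hij (lt_irrefl _)
      · rw [insertPerm_self, e]
        exact Fin.succ_pos _
    · rcases Fin.eq_self_or_eq_succAbove m j with rfl | ⟨b, rfl⟩
      · exfalso
        have := Fin.lt_def.1 hij
        omega
      · rw [e, e]
        have hp' : (b : ℕ) < p ∨ p ≤ (a : ℕ) := by
          rw [v, v] at hp
          split_ifs at hp <;> omega
        simpa using h a b (by simpa using hij) hp'

theorem not_isShuffle_insertPerm {n p : ℕ} (i : Fin (n + 1)) (h0 : i ≠ 0) (hp : p ≤ n)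
    (hi : (i : ℕ) ≠ p) (s : Equiv.Perm (Fin n)) : ¬ IsShuffle p (insertPerm i 0 s) := by
  intro h
  have hi0 : 0 < (i : ℕ) := Nat.pos_of_ne_zero fun h => h0 (Fin.ext h)
  rcases lt_or_gt_of_ne hi with h1 | h1
  · have := h 0 i (Fin.lt_def.2 hi0) (Or.inl h1)
    simp at this
  · have := h ⟨p, by omega⟩ i (Fin.lt_def.2 h1) (Or.inr le_rfl)
    simp at this

open Classical in
/-- In a shuffle of two nonempty words, either the first letter of the first word or the first
letter of the second word comes first. -/
theorem sum_isShuffle_succ {N : Type*} [AddCommMonoid N] (n p : ℕ) (hp : p + 1 ≤ n)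
    (F : Equiv.Perm (Fin (n + 1)) → N) :
    ∑ s ∈ Finset.univ.filter (IsShuffle (p + 1)), F s =
      ∑ s ∈ Finset.univ.filter (IsShuffle (n := n) p), F (insertPerm 0 0 s) +
      ∑ s ∈ Finset.univ.filter (IsShuffle (n := n) (p + 1)),
        F (insertPerm ⟨p + 1, by omega⟩ 0 s) := by
  rw [Finset.sum_filter, ← (Equiv.ofBijective _ (insertPerm_bijective_left n 0)).sum_comp,
    Fintype.sum_prod_type]
  simp only [Equiv.ofBijective_apply]
  rw [Finset.sum_eq_add_of_mem (0 : Fin (n + 1)) ⟨p + 1, by omega⟩ (Finset.mem_univ _)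
    (Finset.mem_univ _) (by simp [Fin.ext_iff])]
  · rw [Finset.sum_filter, Finset.sum_filter]
    simp only [isShuffle_insertPerm_zero]
    congr 1
    refine Finset.sum_congr rfl fun s _ => ?_
    rw [isShuffle_insertPerm_middle (p := p + 1) _ rfl]
  · rintro i - ⟨h0, h1⟩
    refine Finset.sum_eq_zero fun s _ => if_neg ?_
    exact not_isShuffle_insertPerm i h0 hp (fun h => h1 (Fin.ext h)) s

end Shuffles

/-! ### The quantum shuffle algebra -/

theorem basis_induction {ι R M : Type*} [Semiring R] [AddCommMonoid M] [Module R M]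
    (b : Basis ι R M) {P : M → Prop} (t : M) (zero : P 0) (add : ∀ s t, P s → P t → P (s + t))
    (smul : ∀ (c : R) t, P t → P (c • t)) (basis : ∀ i, P (b i)) : P t := by
  have ht : t ∈ Submodule.span R (Set.range b) := by rw [b.span_eq]; trivial
  induction ht using Submodule.span_induction with
  | mem x hx => obtain ⟨i, rfl⟩ := hx; exact basis i
  | zero => exact zero
  | add s t _ _ hs ht => exact add s t hs ht
  | smul c t _ ht => exact smul c t ht

section ShuffleAlgebra

variable {k : Type u} [CommRing k] {Y : Type w} {V : Type*} [AddCommMonoid V] [Module k V]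
variable {r : Y × Y → Y × Y} (b : Basis Y k V)

theorem wordBasis_nil : wordBasis b [] = 1 := by simp [wordBasis_apply]

theorem wordBasis_cons (y : Y) (l : List Y) :
    wordBasis b (y :: l) = TensorAlgebra.ι k (b y) * wordBasis b l := by
  simp [wordBasis_apply]

theorem wordBasis_singleton (y : Y) : wordBasis b [y] = TensorAlgebra.ι k (b y) := by
  simp [wordBasis_apply]

theorem wordBasis_append (l m : List Y) :
    wordBasis b (l ++ m) = wordBasis b l * wordBasis b m := by
  simp [wordBasis_apply]

theorem tensorDeg_eq_span (n : ℕ) :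
    tensorDeg k V n = Submodule.span k {t | ∃ l : List Y, l.length = n ∧ t = wordBasis b l} := by
  induction n with
  | zero =>
    rw [tensorDeg, pow_zero, Submodule.one_eq_span]
    congr 1
    ext t
    simp [List.length_eq_zero_iff, wordBasis_nil]
  | succ n ih =>
    have h1 : LinearMap.range (TensorAlgebra.ι k : V →ₗ[k] TensorAlgebra k V) =
        Submodule.span k (Set.range fun y => TensorAlgebra.ι k (b y)) := by
      rw [LinearMap.range_eq_map, ← b.span_eq, Submodule.map_span, ← Set.range_comp]
      rfl
    rw [tensorDeg, pow_succ', ← tensorDeg, ih, h1, Submodule.span_mul_span]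
    congr 1
    ext t
    constructor
    · rintro ⟨_, ⟨y, rfl⟩, _, ⟨l, hl, rfl⟩, rfl⟩
      exact ⟨y :: l, by simp [hl], (wordBasis_cons b y l).symm⟩
    · rintro ⟨l, hl, rfl⟩
      rcases l with _ | ⟨y, l⟩
      · simp at hl
      · exact ⟨_, ⟨y, rfl⟩, _, ⟨l, by simpa using hl, rfl⟩, (wordBasis_cons b y l).symm⟩

theorem wordBasis_mem_tensorDeg (l : List Y) : wordBasis b l ∈ tensorDeg k V l.length := by
  rw [tensorDeg_eq_span b]
  exact Submodule.subset_span ⟨l, rfl, rfl⟩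

theorem negShuffle_word (u l : List Y) :
    negShuffle r b (wordBasis b u) (wordBasis b l) =
      ∑ s ∈ shuffles u.length l.length, negPermOp r b s (u ++ l) := by
  simp [negShuffle]

open Classical in
theorem negShuffle_word_of_length (u l : List Y) (n : ℕ) (hn : n = u.length + l.length) :
    negShuffle r b (wordBasis b u) (wordBasis b l) =
      ∑ s ∈ Finset.univ.filter (IsShuffle (n := n) u.length), negPermOp r b s (u ++ l) := by
  subst hn
  rw [negShuffle_word, shuffles_eq]

theorem negPermOp_one (n : ℕ) (l : List Y) :
    negPermOp r b (1 : Equiv.Perm (Fin n)) l = wordBasis b l := by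
  simp [negPermOp, permAct_eq, permWord_one]

theorem negShuffle_one_left (t : TensorAlgebra k V) : negShuffle r b 1 t = t := by
  rw [← wordBasis_nil b]
  suffices h : negShuffle r b (wordBasis b []) = LinearMap.id by rw [h]; rfl
  refine (wordBasis b).ext fun l => ?_
  rw [negShuffle_word, List.length_nil, shuffles_zero_left, Finset.sum_singleton, negPermOp_one]
  rfl

theorem negShuffle_one_right (t : TensorAlgebra k V) : negShuffle r b t 1 = t := by
  rw [← wordBasis_nil b]
  suffices h : (negShuffle r b).flip (wordBasis b []) = LinearMap.id from
    LinearMap.congr_fun h t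
  refine (wordBasis b).ext fun l => ?_
  rw [LinearMap.flip_apply, negShuffle_word, List.length_nil, shuffles_zero_right,
    Finset.sum_singleton, negPermOp_one]
  simp

theorem negPermOp_insertPerm_zero_left {n : ℕ} (j : Fin (n + 1)) (s : Equiv.Perm (Fin n)) (y : Y)
    (l : List Y) : negPermOp r b (insertPerm 0 j s) (y :: l) =
      (-1 : k) ^ (permWord s).length • (-1 : k) ^ (j : ℕ) •
        wordBasis b (braidList r (List.range j) (y :: permAct r s l)) := by
  rw [negPermOp, permAct_eq, permWord_insertPerm_zero_left, braidList_append, braidList_map_succ,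
    smul_smul, ← pow_add]
  simp [permAct_eq]

theorem negPermOp_insertPerm_zero_right {n : ℕ} (i : Fin (n + 1)) (s : Equiv.Perm (Fin n))
    (u l : List Y) (y : Y) (hu : u.length = i) :
    negPermOp r b (insertPerm i 0 s) (u ++ y :: l) =
      (-1 : k) ^ (i : ℕ) • (TensorAlgebra.ι k (b (passLetterLeft r u y).1) *
        negPermOp r b s ((passLetterLeft r u y).2 ++ l)) := by
  have hpos : ∀ a ∈ (permValues s).map (· + 1), 0 < a := by simp
  have hlen : u.length ≤ ((permValues s).map (· + 1)).length := by
    simp only [permValues, List.length_map, List.length_ofFn]; omega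
  have hmap : reducedWord ((permValues s).map (· + 1)) = permWord s :=
    reducedWord_map (fun a b h => Nat.succ_lt_succ h) _
  rw [negPermOp, permAct_eq, permWord_eq, permValues_insertPerm_zero_right, ← hu,
    braidList_reducedWord_insertIdx _ hpos _ _ _ hlen,
    length_reducedWord_insertIdx _ hpos _ hlen, hmap, wordBasis_cons, negPermOp, permAct_eq,
    pow_add, mul_smul, mul_smul_comm]

/-- The recursion for the quantum shuffle product, according to the word which provides the first
letter. -/
theorem negShuffle_cons_cons (x y : Y) (u l : List Y) :
    negShuffle r b (wordBasis b (x :: u)) (wordBasis b (y :: l)) =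
      TensorAlgebra.ι k (b x) * negShuffle r b (wordBasis b u) (wordBasis b (y :: l)) +
      (-1 : k) ^ (u.length + 1) • (TensorAlgebra.ι k (b (passLetterLeft r (x :: u) y).1) *
        negShuffle r b (wordBasis b (passLetterLeft r (x :: u) y).2) (wordBasis b l)) := by
  classical
  set n := u.length + 1 + l.length with hn
  rw [negShuffle_word_of_length b (x :: u) (y :: l) (n + 1) (by simp [hn]; omega),
    negShuffle_word_of_length b u (y :: l) n (by simp [hn]; omega),
    negShuffle_word_of_length b _ l n (by simp [hn]), List.length_cons,
    sum_isShuffle_succ n u.length (by omega), Finset.mul_sum, Finset.mul_sum, Finset.smul_sum,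
    length_passLetterLeft, List.length_cons]
  congr 1
  · refine Finset.sum_congr rfl fun s _ => ?_
    rw [List.cons_append, negPermOp_insertPerm_zero_left]
    simp [wordBasis_cons, negPermOp]
  · refine Finset.sum_congr rfl fun s _ => ?_
    rw [negPermOp_insertPerm_zero_right b _ s (x :: u) l y (by simp)]

theorem negShuffle_word_mem (u l : List Y) :
    negShuffle r b (wordBasis b u) (wordBasis b l) ∈ tensorDeg k V (u.length + l.length) := by
  rw [negShuffle_word]
  refine Submodule.sum_mem _ fun s _ => Submodule.smul_mem _ _ ?_
  have := wordBasis_mem_tensorDeg b (permAct r s (u ++ l))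
  rwa [length_permAct, List.length_append] at this

theorem negShuffle_ι_mul_right (x y : Y) (u : List Y) (t : TensorAlgebra k V) :
    negShuffle r b (wordBasis b (x :: u)) (TensorAlgebra.ι k (b y) * t) =
      TensorAlgebra.ι k (b x) * negShuffle r b (wordBasis b u) (TensorAlgebra.ι k (b y) * t) +
      (-1 : k) ^ (u.length + 1) • (TensorAlgebra.ι k (b (passLetterLeft r (x :: u) y).1) *
        negShuffle r b (wordBasis b (passLetterLeft r (x :: u) y).2) t) := by
  induction t using basis_induction (wordBasis b) with
  | zero => simp
  | add s t hs ht => simp only [mul_add, map_add, hs, ht, smul_add]; abel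
  | smul c t ht => simp only [mul_smul_comm, map_smul, ht, smul_add, smul_comm c]
  | basis l => rw [← wordBasis_cons, negShuffle_cons_cons]

variable (r) in
/-- The part of the shuffle product of a tensor with the word `z w` in which `z` is the first
letter to be placed, that is, `u ↦ (-1) ^ |u| z' (u' * w)` if moving `u` past `z` gives `z'`
and `u'`. -/
def crossLetter (z : Y) (w : List Y) : TensorAlgebra k V →ₗ[k] TensorAlgebra k V :=
  (wordBasis b).constr k fun u => (-1 : k) ^ u.length •
    (TensorAlgebra.ι k (b (passLetterLeft r u z).1) *
      negShuffle r b (wordBasis b (passLetterLeft r u z).2) (wordBasis b w))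

theorem negShuffle_ι_mul_left (x z : Y) (w : List Y) (t : TensorAlgebra k V) :
    negShuffle r b (TensorAlgebra.ι k (b x) * t) (wordBasis b (z :: w)) =
      TensorAlgebra.ι k (b x) * negShuffle r b t (wordBasis b (z :: w)) +
        crossLetter r b z w (TensorAlgebra.ι k (b x) * t) := by
  induction t using basis_induction (wordBasis b) with
  | zero => simp
  | add s t hs ht => simp only [mul_add, map_add, LinearMap.add_apply, hs, ht]; abel
  | smul c t ht => simp only [mul_smul_comm, map_smul, LinearMap.smul_apply, ht, smul_add]
  | basis l =>
    rw [← wordBasis_cons, negShuffle_cons_cons, crossLetter, Basis.constr_basis, List.length_cons]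

/-- A letter moved to the left through a shuffle product of two words moves through both words: the
crossings commute with the shuffles by the Yang-Baxter equation. -/
theorem crossLetter_negShuffle (h : IsYBE r) (u v w : List Y) (z : Y) :
    crossLetter r b z w (negShuffle r b (wordBasis b u) (wordBasis b v)) =
      (-1 : k) ^ (u.length + v.length) •
        (TensorAlgebra.ι k (b (passLetterLeft r u (passLetterLeft r v z).1).1) *
          negShuffle r b (negShuffle r b
            (wordBasis b (passLetterLeft r u (passLetterLeft r v z).1).2)
            (wordBasis b (passLetterLeft r v z).2)) (wordBasis b w)) := by
  rw [negShuffle_word, map_sum, negShuffle_word, map_sum, LinearMap.sum_apply, Finset.mul_sum,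
    Finset.smul_sum, length_passLetterLeft, length_passLetterLeft]
  refine Finset.sum_congr rfl fun s _ => ?_
  rw [negPermOp, map_smul, crossLetter, Basis.constr_basis, passLetterLeft_permAct h,
    passLetterLeft_append, length_permAct, List.length_append, negPermOp, map_smul,
    LinearMap.smul_apply, mul_smul_comm, smul_comm]

/-- By induction on the total length: after expanding both sides with the recursion, the terms in
which the first letter comes from `u`, from `v` and from `w` agree separately. -/
theorem negShuffle_word_assoc (h : IsYBE r) (u v w : List Y) :
    negShuffle r b (negShuffle r b (wordBasis b u) (wordBasis b v)) (wordBasis b w) =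
      negShuffle r b (wordBasis b u) (negShuffle r b (wordBasis b v) (wordBasis b w)) := by
  induction hN : u.length + v.length + w.length generalizing u v w with
  | zero =>
    obtain rfl : u = [] := List.length_eq_zero_iff.1 (by omega)
    simp [wordBasis_nil, negShuffle_one_left]
  | succ N ih =>
    rcases u with _ | ⟨x, u⟩
    · simp [wordBasis_nil, negShuffle_one_left]
    rcases v with _ | ⟨y, v⟩
    · simp [wordBasis_nil, negShuffle_one_left, negShuffle_one_right]
    rcases w with _ | ⟨z, w⟩
    · simp [wordBasis_nil, negShuffle_one_right]
    simp only [List.length_cons] at hN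
    -- the first letter comes from `u`, from `v`, from `w`
    have i1 := ih u (y :: v) (z :: w) (by simp; omega)
    have i2 := ih (passLetterLeft r (x :: u) y).2 v (z :: w) (by simp; omega)
    have i3 := ih (passLetterLeft r (x :: u) (passLetterLeft r (y :: v) z).1).2
      (passLetterLeft r (y :: v) z).2 w (by simp; omega)
    have hL : negShuffle r b (negShuffle r b (wordBasis b (x :: u)) (wordBasis b (y :: v)))
        (wordBasis b (z :: w)) =
      TensorAlgebra.ι k (b x) * negShuffle r b (negShuffle r b (wordBasis b u)
          (wordBasis b (y :: v))) (wordBasis b (z :: w)) +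
        (-1 : k) ^ (u.length + 1) • (TensorAlgebra.ι k (b (passLetterLeft r (x :: u) y).1) *
          negShuffle r b (negShuffle r b (wordBasis b (passLetterLeft r (x :: u) y).2)
            (wordBasis b v)) (wordBasis b (z :: w))) +
        crossLetter r b z w (negShuffle r b (wordBasis b (x :: u)) (wordBasis b (y :: v))) := by
      conv_lhs => rw [negShuffle_cons_cons]
      rw [map_add, LinearMap.add_apply, map_smul, LinearMap.smul_apply, negShuffle_ι_mul_left,
        negShuffle_ι_mul_left, negShuffle_cons_cons, map_add, map_smul, smul_add]
      abel
    rw [hL, crossLetter_negShuffle b h, i1, i2, i3, negShuffle_cons_cons b y z v w, map_add,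
      map_smul, map_add, map_smul, negShuffle_ι_mul_right, negShuffle_ι_mul_right, mul_add,
      mul_smul_comm]
    simp only [smul_add, smul_smul, List.length_cons, ← pow_add]
    rw [show u.length + 1 + (v.length + 1) = v.length + 1 + (u.length + 1) by omega]
    abel

theorem negShuffle_assoc (h : IsYBE r) (s t t' : TensorAlgebra k V) :
    negShuffle r b (negShuffle r b s t) t' = negShuffle r b s (negShuffle r b t t') := by
  induction s using basis_induction (wordBasis b) with
  | zero => simp
  | add s s' hs hs' => simp only [map_add, LinearMap.add_apply, hs, hs']
  | smul c s hs => simp only [map_smul, LinearMap.smul_apply, hs]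
  | basis u =>
    induction t using basis_induction (wordBasis b) with
    | zero => simp
    | add s s' hs hs' => simp only [map_add, LinearMap.add_apply, hs, hs']
    | smul c s hs => simp only [map_smul, LinearMap.smul_apply, hs]
    | basis v =>
      induction t' using basis_induction (wordBasis b) with
      | zero => simp
      | add s s' hs hs' => simp only [map_add, hs, hs']
      | smul c s hs => simp only [map_smul, hs]
      | basis w => exact negShuffle_word_assoc b h u v w

/-! ### The quantum symmetrizer -/

theorem negShuffle_letter (y : Y) (l : List Y) :
    negShuffle r b (TensorAlgebra.ι k (b y)) (wordBasis b l) =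
      ∑ j ∈ Finset.range (l.length + 1),
        (-1 : k) ^ j • wordBasis b (braidList r (List.range j) (y :: l)) := by
  induction l generalizing y with
  | nil => simp [wordBasis_nil, negShuffle_one_right, wordBasis_singleton]
  | cons z l ih =>
    rw [← wordBasis_singleton, negShuffle_cons_cons, wordBasis_nil, negShuffle_one_left,
      List.length_cons, Finset.sum_range_succ', add_comm]
    congr 1
    · rw [passLetterLeft, passLetterLeft, wordBasis_singleton, ih, Finset.mul_sum,
        Finset.smul_sum]
      refine Finset.sum_congr rfl fun j _ => ?_
      rw [braidList_range_succ, wordBasis_cons, List.length_nil, zero_add, pow_one, pow_succ',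
        mul_smul_comm, smul_smul]
    · simp [wordBasis_cons]

theorem iteratedShuffle_cons (y : Y) (l : List Y) :
    iteratedShuffle r b (y :: l) =
      negShuffle r b (TensorAlgebra.ι k (b y)) (iteratedShuffle r b l) := rfl

theorem iteratedShuffle_eq_sum (l : List Y) (n : ℕ) (hn : l.length = n) :
    iteratedShuffle r b l = ∑ s : Equiv.Perm (Fin n), negPermOp r b s l := by
  induction l generalizing n with
  | nil =>
    obtain rfl : n = 0 := by simpa using hn.symm
    have : ∀ s : Equiv.Perm (Fin 0), s = 1 := fun s => Subsingleton.elim _ _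
    simp [this, negPermOp_one, iteratedShuffle, wordBasis_nil]
  | cons y l ih =>
    obtain ⟨n, rfl⟩ : ∃ m, n = m + 1 := ⟨l.length, by simpa using hn.symm⟩
    have hl : l.length = n := by simpa using hn
    rw [iteratedShuffle_cons, ih n hl, map_sum,
      ← (Equiv.ofBijective _ (insertPerm_bijective_right n 0)).sum_comp,
      Fintype.sum_prod_type, Finset.sum_comm]
    refine Finset.sum_congr rfl fun s _ => ?_
    rw [negPermOp, map_smul, negShuffle_letter, length_permAct, hl, Finset.smul_sum,
      Finset.sum_range]
    refine Finset.sum_congr rfl fun j _ => ?_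
    rw [Equiv.ofBijective_apply, negPermOp_insertPerm_zero_left]

/-- Iterated quantum shuffles of letters are given by the quantum symmetrizer. -/
theorem iteratedShuffle_eq_negSymmetrizer (l : List Y) :
    iteratedShuffle r b l = negSymmetrizer r b l :=
  iteratedShuffle_eq_sum b l _ rfl

theorem iteratedShuffle_mem (l : List Y) : iteratedShuffle r b l ∈ tensorDeg k V l.length := by
  rw [iteratedShuffle_eq_negSymmetrizer]
  refine Submodule.sum_mem _ fun s _ => Submodule.smul_mem _ _ ?_
  have := wordBasis_mem_tensorDeg b (permAct r s l)
  rwa [length_permAct] at this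

end ShuffleAlgebra

/-! ### The braiding of the structure monoid -/

section BraidedMonoid

variable {X : Type v} (S : Solution X)

theorem Solution.isYBE : IsYBE S.toEquiv := fun x y z => S.braid_apply x y z

/-- A letter moved through the two sides of a crossing of words: the Yang-Baxter equation for one
letter and two words. -/
theorem passLetter_passWord {Y : Type w} {r : Y × Y → Y × Y} (h : IsYBE r) (x : Y)
    (v w : List Y) :
    passWord r (passLetter r x v).1 (passLetter r (passLetter r x v).2 w).1 =
        ((passLetter r x (passWord r v w).1).1,
          (passLetter r (passLetter r x (passWord r v w).1).2 (passWord r v w).2).1) ∧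
      (passLetter r (passLetter r x v).2 w).2 =
        (passLetter r (passLetter r x (passWord r v w).1).2 (passWord r v w).2).2 := by
  induction v generalizing x with
  | nil => exact ⟨rfl, rfl⟩
  | cons y v ih =>
    obtain ⟨i1, i2⟩ := ih (r (x, y)).2
    obtain ⟨j1, j2⟩ := passLetter_pair h x y (passWord r v w).1
    simp only [passLetter, passWord]
    rw [i1, i2, j1, ← j2]
    exact ⟨rfl, rfl⟩

/-- The extension of a braiding to words satisfies the Yang-Baxter equation. -/
theorem isYBE_passWord {Y : Type w} {r : Y × Y → Y × Y} (h : IsYBE r) :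
    IsYBE fun p : List Y × List Y => passWord r p.1 p.2 := by
  intro u v w
  induction u with
  | nil => exact ⟨rfl, rfl, rfl⟩
  | cons x u ih =>
    simp only at ih
    obtain ⟨i1, i2, i3⟩ := ih
    obtain ⟨j1, j2⟩ := passLetter_passWord h x (passWord r u v).1
      (passWord r (passWord r u v).2 w).1
    rw [i1, i2] at j1 j2
    simp only [passWord]
    rw [j1, j2, i3]
    exact ⟨rfl, rfl, rfl⟩

theorem mkWord_surjective : Function.Surjective (mkWord S) := fun m => by
  obtain ⟨l, rfl⟩ := Quotient.exists_rep m
  exact ⟨FreeMonoid.toList l, rfl⟩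

theorem isYBE_braidM : IsYBE (braidM S) := by
  intro a b c
  obtain ⟨u, rfl⟩ := mkWord_surjective S a
  obtain ⟨v, rfl⟩ := mkWord_surjective S b
  obtain ⟨w, rfl⟩ := mkWord_surjective S c
  obtain ⟨h1, h2, h3⟩ := isYBE_passWord S.isYBE u v w
  simp only at h1 h2 h3
  simp only [braidM_mkWord]
  rw [h1, h2, h3]
  exact ⟨rfl, rfl, rfl⟩

theorem mkWord_nil : mkWord S [] = 1 := rfl

theorem braidM_one_left (a : StructureMonoid S) : braidM S (1, a) = (a, 1) := by
  obtain ⟨u, rfl⟩ := mkWord_surjective S a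
  rfl

theorem braidM_one_right (a : StructureMonoid S) : braidM S (a, 1) = (1, a) := by
  obtain ⟨u, rfl⟩ := mkWord_surjective S a
  rw [← mkWord_nil, braidM_mkWord, passWord_nil_right]

theorem braidM_mul_left (a b c : StructureMonoid S) :
    braidM S (a * b, c) = ((braidM S (a, (braidM S (b, c)).1)).1,
      (braidM S (a, (braidM S (b, c)).1)).2 * (braidM S (b, c)).2) := by
  obtain ⟨u, rfl⟩ := mkWord_surjective S a
  obtain ⟨v, rfl⟩ := mkWord_surjective S b
  obtain ⟨w, rfl⟩ := mkWord_surjective S c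
  simp only [← mkWord_append, braidM_mkWord, passWord_append_left]

theorem braidM_mul_right (a b c : StructureMonoid S) :
    braidM S (a, b * c) = ((braidM S (a, b)).1 * (braidM S ((braidM S (a, b)).2, c)).1,
      (braidM S ((braidM S (a, b)).2, c)).2) := by
  obtain ⟨u, rfl⟩ := mkWord_surjective S a
  obtain ⟨v, rfl⟩ := mkWord_surjective S b
  obtain ⟨w, rfl⟩ := mkWord_surjective S c
  simp only [← mkWord_append, braidM_mkWord, passWord_append_right]

theorem mkWord_passLetter (x : X) (l : List X) :
    mkWord S ((passLetter S.toEquiv x l).1 ++ [(passLetter S.toEquiv x l).2]) =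
      mkWord S (x :: l) := by
  induction l generalizing x with
  | nil => rfl
  | cons y l ih =>
    have e1 : ∀ (z : X) (m : List X), mkWord S (z :: m) = mkWord S [z] * mkWord S m :=
      fun _ _ => rfl
    have e2 : mkWord S (x :: y :: l) = mkWord S [x, y] * mkWord S l := rfl
    have e3 : mkWord S ((S.toEquiv (x, y)).1 :: (S.toEquiv (x, y)).2 :: l) =
      mkWord S [(S.toEquiv (x, y)).1, (S.toEquiv (x, y)).2] * mkWord S l := rfl
    rw [passLetter, List.cons_append, e1, ih, ← e1, e3, e2, ← mkWord_pair]

/-- The structure monoid is commutative with respect to its braiding. -/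
theorem braidM_comm (a b : StructureMonoid S) :
    (braidM S (a, b)).1 * (braidM S (a, b)).2 = a * b := by
  obtain ⟨u, rfl⟩ := mkWord_surjective S a
  obtain ⟨v, rfl⟩ := mkWord_surjective S b
  rw [braidM_mkWord]
  simp only [← mkWord_append]
  induction u with
  | nil => simp [passWord]
  | cons x u ih =>
    have e1 : ∀ (z : X) (m : List X), mkWord S (z :: m) = mkWord S [z] * mkWord S m :=
      fun _ _ => rfl
    have e2 : ∀ (z : X) (m n : List X), mkWord S (m ++ z :: n) =
        mkWord S (m ++ [z]) * mkWord S n := fun z m n => by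
      rw [← mkWord_append]; simp
    rw [passWord, e2, mkWord_passLetter, e1, mul_assoc, ← mkWord_append, ih]
    rfl

theorem passLetter_one (u : List (StructureMonoid S)) :
    passLetter (braidM S) 1 u = (u, 1) := by
  induction u with
  | nil => rfl
  | cons y u ih => simp [passLetter, braidM_one_left, ih]

theorem passLetterLeft_one (u : List (StructureMonoid S)) :
    passLetterLeft (braidM S) u 1 = (1, u) := by
  induction u with
  | nil => rfl
  | cons y u ih => simp [passLetterLeft, braidM_one_right, ih]

theorem passLetter_mul (a b : StructureMonoid S) (u : List (StructureMonoid S)) :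
    passLetter (braidM S) (a * b) u =
      ((passLetter (braidM S) a (passLetter (braidM S) b u).1).1,
        (passLetter (braidM S) a (passLetter (braidM S) b u).1).2 *
          (passLetter (braidM S) b u).2) := by
  induction u generalizing a b with
  | nil => rfl
  | cons y u ih => simp [passLetter, braidM_mul_left, ih]

theorem passLetterLeft_mul (u : List (StructureMonoid S)) (a b : StructureMonoid S) :
    passLetterLeft (braidM S) u (a * b) =
      ((passLetterLeft (braidM S) u a).1 *
          (passLetterLeft (braidM S) (passLetterLeft (braidM S) u a).2 b).1,
        (passLetterLeft (braidM S) (passLetterLeft (braidM S) u a).2 b).2) := by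
  induction u with
  | nil => rfl
  | cons y u ih => simp [passLetterLeft, braidM_mul_right, ih]

end BraidedMonoid

/-! ### The braided product of the bar resolution -/

section BarAlgebra

variable (k : Type u) [CommRing k] {X : Type v} (S : Solution X)

/-- The basis element `a ⊗ u ⊗ c` of the bar resolution. -/
def bar (a : StructureMonoid S) (u : List (StructureMonoid S)) (c : StructureMonoid S) : Bar k S :=
  barBasis k S ((a, u), c)

/-- The linear map `t ↦ a ⊗ t ⊗ c` from the tensor algebra to the bar resolution. -/
def barMk (a c : StructureMonoid S) : TensorAlgebra k (AlgA k S) →ₗ[k] Bar k S :=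
  ((TensorProduct.mk k _ _).flip (MonoidAlgebra.of k (StructureMonoid S) c)) ∘ₗ
    TensorProduct.mk k _ _ (MonoidAlgebra.of k (StructureMonoid S) a)

/-- The quantum shuffle product of `-σ` on `T(A)`. -/
abbrev shA : TensorAlgebra k (AlgA k S) →ₗ[k] TensorAlgebra k (AlgA k S) →ₗ[k]
    TensorAlgebra k (AlgA k S) := negShuffle (braidM S) (basisA k S)

/-- The basis of `T(A)` consisting of the words in `M`. -/
abbrev wordA (u : List (StructureMonoid S)) : TensorAlgebra k (AlgA k S) :=
  wordBasis (basisA k S) u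

theorem basisA_apply (m : StructureMonoid S) :
    basisA k S m = MonoidAlgebra.of k (StructureMonoid S) m := by
  simp [MonoidAlgebra.of]

theorem barMk_apply (a c : StructureMonoid S) (t : TensorAlgebra k (AlgA k S)) :
    barMk k S a c t = (MonoidAlgebra.of k (StructureMonoid S) a ⊗ₜ[k] t) ⊗ₜ[k]
      MonoidAlgebra.of k (StructureMonoid S) c := rfl

theorem barMk_word (a c : StructureMonoid S) (u : List (StructureMonoid S)) :
    barMk k S a c (wordA k S u) = bar k S a u c := by
  rw [barMk_apply, bar, barBasis, Basis.tensorProduct_apply, Basis.tensorProduct_apply,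
    basisA_apply, basisA_apply]

theorem barMul_bar (a a' c c' : StructureMonoid S) (u u' : List (StructureMonoid S)) :
    barMul k S (bar k S a u c) (bar k S a' u' c') =
      barMk k S (a * (passLetterLeft (braidM S) u (braidM S (c, a')).1).1)
        ((passLetter (braidM S) (braidM S (c, a')).2 u').2 * c')
        (shA k S (wordA k S (passLetterLeft (braidM S) u (braidM S (c, a')).1).2)
          (wordA k S (passLetter (braidM S) (braidM S (c, a')).2 u').1)) := by
  rw [barMul, bar, bar, Basis.constr_basis, Basis.constr_basis]
  rfl

theorem barMul_barMk_left (a c a' c' : StructureMonoid S) (u v u' : List (StructureMonoid S)) :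
    barMul k S (barMk k S a c (shA k S (wordA k S u) (wordA k S v))) (bar k S a' u' c') =
      barMk k S (a * (passLetterLeft (braidM S) (u ++ v) (braidM S (c, a')).1).1)
        ((passLetter (braidM S) (braidM S (c, a')).2 u').2 * c')
        (shA k S (shA k S
            (wordA k S (passLetterLeft (braidM S) u
              (passLetterLeft (braidM S) v (braidM S (c, a')).1).1).2)
            (wordA k S (passLetterLeft (braidM S) v (braidM S (c, a')).1).2))
          (wordA k S (passLetter (braidM S) (braidM S (c, a')).2 u').1)) := by
  rw [negShuffle_word, map_sum, map_sum, LinearMap.sum_apply, negShuffle_word, map_sum,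
    LinearMap.sum_apply, map_sum, length_passLetterLeft, length_passLetterLeft]
  refine Finset.sum_congr rfl fun s _ => ?_
  simp only [negPermOp, map_smul, LinearMap.smul_apply]
  rw [barMk_word, barMul_bar, passLetterLeft_permAct (isYBE_braidM S), passLetterLeft_append]

theorem barMul_barMk_right (a c a' c' : StructureMonoid S) (u v w : List (StructureMonoid S)) :
    barMul k S (bar k S a u c) (barMk k S a' c' (shA k S (wordA k S v) (wordA k S w))) =
      barMk k S (a * (passLetterLeft (braidM S) u (braidM S (c, a')).1).1)
        ((passLetter (braidM S) (braidM S (c, a')).2 (v ++ w)).2 * c')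
        (shA k S (wordA k S (passLetterLeft (braidM S) u (braidM S (c, a')).1).2)
          (shA k S (wordA k S (passLetter (braidM S) (braidM S (c, a')).2 v).1)
            (wordA k S (passLetter (braidM S)
              (passLetter (braidM S) (braidM S (c, a')).2 v).2 w).1))) := by
  rw [negShuffle_word, map_sum, map_sum, negShuffle_word, map_sum, map_sum, length_passLetter,
    length_passLetter]
  refine Finset.sum_congr rfl fun s _ => ?_
  simp only [negPermOp, map_smul]
  rw [barMk_word, barMul_bar, passLetter_permAct (isYBE_braidM S), passLetter_append]

theorem bar_induction {P : Bar k S → Prop} (t : Bar k S) (zero : P 0)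
    (add : ∀ s t, P s → P t → P (s + t)) (smul : ∀ (c : k) t, P t → P (c • t))
    (bar : ∀ a u c, P (bar k S a u c)) : P t :=
  basis_induction (barBasis k S) t zero add smul fun i => bar i.1.1 i.1.2 i.2

theorem bar_hom_ext {E : Type*} [AddCommMonoid E] [Module k E] {f g : Bar k S →ₗ[k] E}
    (h : ∀ a u c, f (bar k S a u c) = g (bar k S a u c)) : f = g :=
  (barBasis k S).ext fun i => h i.1.1 i.1.2 i.2

theorem barMul_assoc_bar (a c a' c' a'' c'' : StructureMonoid S)
    (u u' u'' : List (StructureMonoid S)) :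
    barMul k S (barMul k S (bar k S a u c) (bar k S a' u' c')) (bar k S a'' u'' c'') =
      barMul k S (bar k S a u c) (barMul k S (bar k S a' u' c') (bar k S a'' u'' c'')) := by
  obtain ⟨h1, h2, h3⟩ := passLetter_passLetterLeft (isYBE_braidM S) (braidM S (c, a')).2 u'
    (braidM S (c', a'')).1
  rw [barMul_bar, barMul_bar, barMul_barMk_left, barMul_barMk_right,
    negShuffle_assoc _ (isYBE_braidM S)]
  simp only [braidM_mul_left, braidM_mul_right, passLetter_mul, passLetterLeft_mul,
    passLetterLeft_append, passLetter_append]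
  rw [h1, h2, h3]
  simp only [mul_assoc]

theorem barMul_assoc (p q s : Bar k S) :
    barMul k S (barMul k S p q) s = barMul k S p (barMul k S q s) := by
  induction p using bar_induction with
  | zero => simp
  | add s s' hs hs' => simp only [map_add, LinearMap.add_apply, hs, hs']
  | smul c s hs => simp only [map_smul, LinearMap.smul_apply, hs]
  | bar a u c =>
    induction q using bar_induction with
    | zero => simp
    | add s s' hs hs' => simp only [map_add, LinearMap.add_apply, hs, hs']
    | smul c s hs => simp only [map_smul, LinearMap.smul_apply, hs]
    | bar a' u' c' =>
      induction s using bar_induction with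
      | zero => simp
      | add s s' hs hs' => simp only [map_add, hs, hs']
      | smul c s hs => simp only [map_smul, hs]
      | bar a'' u'' c'' => exact barMul_assoc_bar k S a c a' c' a'' c'' u u' u''

theorem wordA_nil : wordA k S [] = 1 := wordBasis_nil _

theorem barOne_eq : barOne k S = bar k S 1 [] 1 := by
  rw [← barMk_word, wordA_nil, barMk_apply, map_one, barOne]

theorem barMul_bar_left (a b c : StructureMonoid S) (u : List (StructureMonoid S)) :
    barMul k S (bar k S a [] 1) (bar k S b u c) = bar k S (a * b) u c := by
  rw [barMul_bar, braidM_one_left, passLetter_one, passLetterLeft, wordA_nil,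
    negShuffle_one_left, barMk_word, one_mul]

theorem barMul_bar_right (a c d : StructureMonoid S) (u : List (StructureMonoid S)) :
    barMul k S (bar k S a u c) (bar k S 1 [] d) = bar k S a u (c * d) := by
  rw [barMul_bar, braidM_one_right, passLetterLeft_one, passLetter, wordA_nil,
    negShuffle_one_right, barMk_word, mul_one]

theorem barMul_right_bar (b c d : StructureMonoid S) (u : List (StructureMonoid S)) :
    barMul k S (bar k S 1 [] c) (bar k S b u d) =
      bar k S (braidM S (c, b)).1 (passLetter (braidM S) (braidM S (c, b)).2 u).1
        ((passLetter (braidM S) (braidM S (c, b)).2 u).2 * d) := by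
  rw [barMul_bar, passLetterLeft, wordA_nil, negShuffle_one_left, barMk_word, one_mul]

theorem barMul_left_bar (a c y : StructureMonoid S) (u : List (StructureMonoid S)) :
    barMul k S (bar k S a u c) (bar k S y [] 1) =
      bar k S (a * (passLetterLeft (braidM S) u (braidM S (c, y)).1).1)
        (passLetterLeft (braidM S) u (braidM S (c, y)).1).2 (braidM S (c, y)).2 := by
  rw [barMul_bar, passLetter, wordA_nil, negShuffle_one_right, barMk_word, mul_one]

theorem barMul_one_left (p : Bar k S) : barMul k S (barOne k S) p = p := by
  rw [barOne_eq]
  suffices h : barMul k S (bar k S 1 [] 1) = LinearMap.id by rw [h]; rfl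
  exact bar_hom_ext k S fun a u c => by rw [barMul_bar_left, one_mul]; rfl

theorem barMul_one_right (p : Bar k S) : barMul k S p (barOne k S) = p := by
  rw [barOne_eq]
  suffices h : (barMul k S).flip (bar k S 1 [] 1) = LinearMap.id from LinearMap.congr_fun h p
  exact bar_hom_ext k S fun a u c => by
    rw [LinearMap.flip_apply, barMul_bar_right, mul_one]; rfl

/-- The bar resolution, considered as a ring with the braided product. It is a type of its own since
`Bar` carries the multiplication of a tensor product of algebras. -/
def BarAlg : Type (max u v) := Bar k S

instance : AddCommGroup (BarAlg k S) := inferInstanceAs (AddCommGroup (Bar k S))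

instance : Module k (BarAlg k S) := inferInstanceAs (Module k (Bar k S))

instance : Ring (BarAlg k S) :=
  { (inferInstance : AddCommGroup (BarAlg k S)) with
    mul := fun p q => barMul k S p q
    one := barOne k S
    mul_assoc := barMul_assoc k S
    one_mul := barMul_one_left k S
    mul_one := barMul_one_right k S
    left_distrib := fun p q s => map_add (barMul k S p) q s
    right_distrib := fun p q s => LinearMap.map_add₂ (barMul k S) p q s
    zero_mul := fun p => LinearMap.map_zero₂ (barMul k S) p
    mul_zero := fun p => map_zero (barMul k S p) }

instance : Algebra k (BarAlg k S) :=
  Algebra.ofModule (fun r p q => LinearMap.map_smul₂ (barMul k S) r p q)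
    (fun r p q => map_smul (barMul k S p) r q)

/-- The basis of the ring `BarAlg`. -/
def barAlgBasis : Basis ((StructureMonoid S × List (StructureMonoid S)) × StructureMonoid S) k
    (BarAlg k S) := barBasis k S

/-- The basis element `a ⊗ u ⊗ c` of the ring `BarAlg`. -/
def barE (a : StructureMonoid S) (u : List (StructureMonoid S)) (c : StructureMonoid S) :
    BarAlg k S := barAlgBasis k S ((a, u), c)

/-- The linear map `t ↦ a ⊗ t ⊗ c` from the tensor algebra to the ring `BarAlg`. -/
def barMkE (a c : StructureMonoid S) : TensorAlgebra k (AlgA k S) →ₗ[k] BarAlg k S :=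
  barMk k S a c

theorem barMkE_word (a c : StructureMonoid S) (u : List (StructureMonoid S)) :
    barMkE k S a c (wordA k S u) = barE k S a u c := barMk_word k S a c u

theorem barE_mul (a a' c c' : StructureMonoid S) (u u' : List (StructureMonoid S)) :
    barE k S a u c * barE k S a' u' c' =
      barMkE k S (a * (passLetterLeft (braidM S) u (braidM S (c, a')).1).1)
        ((passLetter (braidM S) (braidM S (c, a')).2 u').2 * c')
        (shA k S (wordA k S (passLetterLeft (braidM S) u (braidM S (c, a')).1).2)
          (wordA k S (passLetter (braidM S) (braidM S (c, a')).2 u').1)) :=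
  barMul_bar k S a a' c c' u u'

theorem left_mul_barE (a b c : StructureMonoid S) (u : List (StructureMonoid S)) :
    barE k S a [] 1 * barE k S b u c = barE k S (a * b) u c := barMul_bar_left k S a b c u

theorem barE_mul_right (a c d : StructureMonoid S) (u : List (StructureMonoid S)) :
    barE k S a u c * barE k S 1 [] d = barE k S a u (c * d) := barMul_bar_right k S a c d u

theorem right_mul_barE (b c d : StructureMonoid S) (u : List (StructureMonoid S)) :
    barE k S 1 [] c * barE k S b u d =
      barE k S (braidM S (c, b)).1 (passLetter (braidM S) (braidM S (c, b)).2 u).1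
        ((passLetter (braidM S) (braidM S (c, b)).2 u).2 * d) := barMul_right_bar k S b c d u

theorem barE_mul_left (a c y : StructureMonoid S) (u : List (StructureMonoid S)) :
    barE k S a u c * barE k S y [] 1 =
      barE k S (a * (passLetterLeft (braidM S) u (braidM S (c, y)).1).1)
        (passLetterLeft (braidM S) u (braidM S (c, y)).1).2 (braidM S (c, y)).2 :=
  barMul_left_bar k S a c y u

theorem barE_one : barE k S 1 [] 1 = 1 := (barOne_eq k S).symm

theorem barE_induction {P : BarAlg k S → Prop} (t : BarAlg k S) (zero : P 0)
    (add : ∀ s t, P s → P t → P (s + t)) (smul : ∀ (c : k) t, P t → P (c • t))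
    (bar : ∀ a u c, P (barE k S a u c)) : P t :=
  basis_induction (barAlgBasis k S) t zero add smul fun i => bar i.1.1 i.1.2 i.2

theorem barAlg_hom_ext {E : Type*} [AddCommMonoid E] [Module k E] {f g : BarAlg k S →ₗ[k] E}
    (h : ∀ a u c, f (barE k S a u c) = g (barE k S a u c)) : f = g :=
  (barAlgBasis k S).ext fun i => h i.1.1 i.1.2 i.2

end BarAlgebra

/-! ### Internal gradings -/

section Gradings

variable {k : Type u} [CommRing k]

/-- A spanning family of submodules is a grading if there are projections onto its members which
vanish on the other members. -/
theorem isInternal_of_projections {E : Type*} [AddCommGroup E] [Module k E]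
    (gr : ℕ → Submodule k E) (π : ℕ → E →ₗ[k] E) (h1 : ∀ n, ∀ x ∈ gr n, π n x = x)
    (h0 : ∀ n m, m ≠ n → ∀ x ∈ gr m, π n x = 0) (htop : ⨆ n, gr n = ⊤) :
    DirectSum.IsInternal gr := by
  rw [DirectSum.isInternal_submodule_iff_iSupIndep_and_iSup_eq_top]
  refine ⟨fun n => ?_, htop⟩
  rw [Submodule.disjoint_def]
  intro x hx hx'
  have hle : ⨆ m, ⨆ (_ : m ≠ n), gr m ≤ LinearMap.ker (π n) :=
    iSup₂_le fun m hm x hx => h0 n m hm x hx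
  rw [← h1 n x hx]
  exact hle hx'

variable {ι E : Type*} [AddCommGroup E] [Module k E]

/-- The span of the basis vectors of degree `n`. -/
def basisGrading (b : Basis ι k E) (deg : ι → ℕ) (n : ℕ) : Submodule k E :=
  Submodule.span k {x | ∃ i, deg i = n ∧ x = b i}

/-- The projection onto the span of the basis vectors of degree `n`. -/
def basisProj (b : Basis ι k E) (deg : ι → ℕ) (n : ℕ) : E →ₗ[k] E :=
  b.constr k fun i => if deg i = n then b i else 0

theorem basisProj_basis (b : Basis ι k E) (deg : ι → ℕ) (n : ℕ) (i : ι) :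
    basisProj b deg n (b i) = if deg i = n then b i else 0 := by
  simp [basisProj]

theorem basisProj_of_mem (b : Basis ι k E) (deg : ι → ℕ) (n m : ℕ) (x : E)
    (hx : x ∈ basisGrading b deg m) : basisProj b deg n x = if m = n then x else 0 := by
  induction hx using Submodule.span_induction with
  | mem x hx => obtain ⟨i, rfl, rfl⟩ := hx; exact basisProj_basis b deg n i
  | zero => simp
  | add s t _ _ hs ht => rw [map_add, hs, ht]; split_ifs <;> simp
  | smul c t _ ht => rw [map_smul, ht]; split_ifs <;> simp

theorem iSup_basisGrading (b : Basis ι k E) (deg : ι → ℕ) : ⨆ n, basisGrading b deg n = ⊤ := by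
  rw [eq_top_iff, ← b.span_eq, Submodule.span_le]
  rintro _ ⟨i, rfl⟩
  exact Submodule.mem_iSup_of_mem (deg i) (Submodule.subset_span ⟨i, rfl, rfl⟩)

theorem isInternal_basisGrading (b : Basis ι k E) (deg : ι → ℕ) :
    DirectSum.IsInternal (basisGrading b deg) := by
  refine isInternal_of_projections _ (basisProj b deg) (fun n x hx => ?_) (fun n m h x hx => ?_)
    (iSup_basisGrading b deg)
  · rw [basisProj_of_mem b deg n n x hx, if_pos rfl]
  · rw [basisProj_of_mem b deg n m x hx, if_neg h]

theorem sandwichGrading_eq_span (A : Type*) [Ring A] [Algebra k A] {I : Type*} (bA : Basis I k A)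
    {T : Type*} [AddCommMonoid T] [Module k T] (P : ℕ → Submodule k T) (n : ℕ) (G : Set T)
    (hG : P n = Submodule.span k G) :
    sandwichGrading A P n =
      Submodule.span k {z | ∃ i j, ∃ t ∈ G, z = (bA i ⊗ₜ[k] t) ⊗ₜ[k] bA j} := by
  apply le_antisymm
  · refine Submodule.span_le.2 ?_
    rintro _ ⟨a, t, ht, c, rfl⟩
    rw [hG] at ht
    rw [SetLike.mem_coe]
    induction ht using Submodule.span_induction with
    | mem t ht =>
      induction a using basis_induction bA with
      | zero => simp
      | add a a' h h' => rw [TensorProduct.add_tmul, TensorProduct.add_tmul]; exact add_mem h h'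
      | smul r a h =>
        rw [← TensorProduct.smul_tmul', ← TensorProduct.smul_tmul']
        exact Submodule.smul_mem _ _ h
      | basis i =>
        induction c using basis_induction bA with
        | zero => simp
        | add a a' h h' => rw [TensorProduct.tmul_add]; exact add_mem h h'
        | smul r a h => rw [TensorProduct.tmul_smul]; exact Submodule.smul_mem _ _ h
        | basis j => exact Submodule.subset_span ⟨i, j, t, ht, rfl⟩
    | zero => simp
    | add s t _ _ hs ht =>
      rw [TensorProduct.tmul_add, TensorProduct.add_tmul]; exact add_mem hs ht
    | smul r t _ ht =>
      rw [TensorProduct.tmul_smul, ← TensorProduct.smul_tmul']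
      exact Submodule.smul_mem _ _ ht
  · refine Submodule.span_le.2 ?_
    rintro _ ⟨i, j, t, ht, rfl⟩
    exact Submodule.subset_span ⟨bA i, t, by rw [hG]; exact Submodule.subset_span ht, bA j, rfl⟩

end Gradings

/-! ### The bar resolution as a differential graded algebra -/

section BarDG

variable (k : Type u) [CommRing k] {X : Type v} (S : Solution X)

/-- The grading of the ring `BarAlg`. -/
def barGradingE (n : ℕ) : Submodule k (BarAlg k S) := barGrading k S n

/-- The bar differential on the ring `BarAlg`. -/
def barDiffE : BarAlg k S →ₗ[k] BarAlg k S := barDiff k S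

/-- The augmentation of the ring `BarAlg`. -/
def barAugE : BarAlg k S →ₗ[k] AlgA k S := barAug k S

theorem barBasis_apply (i j : StructureMonoid S) (l : List (StructureMonoid S)) :
    barBasis k S ((i, l), j) =
      (basisA k S i ⊗ₜ[k] wordBasis (basisA k S) l) ⊗ₜ[k] basisA k S j := by
  rw [barBasis, Basis.tensorProduct_apply, Basis.tensorProduct_apply]

theorem barGradingE_eq (n : ℕ) : barGradingE k S n =
    basisGrading (barAlgBasis k S) (fun i => i.1.2.length) n := by
  refine (sandwichGrading_eq_span _ (basisA k S) _ n _
    (tensorDeg_eq_span (basisA k S) n)).trans ?_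
  refine congrArg (Submodule.span k) ?_
  ext z
  constructor
  · rintro ⟨i, j, _, ⟨l, hl, rfl⟩, rfl⟩
    exact ⟨((i, l), j), hl, (barBasis_apply k S i j l).symm⟩
  · rintro ⟨⟨⟨i, l⟩, j⟩, hl, rfl⟩
    exact ⟨i, j, _, ⟨l, hl, rfl⟩, barBasis_apply k S i j l⟩

theorem bar_mem (a c : StructureMonoid S) (u : List (StructureMonoid S)) :
    barE k S a u c ∈ barGradingE k S u.length := by
  rw [barGradingE_eq]
  exact Submodule.subset_span ⟨_, rfl, rfl⟩

theorem barGrading_induction {n : ℕ} {P : (t : BarAlg k S) → t ∈ barGradingE k S n → Prop}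
    (zero : P 0 (zero_mem _))
    (add : ∀ s t hs ht, P s hs → P t ht → P (s + t) (add_mem hs ht))
    (smul : ∀ (c : k) t ht, P t ht → P (c • t) (Submodule.smul_mem _ c ht))
    (bar : ∀ a u c, (hu : u.length = n) → P (barE k S a u c) (hu ▸ bar_mem k S a c u))
    (t : BarAlg k S) (ht : t ∈ barGradingE k S n) : P t ht := by
  have ht' := ht
  rw [barGradingE_eq] at ht'
  have key : ∃ h, P t h := by
    induction ht' using Submodule.span_induction with
    | mem x hx => obtain ⟨i, hi, rfl⟩ := hx; exact ⟨_, bar i.1.1 i.1.2 i.2 hi⟩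
    | zero => exact ⟨_, zero⟩
    | add s t hs ht ihs iht =>
      obtain ⟨hs, ihs⟩ := ihs (by rwa [barGradingE_eq])
      obtain ⟨ht, iht⟩ := iht (by rwa [barGradingE_eq])
      exact ⟨_, add s t _ _ ihs iht⟩
    | smul c t ht iht =>
      obtain ⟨ht, iht⟩ := iht (by rwa [barGradingE_eq])
      exact ⟨_, smul c t _ iht⟩
  exact key.2

theorem barMk_mem (a c : StructureMonoid S) (n : ℕ) (t : TensorAlgebra k (AlgA k S))
    (ht : t ∈ tensorDeg k (AlgA k S) n) : barMkE k S a c t ∈ barGradingE k S n := by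
  change barMk k S a c t ∈ barGrading k S n
  exact Submodule.subset_span ⟨_, t, ht, _, rfl⟩

theorem barAlg_mul_mem (m n : ℕ) (p : BarAlg k S) (hp : p ∈ barGradingE k S m) (q : BarAlg k S)
    (hq : q ∈ barGradingE k S n) : p * q ∈ barGradingE k S (m + n) := by
  induction p, hp using barGrading_induction with
  | zero => simp
  | add s t _ _ hs ht => rw [add_mul]; exact add_mem hs ht
  | smul c t _ ht => rw [smul_mul_assoc]; exact Submodule.smul_mem _ _ ht
  | bar a u c hu =>
    induction q, hq using barGrading_induction with
    | zero => simp
    | add s t _ _ hs ht => rw [mul_add]; exact add_mem hs ht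
    | smul c t _ ht => rw [mul_smul_comm]; exact Submodule.smul_mem _ _ ht
    | bar a' u' c' hu' =>
      rw [barE_mul]
      refine barMk_mem k S _ _ _ _ ?_
      have := negShuffle_word_mem (r := braidM S) (basisA k S)
        (passLetterLeft (braidM S) u (braidM S (c, a')).1).2
        (passLetter (braidM S) (braidM S (c, a')).2 u').1
      rwa [length_passLetterLeft, length_passLetter, hu, hu'] at this

/-- Associativity in a form in which rewriting does not have to search for the ring structure of
`BarAlg`. -/
theorem barAlg_mul_assoc (p q s : BarAlg k S) : p * q * s = p * (q * s) := mul_assoc p q s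

/-- The contracting homotopy `a ⊗ u ⊗ c ↦ 1 ⊗ a u ⊗ c` of the bar resolution. -/
def barHomotopy : BarAlg k S →ₗ[k] BarAlg k S :=
  (barAlgBasis k S).constr k fun i => barE k S 1 (i.1.1 :: i.1.2) i.2

/-- The contracting homotopy `a ⊗ u ⊗ c ↦ a ⊗ u c ⊗ 1` of the bar resolution. -/
def barHomotopyRight : BarAlg k S →ₗ[k] BarAlg k S :=
  (barAlgBasis k S).constr k fun i => barE k S i.1.1 (i.1.2 ++ [i.2]) 1

/-- The parity automorphism of the bar resolution. -/
def barParity : BarAlg k S →ₗ[k] BarAlg k S :=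
  (barAlgBasis k S).constr k fun i => (-1 : k) ^ i.1.2.length • barE k S i.1.1 i.1.2 i.2

/-- The section `c ↦ 1 ⊗ 1 ⊗ c` of the augmentation. -/
def barSection : AlgA k S →ₗ[k] BarAlg k S :=
  (basisA k S).constr k fun c => barE k S 1 [] c

/-- The section `a ↦ a ⊗ 1 ⊗ 1` of the augmentation. -/
def barSectionRight : AlgA k S →ₗ[k] BarAlg k S :=
  (basisA k S).constr k fun a => barE k S a [] 1

variable (a c d : StructureMonoid S) (u l : List (StructureMonoid S)) (p q : BarAlg k S)

theorem barHomotopy_bar : barHomotopy k S (barE k S a u c) = barE k S 1 (a :: u) c := by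
  rw [barHomotopy, barE, Basis.constr_basis]

theorem barHomotopyRight_bar :
    barHomotopyRight k S (barE k S a u c) = barE k S a (u ++ [c]) 1 := by
  rw [barHomotopyRight, barE, Basis.constr_basis]

theorem barParity_bar : barParity k S (barE k S a u c) =
    (-1 : k) ^ u.length • barE k S a u c := by
  rw [barParity, barE, Basis.constr_basis]
  rfl

theorem barSection_of :
    barSection k S (MonoidAlgebra.of k (StructureMonoid S) c) = barE k S 1 [] c := by
  rw [barSection, ← basisA_apply, Basis.constr_basis]

theorem barSectionRight_of :
    barSectionRight k S (MonoidAlgebra.of k (StructureMonoid S) c) = barE k S c [] 1 := by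
  rw [barSectionRight, ← basisA_apply, Basis.constr_basis]

theorem barAug_bar_nil : barAugE k S (barE k S a [] c) =
    MonoidAlgebra.of k (StructureMonoid S) (a * c) := by
  change barAug k S (barBasis k S _) = _
  rw [barAug, Basis.constr_basis]

theorem barAug_bar_cons : barAugE k S (barE k S a (d :: u) c) = 0 := by
  change barAug k S (barBasis k S _) = _
  rw [barAug, Basis.constr_basis]

theorem barDiff_bar : barDiffE k S (barE k S a u c) = barDiffFun k S a u c := by
  change barDiff k S (barBasis k S _) = _
  rw [barDiff, Basis.constr_basis]

theorem barDiff_bar_nil : barDiffE k S (barE k S a [] c) = 0 := barDiff_bar k S a c []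

theorem barDiff_bar_cons : barDiffE k S (barE k S a (d :: l) c) =
    barE k S (a * d) l c +
      ∑ i ∈ Finset.range l.length,
        (-1 : k) ^ (i + 1) • barE k S a (mergeAt i (d :: l)) c +
      (-1 : k) ^ (l.length + 1) • barE k S a (d :: l).dropLast
        ((d :: l).getLast (List.cons_ne_nil d l) * c) := barDiff_bar k S a c (d :: l)

theorem barDiff_leftMul : barDiffE k S (barE k S a [] 1 * p) =
    barE k S a [] 1 * barDiffE k S p := by
  suffices h : barDiffE k S ∘ₗ LinearMap.mulLeft k (barE k S a [] 1) =
      LinearMap.mulLeft k (barE k S a [] 1) ∘ₗ barDiffE k S from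
    LinearMap.congr_fun h p
  refine barAlg_hom_ext k S fun b u c => ?_
  rw [LinearMap.comp_apply, LinearMap.comp_apply, LinearMap.mulLeft_apply,
    LinearMap.mulLeft_apply, left_mul_barE]
  rcases u with _ | ⟨d, u⟩
  · rw [barDiff_bar_nil, barDiff_bar_nil, mul_zero]
  · rw [barDiff_bar_cons, barDiff_bar_cons]
    simp only [mul_add, Finset.mul_sum, mul_smul_comm, left_mul_barE, mul_assoc]

/-- The map `a ⊗ u ⊗ c ↦ 1 ⊗ a u ⊗ c` is a contracting homotopy. Since `b'` commutes
with left multiplication by `a ⊗ 1 ⊗ 1` and every basis element of positive degree is the product of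
such an element with a value of the homotopy (`bar_cons_eq`), this determines `b'` recursively. -/
theorem barDiff_barHomotopy : barDiffE k S (barHomotopy k S p) =
    p - barHomotopy k S (barDiffE k S p) - barSection k S (barAugE k S p) := by
  suffices h : barDiffE k S ∘ₗ barHomotopy k S =
      LinearMap.id - barHomotopy k S ∘ₗ barDiffE k S - barSection k S ∘ₗ barAugE k S from
    LinearMap.congr_fun h p
  refine barAlg_hom_ext k S fun a u c => ?_
  simp only [LinearMap.comp_apply, LinearMap.sub_apply, LinearMap.id_apply, barHomotopy_bar]
  rcases u with _ | ⟨d, u⟩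
  · rw [barDiff_bar_cons, barDiff_bar_nil, barAug_bar_nil, barSection_of]
    simp [sub_eq_add_neg]
  · rw [barDiff_bar_cons, barDiff_bar_cons, barAug_bar_cons, List.length_cons,
      Finset.sum_range_succ']
    simp only [map_add, barHomotopy_bar, one_mul, map_zero, mergeAt,
      List.dropLast_cons_cons, List.getLast_cons_cons, pow_succ _ (_ + 1), zero_add,
      mul_neg, mul_one, neg_smul, Finset.sum_neg_distrib, one_smul, pow_zero, pow_succ]
    simp only [neg_neg, map_neg, map_sum, map_smul, barHomotopy_bar]
    abel

theorem barAug_leftMul : barAugE k S (barE k S a [] 1 * p) =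
    MonoidAlgebra.of k (StructureMonoid S) a * barAugE k S p := by
  suffices h : barAugE k S ∘ₗ LinearMap.mulLeft k (barE k S a [] 1) =
      LinearMap.mulLeft k (MonoidAlgebra.of k (StructureMonoid S) a) ∘ₗ barAugE k S from
    LinearMap.congr_fun h p
  refine barAlg_hom_ext k S fun b u c => ?_
  rw [LinearMap.comp_apply, LinearMap.comp_apply, LinearMap.mulLeft_apply,
    LinearMap.mulLeft_apply, left_mul_barE]
  rcases u with _ | ⟨d, u⟩
  · rw [barAug_bar_nil, barAug_bar_nil, ← map_mul, mul_assoc]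
  · rw [barAug_bar_cons, barAug_bar_cons, mul_zero]

theorem barAug_barHomotopy : barAugE k S (barHomotopy k S p) = 0 := by
  suffices h : barAugE k S ∘ₗ barHomotopy k S = 0 from
    LinearMap.congr_fun h p
  refine barAlg_hom_ext k S fun b u c => ?_
  rw [LinearMap.comp_apply, barHomotopy_bar, barAug_bar_cons, LinearMap.zero_apply]

theorem barAug_barSection (x : AlgA k S) : barAugE k S (barSection k S x) = x := by
  suffices h : barAugE k S ∘ₗ barSection k S = LinearMap.id from LinearMap.congr_fun h x
  refine (basisA k S).ext fun c => ?_
  rw [LinearMap.comp_apply, basisA_apply, barSection_of, barAug_bar_nil, one_mul]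
  rfl

theorem barDiff_barSection (x : AlgA k S) : barDiffE k S (barSection k S x) = 0 := by
  suffices h : barDiffE k S ∘ₗ barSection k S = 0 from LinearMap.congr_fun h x
  refine (basisA k S).ext fun c => ?_
  rw [LinearMap.comp_apply, basisA_apply, barSection_of, barDiff_bar_nil, LinearMap.zero_apply]

theorem bar_cons_eq : barE k S a (d :: u) c =
    barE k S a [] 1 * barHomotopy k S (barE k S d u c) := by
  rw [barHomotopy_bar, left_mul_barE, mul_one]

theorem barAug_barDiff : barAugE k S (barDiffE k S p) = 0 := by
  suffices h : barAugE k S ∘ₗ barDiffE k S = 0 from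
    LinearMap.congr_fun h p
  refine barAlg_hom_ext k S fun b u c => ?_
  rw [LinearMap.comp_apply, LinearMap.zero_apply]
  rcases u with _ | ⟨d, u⟩
  · rw [barDiff_bar_nil, map_zero]
  · rw [bar_cons_eq, barDiff_leftMul, barAug_leftMul, barDiff_barHomotopy, map_sub, map_sub,
      barAug_barHomotopy, barAug_barSection, sub_zero, sub_self, mul_zero]

theorem barDiff_barDiff : barDiffE k S (barDiffE k S p) = 0 := by
  suffices h : barDiffE k S ∘ₗ barDiffE k S = 0 from
    LinearMap.congr_fun h p
  refine barAlg_hom_ext k S fun b u c => ?_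
  rw [LinearMap.comp_apply, LinearMap.zero_apply]
  induction u generalizing b with
  | nil => rw [barDiff_bar_nil, map_zero]
  | cons d u ih =>
    rw [bar_cons_eq, barDiff_leftMul, barDiff_leftMul, barDiff_barHomotopy, map_sub, map_sub,
      barDiff_barHomotopy, ih d, barDiff_barSection, barAug_barDiff]
    simp

theorem barHomotopy_mem (n : ℕ) (hp : p ∈ barGradingE k S n) :
    barHomotopy k S p ∈ barGradingE k S (n + 1) := by
  induction p, hp using barGrading_induction with
  | zero => simp
  | add s t _ _ hs ht => rw [map_add]; exact add_mem hs ht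
  | smul c t _ ht => rw [map_smul]; exact Submodule.smul_mem _ _ ht
  | bar a u c hu => rw [barHomotopy_bar, ← hu]; exact bar_mem k S 1 c (a :: u)

theorem barDiff_bar_mem (n : ℕ) (hu : u.length = n + 1) :
    barDiffE k S (barE k S a u c) ∈ barGradingE k S n := by
  induction u generalizing a n with
  | nil => simp at hu
  | cons d u ih =>
    have hn : u.length = n := by simpa using hu
    rw [bar_cons_eq, barDiff_leftMul, barDiff_barHomotopy, ← zero_add n]
    refine barAlg_mul_mem k S 0 n _ (bar_mem k S a 1 []) _ ?_
    refine sub_mem (sub_mem (hn ▸ bar_mem k S d c u) ?_) ?_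
    · rcases n with _ | n
      · obtain rfl := List.length_eq_zero_iff.1 hn
        rw [barDiff_bar_nil, map_zero]; exact zero_mem _
      · exact barHomotopy_mem k S _ _ (ih d n hn)
    · rcases u with _ | ⟨e, u⟩
      · rw [barAug_bar_nil, barSection_of, ← hn]; exact bar_mem k S _ _ []
      · rw [barAug_bar_cons, map_zero]; exact zero_mem _

theorem barDiff_mem (n : ℕ) (hp : p ∈ barGradingE k S (n + 1)) :
    barDiffE k S p ∈ barGradingE k S n := by
  induction p, hp using barGrading_induction with
  | zero => simp
  | add s t _ _ hs ht => rw [map_add]; exact add_mem hs ht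
  | smul c t _ ht => rw [map_smul]; exact Submodule.smul_mem _ _ ht
  | bar a u c hu => exact barDiff_bar_mem k S a c u n hu

theorem barDiff_of_mem_zero (hp : p ∈ barGradingE k S 0) : barDiffE k S p = 0 := by
  induction p, hp using barGrading_induction with
  | zero => simp
  | add s t _ _ hs ht => rw [map_add, hs, ht, add_zero]
  | smul c t _ ht => rw [map_smul, ht, smul_zero]
  | bar a u c hu => obtain rfl := List.length_eq_zero_iff.1 hu; exact barDiff_bar_nil k S a c

theorem barAug_of_mem (n : ℕ) (hp : p ∈ barGradingE k S (n + 1)) : barAugE k S p = 0 := by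
  induction p, hp using barGrading_induction with
  | zero => simp
  | add s t _ _ hs ht => rw [map_add, hs, ht, add_zero]
  | smul c t _ ht => rw [map_smul, ht, smul_zero]
  | bar a u c hu =>
    obtain ⟨d, u, rfl⟩ := List.exists_cons_of_length_eq_add_one hu
    exact barAug_bar_cons k S a c d u

/-! ### The Leibniz rule for the bar differential -/

theorem barHomotopyRight_barHomotopy :
    barHomotopyRight k S (barHomotopy k S p) = barHomotopy k S (barHomotopyRight k S p) := by
  suffices h : barHomotopyRight k S ∘ₗ barHomotopy k S = barHomotopy k S ∘ₗ barHomotopyRight k S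
    from LinearMap.congr_fun h p
  refine barAlg_hom_ext k S fun b u c => ?_
  simp only [LinearMap.comp_apply, barHomotopy_bar, barHomotopyRight_bar, List.cons_append]

theorem barHomotopyRight_leftMul : barHomotopyRight k S (barE k S a [] 1 * p) =
    barE k S a [] 1 * barHomotopyRight k S p := by
  suffices h : barHomotopyRight k S ∘ₗ LinearMap.mulLeft k (barE k S a [] 1) =
      LinearMap.mulLeft k (barE k S a [] 1) ∘ₗ barHomotopyRight k S from
    LinearMap.congr_fun h p
  refine barAlg_hom_ext k S fun b u c => ?_
  simp only [LinearMap.comp_apply, LinearMap.mulLeft_apply, left_mul_barE, barHomotopyRight_bar]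

theorem barHomotopyRight_barSection (x : AlgA k S) :
    barHomotopyRight k S (barSection k S x) = barHomotopy k S (barSectionRight k S x) := by
  suffices h : barHomotopyRight k S ∘ₗ barSection k S = barHomotopy k S ∘ₗ barSectionRight k S
    from LinearMap.congr_fun h x
  refine (basisA k S).ext fun c => ?_
  simp only [LinearMap.comp_apply, basisA_apply, barSection_of, barSectionRight_of,
    barHomotopy_bar, barHomotopyRight_bar, List.nil_append]

theorem barAug_barHomotopyRight : barAugE k S (barHomotopyRight k S p) = 0 := by
  suffices h : barAugE k S ∘ₗ barHomotopyRight k S = 0 from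
    LinearMap.congr_fun h p
  refine barAlg_hom_ext k S fun b u c => ?_
  rw [LinearMap.comp_apply, barHomotopyRight_bar, LinearMap.zero_apply]
  rcases u with _ | ⟨d, u⟩
  · exact barAug_bar_cons k S _ _ _ _
  · exact barAug_bar_cons k S _ _ _ _

/-- The map `a ⊗ u ⊗ c ↦ a ⊗ u c ⊗ 1` is a contracting homotopy, up to signs. -/
theorem barDiff_barHomotopyRight : barDiffE k S (barHomotopyRight k S p) =
    barHomotopyRight k S (barDiffE k S p) - barParity k S p +
      barSectionRight k S (barAugE k S p) := by
  suffices h : barDiffE k S ∘ₗ barHomotopyRight k S =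
      barHomotopyRight k S ∘ₗ barDiffE k S - barParity k S + barSectionRight k S ∘ₗ barAugE k S from
    LinearMap.congr_fun h p
  refine barAlg_hom_ext k S fun a u c => ?_
  simp only [LinearMap.comp_apply, LinearMap.sub_apply, LinearMap.add_apply]
  induction u generalizing a with
  | nil =>
    rw [barHomotopyRight_bar, List.nil_append, barDiff_bar_cons, barDiff_bar_nil,
      barParity_bar, barAug_bar_nil, barSectionRight_of]
    simp
    abel
  | cons d u ih =>
    have hγ : barParity k S (barE k S a [] 1 * barHomotopy k S (barE k S d u c)) =
        barE k S a [] 1 * ((-1 : k) ^ (u.length + 1) • barHomotopy k S (barE k S d u c)) := by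
      rw [← bar_cons_eq, barParity_bar, bar_cons_eq, mul_smul_comm, List.length_cons]
    rw [bar_cons_eq, hγ, barHomotopyRight_leftMul, barHomotopyRight_barHomotopy, barDiff_leftMul,
      barDiff_leftMul, barDiff_barHomotopy, barDiff_barHomotopy, ih d, barHomotopyRight_leftMul,
      barAug_barHomotopyRight, map_zero, ← bar_cons_eq, barAug_bar_cons, map_zero, add_zero,
      ← mul_sub]
    congr 1
    simp only [map_sub, map_add, barHomotopyRight_barHomotopy, barHomotopyRight_barSection,
      barParity_bar, map_smul, pow_succ, mul_neg, mul_one, neg_smul]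
    abel

theorem barDiff_rightMul : barDiffE k S (p * barE k S 1 [] d) =
    barDiffE k S p * barE k S 1 [] d := by
  suffices h : barDiffE k S ∘ₗ LinearMap.mulRight k (barE k S 1 [] d) =
      LinearMap.mulRight k (barE k S 1 [] d) ∘ₗ barDiffE k S from
    LinearMap.congr_fun h p
  refine barAlg_hom_ext k S fun b u c => ?_
  rw [LinearMap.comp_apply, LinearMap.comp_apply, LinearMap.mulRight_apply,
    LinearMap.mulRight_apply, barE_mul_right]
  rcases u with _ | ⟨e, u⟩
  · rw [barDiff_bar_nil, barDiff_bar_nil, zero_mul]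
  · rw [barDiff_bar_cons, barDiff_bar_cons]
    simp only [add_mul, Finset.sum_mul, smul_mul_assoc, barE_mul_right, mul_assoc]

theorem rightMul_barHomotopy :
    barE k S 1 [] c * barHomotopy k S p =
      barHomotopy k S (barE k S 1 [] c * p) := by
  suffices h : LinearMap.mulLeft k (barE k S 1 [] c) ∘ₗ barHomotopy k S =
      barHomotopy k S ∘ₗ LinearMap.mulLeft k (barE k S 1 [] c) from
    LinearMap.congr_fun h p
  refine barAlg_hom_ext k S fun b u d => ?_
  simp only [LinearMap.comp_apply, LinearMap.mulLeft_apply, barHomotopy_bar, right_mul_barE,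
    braidM_one_right, passLetter]

theorem barHomotopyRight_leftMul_letter :
    barHomotopyRight k S p * barE k S a [] 1 =
      barHomotopyRight k S (p * barE k S a [] 1) := by
  suffices h : LinearMap.mulRight k (barE k S a [] 1) ∘ₗ barHomotopyRight k S =
      barHomotopyRight k S ∘ₗ LinearMap.mulRight k (barE k S a [] 1) from
    LinearMap.congr_fun h p
  refine barAlg_hom_ext k S fun b u d => ?_
  simp only [LinearMap.comp_apply, LinearMap.mulRight_apply, barHomotopyRight_bar, barE_mul_left,
    braidM_one_left, passLetterLeft_append, passLetterLeft]

theorem barHomotopy_rightMul : barHomotopy k S p * barE k S 1 [] c =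
    barHomotopy k S (p * barE k S 1 [] c) := by
  suffices h : LinearMap.mulRight k (barE k S 1 [] c) ∘ₗ barHomotopy k S =
      barHomotopy k S ∘ₗ LinearMap.mulRight k (barE k S 1 [] c) from
    LinearMap.congr_fun h p
  refine barAlg_hom_ext k S fun b u d => ?_
  simp only [LinearMap.comp_apply, LinearMap.mulRight_apply, barHomotopy_bar, barE_mul_right]

theorem barSection_barAug_rightMul :
    barSection k S (barAugE k S (barE k S 1 [] c * p)) =
      barE k S 1 [] c * barSection k S (barAugE k S p) := by
  suffices h : barSection k S ∘ₗ barAugE k S ∘ₗ LinearMap.mulLeft k (barE k S 1 [] c) =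
      LinearMap.mulLeft k (barE k S 1 [] c) ∘ₗ barSection k S ∘ₗ barAugE k S from
    LinearMap.congr_fun h p
  refine barAlg_hom_ext k S fun b u d => ?_
  simp only [LinearMap.comp_apply, LinearMap.mulLeft_apply]
  rcases u with _ | ⟨e, u⟩
  · rw [right_mul_barE, passLetter, barAug_bar_nil, barAug_bar_nil, barSection_of,
      barSection_of, barE_mul_right, ← mul_assoc, braidM_comm, mul_assoc]
  · rw [right_mul_barE, passLetter, barAug_bar_cons, barAug_bar_cons, map_zero, mul_zero]

theorem barSectionRight_barAug_leftMul_letter :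
    barSectionRight k S (barAugE k S (p * barE k S a [] 1)) =
      barSectionRight k S (barAugE k S p) * barE k S a [] 1 := by
  suffices h : barSectionRight k S ∘ₗ barAugE k S ∘ₗ LinearMap.mulRight k (barE k S a [] 1) =
      LinearMap.mulRight k (barE k S a [] 1) ∘ₗ barSectionRight k S ∘ₗ barAugE k S from
    LinearMap.congr_fun h p
  refine barAlg_hom_ext k S fun b u d => ?_
  simp only [LinearMap.comp_apply, LinearMap.mulRight_apply]
  rcases u with _ | ⟨e, u⟩
  · rw [barE_mul_left, passLetterLeft, barAug_bar_nil, barAug_bar_nil, barSectionRight_of,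
      barSectionRight_of, left_mul_barE, mul_assoc, braidM_comm, mul_assoc]
  · rw [barE_mul_left, passLetterLeft, barAug_bar_cons, barAug_bar_cons, map_zero, zero_mul]

theorem barParity_leftMul_letter :
    barParity k S (p * barE k S a [] 1) =
      barParity k S p * barE k S a [] 1 := by
  suffices h : barParity k S ∘ₗ LinearMap.mulRight k (barE k S a [] 1) =
      LinearMap.mulRight k (barE k S a [] 1) ∘ₗ barParity k S from
    LinearMap.congr_fun h p
  refine barAlg_hom_ext k S fun b u d => ?_
  simp only [LinearMap.comp_apply, LinearMap.mulRight_apply, barParity_bar, map_smul,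
    barE_mul_left, length_passLetterLeft]

/-- The bar differential commutes with left multiplication by `1 ⊗ 1 ⊗ c`. -/
theorem barDiff_mul_right_factor :
    barDiffE k S (barE k S 1 [] d * p) =
      barE k S 1 [] d * barDiffE k S p := by
  suffices h : ∀ u a c d, barDiffE k S (barE k S 1 [] d * barE k S a u c) =
      barE k S 1 [] d * barDiffE k S (barE k S a u c) by
    induction p using barE_induction with
    | zero => simp
    | add s s' hs hs' => simp only [map_add, mul_add, hs, hs']
    | smul c s hs => simp only [map_smul, mul_smul_comm, hs]
    | bar a u c => exact h u a c d
  intro u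
  induction u with
  | nil =>
    intro a c d
    rw [right_mul_barE, passLetter, barDiff_bar_nil, barDiff_bar_nil, mul_zero]
  | cons e u ih =>
    intro a c d
    -- move the letter `a` to the left of `d`
    have hda : ∀ q, barE k S 1 [] d * (barE k S a [] 1 * q) =
        barE k S (braidM S (d, a)).1 [] 1 * (barE k S 1 [] (braidM S (d, a)).2 * q) :=
        fun q => by
      rw [← barAlg_mul_assoc, ← barAlg_mul_assoc, right_mul_barE, left_mul_barE, passLetter,
        mul_one, mul_one]
    rw [bar_cons_eq, hda, barDiff_leftMul, barDiff_leftMul, hda, rightMul_barHomotopy,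
      barDiff_barHomotopy, barDiff_barHomotopy, ih, barSection_barAug_rightMul]
    simp only [mul_sub, rightMul_barHomotopy]

/-- The bar differential commutes with right multiplication by `a ⊗ 1 ⊗ 1`. -/
theorem barDiff_mul_left_factor :
    barDiffE k S (p * barE k S d [] 1) =
      barDiffE k S p * barE k S d [] 1 := by
  suffices h : ∀ u a c d, barDiffE k S (barE k S a u c * barE k S d [] 1) =
      barDiffE k S (barE k S a u c) * barE k S d [] 1 by
    induction p using barE_induction with
    | zero => simp
    | add s s' hs hs' => simp only [map_add, add_mul, hs, hs']
    | smul c s hs => simp only [map_smul, smul_mul_assoc, hs]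
    | bar a u c => exact h u a c d
  intro u
  induction u using List.reverseRecOn with
  | nil =>
    intro a c d
    rw [barE_mul_left, passLetterLeft, barDiff_bar_nil, barDiff_bar_nil, zero_mul]
  | append_singleton u e ih =>
    intro a c d
    -- move the letter `c` to the right of `d`
    have hcd : ∀ q, q * barE k S 1 [] c * barE k S d [] 1 =
        q * barE k S (braidM S (c, d)).1 [] 1 * barE k S 1 [] (braidM S (c, d)).2 := fun q => by
      rw [barAlg_mul_assoc, barAlg_mul_assoc, right_mul_barE, barE_mul_right, passLetter, mul_one,
        one_mul]
    have hu : barE k S a (u ++ [e]) c =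
        barHomotopyRight k S (barE k S a u e) * barE k S 1 [] c := by
      rw [barHomotopyRight_bar, barE_mul_right, one_mul]
    rw [hu, hcd, barDiff_rightMul, barDiff_rightMul, hcd, barHomotopyRight_leftMul_letter,
      barDiff_barHomotopyRight, barDiff_barHomotopyRight, ih,
      barSectionRight_barAug_leftMul_letter, barParity_leftMul_letter,
      ← barHomotopyRight_leftMul_letter]
    simp only [add_mul, sub_mul]

/-- The recursion for the product of the bar resolution, which corresponds to the recursion for
the quantum shuffle product. -/
theorem barHomotopy_mul_barHomotopy :
    barHomotopy k S p * barHomotopy k S q =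
      barHomotopy k S (p * barHomotopy k S q - barHomotopy k S (barParity k S p) * q) := by
  induction p using barE_induction with
  | zero => simp
  | add s s' hs hs' => simp only [map_add, add_mul, hs, hs', map_sub]; abel
  | smul c s hs =>
    simp only [map_smul, smul_mul_assoc, hs, map_sub, smul_sub]
  | bar a u c =>
    induction q using barE_induction with
    | zero => simp
    | add s s' hs hs' => simp only [map_add, mul_add, hs, hs', map_sub]; abel
    | smul c s hs => simp only [map_smul, mul_smul_comm, hs, map_sub, smul_sub]
    | bar b v e =>
      have hmk : ∀ (a c : StructureMonoid S) t, barHomotopy k S (barMkE k S a c t) =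
          barMkE k S 1 c (TensorAlgebra.ι k (basisA k S a) * t) := fun a c t => by
        induction t using basis_induction (wordBasis (basisA k S)) with
        | zero => simp
        | add s s' hs hs' => simp only [map_add, mul_add, hs, hs', mul_add]
        | smul r s hs => simp only [map_smul, mul_smul_comm, hs, mul_smul_comm]
        | basis w => rw [barMkE_word, barHomotopy_bar, ← wordBasis_cons, barMkE_word]
      simp only [barHomotopy_bar, barE_mul, barParity_bar, map_smul, smul_mul_assoc,
        hmk, braidM_one_right, passLetterLeft_one, passLetter, mul_one, one_mul,
        negShuffle_cons_cons, map_add, sub_eq_add_neg, pow_succ, mul_neg, neg_smul, map_neg]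

theorem barParity_barHomotopy :
    barParity k S (barHomotopy k S p) = -barHomotopy k S (barParity k S p) := by
  suffices h : barParity k S ∘ₗ barHomotopy k S = -(barHomotopy k S ∘ₗ barParity k S)
    from LinearMap.congr_fun h p
  refine barAlg_hom_ext k S fun b u c => ?_
  simp [barHomotopy_bar, barParity_bar, pow_succ]

theorem barParity_of_mem (n : ℕ) (hp : p ∈ barGradingE k S n) :
    barParity k S p = (-1 : k) ^ n • p := by
  induction p, hp using barGrading_induction with
  | zero => simp
  | add s t _ _ hs ht => rw [map_add, hs, ht, smul_add]
  | smul c t _ ht => rw [map_smul, ht, smul_comm]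
  | bar a u c hu => rw [barParity_bar, hu]

theorem barDiff_barParity :
    barParity k S (barDiffE k S p) = -barDiffE k S (barParity k S p) := by
  suffices h : barParity k S ∘ₗ barDiffE k S = -(barDiffE k S ∘ₗ barParity k S)
    from LinearMap.congr_fun h p
  refine barAlg_hom_ext k S fun b u c => ?_
  rw [LinearMap.comp_apply, LinearMap.neg_apply, LinearMap.comp_apply]
  rcases hn : u.length with _ | n
  · obtain rfl := List.length_eq_zero_iff.1 hn
    simp [barParity_bar, barDiff_bar_nil]
  · rw [barParity_of_mem k S _ n (barDiff_bar_mem k S b c u n hn), barParity_bar, hn, map_smul,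
      pow_succ]
    simp

theorem barAug_barHomotopy_mul (a b c e : StructureMonoid S)
    (u v : List (StructureMonoid S)) :
    barAugE k S (barHomotopy k S (barE k S a u c) * barE k S b v e) = 0 := by
  have h := barAlg_mul_mem k S _ _ _ (barHomotopy_mem k S _ _ (bar_mem k S a c u)) _
    (bar_mem k S b e v)
  rw [Nat.add_right_comm] at h
  exact barAug_of_mem k S _ _ h

theorem barAug_mul_barHomotopy (a b c e : StructureMonoid S)
    (u v : List (StructureMonoid S)) :
    barAugE k S (barE k S a u c * barHomotopy k S (barE k S b v e)) = 0 :=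
  barAug_of_mem k S _ (u.length + v.length) (barAlg_mul_mem k S u.length (v.length + 1) _
    (bar_mem k S a c u) _ (barHomotopy_mem k S _ _ (bar_mem k S b e v)))

theorem barAug_barParity : barAugE k S (barParity k S p) = barAugE k S p := by
  suffices h : barAugE k S ∘ₗ barParity k S = barAugE k S from
    LinearMap.congr_fun h p
  refine barAlg_hom_ext k S fun b u c => ?_
  rw [LinearMap.comp_apply, barParity_bar, map_smul]
  rcases u with _ | ⟨d, u⟩
  · simp
  · rw [barAug_bar_cons, smul_zero]

/-- The Leibniz rule on `1 ⊗ a u ⊗ c` and `1 ⊗ b v ⊗ e`, provided that it holds for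
`a ⊗ u ⊗ c` and `1 ⊗ b v ⊗ e` and for `1 ⊗ a u ⊗ c` and `b ⊗ v ⊗ e`. -/
theorem barDiff_mul_barHomotopy (a b c e : StructureMonoid S) (u v : List (StructureMonoid S))
    (h1 : barDiffE k S (barE k S a u c * barHomotopy k S (barE k S b v e)) =
      barDiffE k S (barE k S a u c) * barHomotopy k S (barE k S b v e) +
      barParity k S (barE k S a u c) * barDiffE k S (barHomotopy k S (barE k S b v e)))
    (h2 : barDiffE k S (barHomotopy k S (barE k S a u c) * barE k S b v e) =
      barDiffE k S (barHomotopy k S (barE k S a u c)) * barE k S b v e +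
      barParity k S (barHomotopy k S (barE k S a u c)) * barDiffE k S (barE k S b v e)) :
    barDiffE k S (barHomotopy k S (barE k S a u c) * barHomotopy k S (barE k S b v e)) =
      barDiffE k S (barHomotopy k S (barE k S a u c)) * barHomotopy k S (barE k S b v e) +
      barParity k S (barHomotopy k S (barE k S a u c)) *
        barDiffE k S (barHomotopy k S (barE k S b v e)) := by
  have hA1 := barAug_mul_barHomotopy k S a b c e u v
  have hA2 := barAug_barHomotopy_mul k S a b c e u v
  have hγ := barParity_bar k S a c u
  have hεε : (-1 : k) ^ u.length * (-1 : k) ^ u.length = 1 := by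
    rw [← mul_pow]; simp
  have hγD := barDiff_barParity k S (barE k S a u c)
  -- the augmentation only sees degree zero, where the sign is trivial
  have hγA : (-1 : k) ^ u.length • barAugE k S (barE k S a u c) = barAugE k S (barE k S a u c) := by
    rw [← map_smul, ← hγ, barAug_barParity]
  have hηs : ∀ x q, barSection k S x * barHomotopy k S q =
      barHomotopy k S (barSection k S x * q) := fun x q => by
    induction x using basis_induction (basisA k S) with
    | zero => simp
    | add s s' hs hs' => simp only [map_add, add_mul, hs, hs']
    | smul r s hs => simp only [map_smul, smul_mul_assoc, hs]
    | basis m => rw [basisA_apply, barSection_of, rightMul_barHomotopy]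
  have hsη : ∀ x q, barHomotopy k S q * barSection k S x =
      barHomotopy k S (q * barSection k S x) := fun x q => by
    induction x using basis_induction (basisA k S) with
    | zero => simp
    | add s s' hs hs' => simp only [map_add, mul_add, hs, hs']
    | smul r s hs => simp only [map_smul, mul_smul_comm, hs]
    | basis m => rw [basisA_apply, barSection_of, barHomotopy_rightMul]
  generalize barE k S a u c = P at *
  generalize barE k S b v e = Q at *
  generalize (-1 : k) ^ u.length = ε at *
  have hmul := barHomotopy_mul_barHomotopy k S P Q
  have hmul1 := barHomotopy_mul_barHomotopy k S (barDiffE k S P) Q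
  have hmul2 := barHomotopy_mul_barHomotopy k S P (barDiffE k S Q)
  have hηP : ε • barSection k S (barAugE k S P) = barSection k S (barAugE k S P) := by
    rw [← map_smul, hγA]
  rw [hγ] at hmul hmul2 h1 hγD
  rw [hγD] at hmul1
  rw [barParity_barHomotopy, hγ] at h2 ⊢
  have e1 : barDiffE k S (barHomotopy k S P * barHomotopy k S Q) =
      (P * barHomotopy k S Q - ε • (barHomotopy k S P * Q)) -
        barHomotopy k S (barDiffE k S (P * barHomotopy k S Q)) +
        ε • barHomotopy k S (barDiffE k S (barHomotopy k S P * Q)) := by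
    rw [hmul, barDiff_barHomotopy]
    simp only [map_sub, map_smul, smul_mul_assoc, hA1, hA2, map_zero, smul_zero, sub_zero]
    abel
  rw [e1, h1, h2, barDiff_barHomotopy k S P, barDiff_barHomotopy k S Q]
  simp only [map_smul, smul_mul_assoc, map_neg, neg_mul] at hmul hmul1 hmul2
  simp only [mul_sub, sub_mul, map_sub, map_add, map_smul, map_neg, neg_mul, smul_mul_assoc,
    hηs, hsη, hmul1, hmul2, smul_add, smul_sub, smul_neg, smul_smul, hεε,
    one_smul]
  have hηPQ : ε • barHomotopy k S (barSection k S (barAugE k S P) * Q) =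
      barHomotopy k S (barSection k S (barAugE k S P) * Q) := by
    rw [← map_smul, ← smul_mul_assoc, hηP]
  rw [hηPQ]
  abel

/-- The Leibniz rule for the bar differential and the braided shuffle product. -/
theorem barDiff_barMul : barDiffE k S (p * q) =
    barDiffE k S p * q + barParity k S p * barDiffE k S q := by
  suffices h : ∀ (N : ℕ) (u v : List (StructureMonoid S)) (a c b e : StructureMonoid S),
      u.length + v.length = N →
      barDiffE k S (barE k S a u c * barE k S b v e) =
        barDiffE k S (barE k S a u c) * barE k S b v e +
        barParity k S (barE k S a u c) * barDiffE k S (barE k S b v e) by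
    induction p using barE_induction with
    | zero => simp
    | add s s' hs hs' => simp only [map_add, add_mul, hs, hs']; abel
    | smul c s hs => simp only [map_smul, smul_mul_assoc, hs, smul_add]
    | bar a u c =>
      induction q using barE_induction with
      | zero => simp
      | add s s' hs hs' => simp only [map_add, mul_add, hs, hs']; abel
      | smul c s hs => simp only [map_smul, mul_smul_comm, hs, smul_add]
      | bar b v e => exact h _ u v a c b e rfl
  intro N
  induction N with
  | zero =>
    intro u v a c b e hN
    obtain rfl : u = [] := List.length_eq_zero_iff.1 (by omega)
    obtain rfl : v = [] := List.length_eq_zero_iff.1 (by omega)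
    rw [barE_mul]
    simp only [passLetter, passLetterLeft, wordA_nil, negShuffle_one_left, barDiff_bar_nil,
      zero_mul, mul_zero, add_zero]
    rw [← wordA_nil, barMkE_word, barDiff_bar_nil]
  | succ N ih =>
    -- the case in which both outer left factors are trivial
    have key : ∀ (u v : List (StructureMonoid S)) (c e : StructureMonoid S),
        u.length + v.length = N + 1 →
        barDiffE k S (barE k S 1 u c * barE k S 1 v e) =
          barDiffE k S (barE k S 1 u c) * barE k S 1 v e +
          barParity k S (barE k S 1 u c) * barDiffE k S (barE k S 1 v e) := by
      intro u v c e hN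
      rcases u with _ | ⟨x, u⟩
      · rw [barDiff_mul_right_factor, barDiff_bar_nil, barParity_bar]
        simp
      rcases v with _ | ⟨y, v⟩
      · rw [barDiff_rightMul, barDiff_bar_nil]
        simp
      rw [← barHomotopy_bar, ← barHomotopy_bar]
      refine barDiff_mul_barHomotopy k S x y c e u v ?_ ?_
      · rw [barHomotopy_bar]; exact ih _ _ _ _ _ _ (by simp at hN ⊢; omega)
      · rw [barHomotopy_bar]; exact ih _ _ _ _ _ _ (by simp at hN ⊢; omega)
    intro u v a c b e hN
    have ha : barE k S a u c = barE k S a [] 1 * barE k S 1 u c := by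
      rw [left_mul_barE, mul_one]
    have hb : barE k S b v e = barE k S b [] 1 * barE k S 1 v e := by
      rw [left_mul_barE, mul_one]
    have hub : barE k S 1 u c * barE k S b [] 1 =
        barE k S (passLetterLeft (braidM S) u (braidM S (c, b)).1).1 [] 1 *
          barE k S 1 (passLetterLeft (braidM S) u (braidM S (c, b)).1).2 (braidM S (c, b)).2 := by
      rw [left_mul_barE, barE_mul_left, one_mul, mul_one]
    have hγ : barParity k S (barE k S a u c) * barDiffE k S (barE k S b v e) =
        (-1 : k) ^ u.length • (barE k S a [] 1 *
          (barE k S 1 u c * barE k S b [] 1 * barDiffE k S (barE k S 1 v e))) := by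
      rw [barParity_bar, smul_mul_assoc, hb, barDiff_leftMul, ha]
      simp only [barAlg_mul_assoc]
    rw [hγ]
    conv_lhs => rw [ha, hb]
    rw [barAlg_mul_assoc, ← barAlg_mul_assoc k S (barE k S 1 u c), hub, barAlg_mul_assoc,
      barDiff_leftMul, barDiff_leftMul, key _ _ _ _ (by simpa using hN), mul_add, mul_add]
    refine congrArg₂ (· + ·) ?_ ?_
    · rw [ha, hb, barDiff_leftMul, barAlg_mul_assoc, ← barAlg_mul_assoc k S _ (barE k S b [] 1),
        ← barDiff_mul_left_factor, hub, barDiff_leftMul, barAlg_mul_assoc]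
    · rw [barParity_bar, length_passLetterLeft, smul_mul_assoc, mul_smul_comm, mul_smul_comm,
        barAlg_mul_assoc]

theorem barDiff_barMul_of_mem (n : ℕ) (hp : p ∈ barGradingE k S n) :
    barDiffE k S (p * q) = barDiffE k S p * q + (-1 : k) ^ n • (p * barDiffE k S q) := by
  rw [barDiff_barMul, barParity_of_mem k S p n hp, smul_mul_assoc]

theorem isDGAlgebra_bar :
    IsDGAlgebra (barMul k S) (barOne k S) (barGrading k S) (barDiff k S) where
  mul_assoc := barMul_assoc k S
  one_mul := barMul_one_left k S
  mul_one := barMul_one_right k S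
  decomposition := by
    have h := isInternal_basisGrading (barAlgBasis k S) (fun i => i.1.2.length)
    rw [← funext (barGradingE_eq k S)] at h
    exact h
  one_mem := by rw [barOne_eq]; exact bar_mem k S 1 1 []
  mul_mem m n a ha b hb := barAlg_mul_mem k S m n a ha b hb
  d_zero a ha := barDiff_of_mem_zero k S a ha
  d_mem n a ha := barDiff_mem k S a n ha
  d_d := barDiff_barDiff k S
  leibniz n a ha b := barDiff_barMul_of_mem k S a b n ha

end BarDG

/-! ### Normal forms in the algebra `B` -/

section NormalForm

variable {X : Type v} (S : Solution X)

/-- Move the letter `x` from left to right through an element of the structure monoid. -/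
def passM (x : X) (a : StructureMonoid S) : StructureMonoid S × X :=
  Quotient.lift (s := (conGen (MonoidRel S)).toSetoid)
    (fun l : FreeMonoid X =>
      (mkWord S (passLetter S.toEquiv x l.toList).1, (passLetter S.toEquiv x l.toList).2))
    (fun a b h => by
      have h := passLetter_congr_right S (l := a.toList) (m := b.toList) h x
      exact Prod.ext h.1 h.2) a

theorem passM_mkWord (x : X) (l : List X) : passM S x (mkWord S l) =
    (mkWord S (passLetter S.toEquiv x l).1, (passLetter S.toEquiv x l).2) := rfl

theorem passM_one (x : X) : passM S x 1 = (1, x) := rfl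

theorem passM_mkLetter_mul (x y : X) (a : StructureMonoid S) :
    passM S x (mkLetter S y * a) =
      (mkLetter S (S.toEquiv (x, y)).1 * (passM S (S.toEquiv (x, y)).2 a).1,
        (passM S (S.toEquiv (x, y)).2 a).2) := by
  obtain ⟨l, rfl⟩ := mkWord_surjective S a
  rfl

theorem passM_pair (x y : X) (a : StructureMonoid S) :
    (passM S (S.toEquiv (x, y)).1 (passM S (S.toEquiv (x, y)).2 a).1).1 =
        (passM S x (passM S y a).1).1 ∧
      ((passM S (S.toEquiv (x, y)).1 (passM S (S.toEquiv (x, y)).2 a).1).2,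
        (passM S (S.toEquiv (x, y)).2 a).2) =
      S.toEquiv ((passM S x (passM S y a).1).2, (passM S y a).2) := by
  obtain ⟨l, rfl⟩ := mkWord_surjective S a
  have h := passLetter_pair S.isYBE x y l
  simp only [passM_mkWord]
  exact ⟨by rw [h.1], h.2⟩

theorem mkLetter_mul_mkLetter (x y : X) : mkLetter S x * mkLetter S y =
    mkLetter S (S.toEquiv (x, y)).1 * mkLetter S (S.toEquiv (x, y)).2 := mkWord_pair S x y

theorem mkLetter_mul_mkLetter_mul (x y : X) (c : StructureMonoid S) :
    mkLetter S x * (mkLetter S y * c) =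
      mkLetter S (S.toEquiv (x, y)).1 * (mkLetter S (S.toEquiv (x, y)).2 * c) := by
  rw [← mul_assoc, mkLetter_mul_mkLetter, mul_assoc]

/-- Induction on elements of the structure monoid, adding one letter on the left. -/
theorem structureMonoid_induction {P : StructureMonoid S → Prop} (one : P 1)
    (mul : ∀ x a, P a → P (mkLetter S x * a)) (a : StructureMonoid S) : P a := by
  obtain ⟨l, rfl⟩ := mkWord_surjective S a
  induction l with
  | nil => exact one
  | cons x l ih => exact mul x _ ih

/-- The index set `M × X* × M` of the normal forms `a' e_{x₁} ⋯ e_{xₙ} c`. -/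
abbrev NormalWord : Type v := StructureMonoid S × List X × StructureMonoid S

/-- Multiplication of a normal form by a generator on the left: primed letters are collected on the
left and unprimed ones on the right. -/
def normalAct : Gen X → NormalWord S → NormalWord S
  | .pr x, (a, w, c) => (mkLetter S x * a, w, c)
  | .ee x, (a, w, c) => ((passM S x a).1, (passM S x a).2 :: w, c)
  | .pl x, (a, w, c) =>
    ((passM S x a).1, (passLetter S.toEquiv (passM S x a).2 w).1,
      mkLetter S (passLetter S.toEquiv (passM S x a).2 w).2 * c)

theorem normalAct_pl_pl (x y : X) (ω : NormalWord S) :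
    normalAct S (.pl x) (normalAct S (.pl y) ω) =
      normalAct S (.pl (S.toEquiv (x, y)).1) (normalAct S (.pl (S.toEquiv (x, y)).2) ω) := by
  obtain ⟨a, w, c⟩ := ω
  obtain ⟨h1, h2⟩ := passM_pair S x y a
  have h2' := Prod.ext_iff.1 h2
  simp only at h2'
  obtain ⟨h3, h4⟩ := passLetter_pair S.isYBE (passM S x (passM S y a).1).2 (passM S y a).2 w
  have h4' := Prod.ext_iff.1 h4
  simp only at h4'
  simp only [normalAct]
  rw [h1, h2'.1, h2'.2, h3, h4'.1, h4'.2, ← mkLetter_mul_mkLetter_mul]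

theorem normalAct_pl_pr (x y : X) (ω : NormalWord S) :
    normalAct S (.pl x) (normalAct S (.pr y) ω) =
      normalAct S (.pr (S.toEquiv (x, y)).1) (normalAct S (.pl (S.toEquiv (x, y)).2) ω) := by
  obtain ⟨a, w, c⟩ := ω
  simp only [normalAct, passM_mkLetter_mul]

theorem normalAct_pr_pr (x y : X) (ω : NormalWord S) :
    normalAct S (.pr x) (normalAct S (.pr y) ω) =
      normalAct S (.pr (S.toEquiv (x, y)).1) (normalAct S (.pr (S.toEquiv (x, y)).2) ω) := by
  obtain ⟨a, w, c⟩ := ω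
  simp only [normalAct]
  rw [mkLetter_mul_mkLetter_mul]

theorem normalAct_pl_ee (x y : X) (ω : NormalWord S) :
    normalAct S (.pl x) (normalAct S (.ee y) ω) =
      normalAct S (.ee (S.toEquiv (x, y)).1) (normalAct S (.pl (S.toEquiv (x, y)).2) ω) := by
  obtain ⟨a, w, c⟩ := ω
  obtain ⟨h1, h2⟩ := passM_pair S x y a
  have h2' := Prod.ext_iff.1 h2
  simp only at h2'
  simp only [normalAct, passLetter]
  rw [h1, h2'.1, h2'.2]

theorem normalAct_ee_pr (x y : X) (ω : NormalWord S) :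
    normalAct S (.ee x) (normalAct S (.pr y) ω) =
      normalAct S (.pr (S.toEquiv (x, y)).1) (normalAct S (.ee (S.toEquiv (x, y)).2) ω) := by
  obtain ⟨a, w, c⟩ := ω
  simp only [normalAct, passM_mkLetter_mul]

theorem length_normalAct (g : Gen X) (ω : NormalWord S) :
    (normalAct S g ω).2.1.length = g.deg + ω.2.1.length := by
  obtain ⟨a, w, c⟩ := ω
  cases g <;> simp [normalAct, Gen.deg, add_comm]

variable (k : Type u) [CommRing k]

/-- The representation of `B` on the free module on the normal forms. -/
def normalRep : AlgB k S →ₐ[k] Module.End k (NormalWord S →₀ k) :=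
  liftB k S (FreeAlgebra.lift k fun g => Finsupp.lmapDomain k k (normalAct S g)) (by
    intro a b h
    induction h with
    | pl_pl x y =>
      simp only [map_mul, FreeAlgebra.lift_ι_apply]
      exact Finsupp.lhom_ext fun ω c => by simp [normalAct_pl_pl S x y]
    | pl_pr x y =>
      simp only [map_mul, FreeAlgebra.lift_ι_apply]
      exact Finsupp.lhom_ext fun ω c => by simp [normalAct_pl_pr S x y]
    | pr_pr x y =>
      simp only [map_mul, FreeAlgebra.lift_ι_apply]
      exact Finsupp.lhom_ext fun ω c => by simp [normalAct_pr_pr S x y]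
    | pl_ee x y =>
      simp only [map_mul, FreeAlgebra.lift_ι_apply]
      exact Finsupp.lhom_ext fun ω c => by simp [normalAct_pl_ee S x y]
    | ee_pr x y =>
      simp only [map_mul, FreeAlgebra.lift_ι_apply]
      exact Finsupp.lhom_ext fun ω c => by simp [normalAct_ee_pr S x y])

theorem normalRep_genB (g : Gen X) (ω : NormalWord S) (c : k) :
    normalRep S k (genB k S g) (Finsupp.single ω c) = Finsupp.single (normalAct S g ω) c := by
  simp [normalRep, genB, liftB_mkB]

/-- The element `a' e_{x₁} ⋯ e_{xₙ} c` of `B`. -/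
def normalForm (ω : NormalWord S) : AlgB k S :=
  inclA' k S (MonoidAlgebra.of k _ ω.1) * eWord k S ω.2.1 *
    inclA k S (MonoidAlgebra.of k _ ω.2.2)

theorem algB_induction {P : AlgB k S → Prop} (b : AlgB k S) (scalar : ∀ r, P (algebraMap k _ r))
    (gen : ∀ g, P (genB k S g)) (mul : ∀ a b, P a → P b → P (a * b))
    (add : ∀ a b, P a → P b → P (a + b)) : P b := by
  obtain ⟨a, rfl⟩ := RingQuot.mkAlgHom_surjective k (RelB k S) b
  change P (mkB k S a)
  induction a using FreeAlgebra.induction with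
  | grade0 r => rw [AlgHom.commutes]; exact scalar r
  | grade1 g => exact gen g
  | mul a b ha hb => rw [map_mul]; exact mul _ _ ha hb
  | add a b ha hb => rw [map_add]; exact add _ _ ha hb

theorem inclA'_mkLetter_mul (x : X) (a : StructureMonoid S) :
    inclA' k S (MonoidAlgebra.of k _ (mkLetter S x * a)) =
      genB k S (.pr x) * inclA' k S (MonoidAlgebra.of k _ a) := by
  rw [map_mul, map_mul]
  congr 1
  simp [inclA', mkLetter]

theorem inclA_mkLetter_mul (x : X) (a : StructureMonoid S) :
    inclA k S (MonoidAlgebra.of k _ (mkLetter S x * a)) =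
      genB k S (.pl x) * inclA k S (MonoidAlgebra.of k _ a) := by
  rw [map_mul, map_mul]
  congr 1
  simp [inclA, mkLetter]

theorem inclA'_one : inclA' k S (MonoidAlgebra.of k _ 1) = 1 := by rw [map_one, map_one]

theorem inclA_one : inclA k S (MonoidAlgebra.of k _ 1) = 1 := by rw [map_one, map_one]

theorem eWord_nil : eWord k S [] = 1 := rfl

theorem eWord_cons (x : X) (l : List X) : eWord k S (x :: l) = genB k S (.ee x) * eWord k S l := by
  simp [eWord]

theorem ee_mul_inclA' (x : X) (a : StructureMonoid S) :
    genB k S (.ee x) * inclA' k S (MonoidAlgebra.of k _ a) =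
      inclA' k S (MonoidAlgebra.of k _ (passM S x a).1) * genB k S (.ee (passM S x a).2) := by
  induction a using structureMonoid_induction generalizing x with
  | one => simp only [passM_one, map_one, one_mul, mul_one]
  | mul y a ih =>
    rw [inclA'_mkLetter_mul, ← mul_assoc, genB_rel k S (RelB.ee_pr x y), mul_assoc, ih,
      passM_mkLetter_mul, inclA'_mkLetter_mul, mul_assoc]

theorem pl_mul_inclA' (x : X) (a : StructureMonoid S) :
    genB k S (.pl x) * inclA' k S (MonoidAlgebra.of k _ a) =
      inclA' k S (MonoidAlgebra.of k _ (passM S x a).1) * genB k S (.pl (passM S x a).2) := by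
  induction a using structureMonoid_induction generalizing x with
  | one => simp only [passM_one, map_one, one_mul, mul_one]
  | mul y a ih =>
    rw [inclA'_mkLetter_mul, ← mul_assoc, genB_rel k S (RelB.pl_pr x y), mul_assoc, ih,
      passM_mkLetter_mul, inclA'_mkLetter_mul, mul_assoc]

theorem pl_mul_eWord (x : X) (w : List X) :
    genB k S (.pl x) * eWord k S w =
      eWord k S (passLetter S.toEquiv x w).1 * genB k S (.pl (passLetter S.toEquiv x w).2) := by
  induction w generalizing x with
  | nil => simp [eWord, passLetter]
  | cons y w ih =>
    rw [eWord_cons, ← mul_assoc, genB_rel k S (RelB.pl_ee x y), mul_assoc, ih, passLetter,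
      eWord_cons, mul_assoc]

theorem genB_mul_normalForm (g : Gen X) (ω : NormalWord S) :
    genB k S g * normalForm S k ω = normalForm S k (normalAct S g ω) := by
  obtain ⟨a, w, c⟩ := ω
  cases g with
  | pr x => simp only [normalForm, normalAct, inclA'_mkLetter_mul, mul_assoc]
  | ee x =>
    simp only [normalForm, normalAct, eWord_cons]
    rw [mul_assoc, ← mul_assoc, ee_mul_inclA', mul_assoc, mul_assoc, mul_assoc]
  | pl x =>
    simp only [normalForm, normalAct, inclA_mkLetter_mul]
    rw [mul_assoc, ← mul_assoc, pl_mul_inclA', mul_assoc, ← mul_assoc (genB k S _), pl_mul_eWord,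
      mul_assoc, mul_assoc]

theorem linearCombination_normalRep (b : AlgB k S) (t : NormalWord S →₀ k) :
    Finsupp.linearCombination k (normalForm S k) (normalRep S k b t) =
      b * Finsupp.linearCombination k (normalForm S k) t := by
  induction b using algB_induction generalizing t with
  | scalar r => rw [AlgHom.commutes, Module.algebraMap_end_apply, map_smul, Algebra.smul_def]
  | gen g =>
    induction t using Finsupp.induction_linear with
    | zero => simp
    | add s t hs ht => simp only [map_add, hs, ht, mul_add]
    | single ω c =>
      rw [normalRep_genB, Finsupp.linearCombination_single, Finsupp.linearCombination_single,
        mul_smul_comm, genB_mul_normalForm]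
  | mul a b ha hb => rw [map_mul, Module.End.mul_apply, ha, hb, mul_assoc]
  | add a b ha hb => rw [map_add, LinearMap.add_apply, map_add, ha, hb, add_mul]

theorem normalForm_one : normalForm S k (1, [], 1) = 1 := by
  simp only [normalForm, inclA'_one, inclA_one, eWord_nil, one_mul]

theorem normalRep_normalForm (ω : NormalWord S) :
    normalRep S k (normalForm S k ω) (Finsupp.single (1, [], 1) 1) = Finsupp.single ω 1 := by
  obtain ⟨a, w, c⟩ := ω
  have h1 : normalRep S k (inclA k S (MonoidAlgebra.of k _ c)) (Finsupp.single (1, [], 1) 1) =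
      Finsupp.single (1, [], c) 1 := by
    induction c using structureMonoid_induction with
    | one => rw [inclA_one, map_one]; rfl
    | mul x c ih =>
      rw [inclA_mkLetter_mul, map_mul, Module.End.mul_apply, ih, normalRep_genB]
      rfl
  have h2 : normalRep S k (eWord k S w) (Finsupp.single (1, [], c) 1) =
      Finsupp.single (1, w, c) 1 := by
    induction w with
    | nil => simp [eWord]
    | cons x w ih =>
      rw [eWord_cons, map_mul, Module.End.mul_apply, ih, normalRep_genB]
      rfl
  have h3 : normalRep S k (inclA' k S (MonoidAlgebra.of k _ a)) (Finsupp.single (1, w, c) 1) =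
      Finsupp.single (a, w, c) 1 := by
    induction a using structureMonoid_induction with
    | one => rw [inclA'_one, map_one]; rfl
    | mul x a ih =>
      rw [inclA'_mkLetter_mul, map_mul, Module.End.mul_apply, ih, normalRep_genB]
      rfl
  rw [normalForm, map_mul, map_mul, Module.End.mul_apply, Module.End.mul_apply, h1, h2, h3]

/-- The normal forms `a' e_{x₁} ⋯ e_{xₙ} c` form a basis of `B`: the coordinates of `b` are obtained
by letting `b` act on the empty normal form. -/
def basisB : Basis (NormalWord S) k (AlgB k S) :=
  Basis.ofRepr (LinearEquiv.ofLinearMap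
    ((LinearMap.applyₗ (Finsupp.single (1, [], 1) 1)) ∘ₗ (normalRep S k).toLinearMap)
    (Finsupp.linearCombination k (normalForm S k))
    (Finsupp.lhom_ext' fun ω => LinearMap.ext_ring (by
      simpa using normalRep_normalForm S k ω))
    (LinearMap.ext fun b => by
      have := linearCombination_normalRep S k b (Finsupp.single (1, [], 1) 1)
      simpa [normalForm_one] using this))

theorem basisB_apply (ω : NormalWord S) : basisB S k ω = normalForm S k ω := by
  simp [basisB]

theorem algB_hom_ext {E : Type*} [AddCommMonoid E] [Module k E] {f g : AlgB k S →ₗ[k] E}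
    (h : ∀ a l c, f (normalForm S k (a, l, c)) = g (normalForm S k (a, l, c))) : f = g :=
  (basisB S k).ext fun ω => by rw [basisB_apply]; exact h ω.1 ω.2.1 ω.2.2

theorem prod_genB_eq_normalForm (l : List (Gen X)) :
    (l.map (genB k S)).prod = normalForm S k (l.foldr (normalAct S) (1, [], 1)) := by
  induction l with
  | nil => simp [normalForm_one]
  | cons g l ih => rw [List.map_cons, List.prod_cons, ih, genB_mul_normalForm, List.foldr_cons]

theorem length_foldr_normalAct (l : List (Gen X)) :
    (l.foldr (normalAct S) (1, [], 1)).2.1.length = (l.map Gen.deg).sum := by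
  induction l with
  | nil => rfl
  | cons g l ih => rw [List.foldr_cons, length_normalAct, ih, List.map_cons, List.sum_cons]

theorem mul_mem_gradingB (m n : ℕ) (a : AlgB k S) (ha : a ∈ gradingB k S m) (b : AlgB k S)
    (hb : b ∈ gradingB k S n) : a * b ∈ gradingB k S (m + n) := by
  induction ha using Submodule.span_induction with
  | zero => simp
  | add s t _ _ hs ht => rw [add_mul]; exact add_mem hs ht
  | smul c t _ ht => rw [smul_mul_assoc]; exact Submodule.smul_mem _ _ ht
  | mem a ha =>
    obtain ⟨l, rfl, rfl⟩ := ha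
    induction hb using Submodule.span_induction with
    | zero => simp
    | add s t _ _ hs ht => rw [mul_add]; exact add_mem hs ht
    | smul c t _ ht => rw [mul_smul_comm]; exact Submodule.smul_mem _ _ ht
    | mem b hb =>
      obtain ⟨l', rfl, rfl⟩ := hb
      exact Submodule.subset_span ⟨l ++ l', by simp, by simp⟩

theorem one_mem_gradingB : (1 : AlgB k S) ∈ gradingB k S 0 :=
  Submodule.subset_span ⟨[], rfl, rfl⟩

theorem genB_mem_gradingB (g : Gen X) : genB k S g ∈ gradingB k S g.deg :=
  Submodule.subset_span ⟨[g], by simp, by simp⟩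

theorem normalForm_mem_gradingB (ω : NormalWord S) :
    normalForm S k ω ∈ gradingB k S ω.2.1.length := by
  obtain ⟨a, w, c⟩ := ω
  have h1 : inclA k S (MonoidAlgebra.of k _ c) ∈ gradingB k S 0 := by
    induction c using structureMonoid_induction with
    | one => rw [inclA_one]; exact one_mem_gradingB S k
    | mul x c ih =>
      rw [inclA_mkLetter_mul]
      exact mul_mem_gradingB S k 0 0 _ (genB_mem_gradingB S k (.pl x)) _ ih
  have h2 : eWord k S w ∈ gradingB k S w.length := by
    induction w with
    | nil => simpa [eWord] using one_mem_gradingB S k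
    | cons x w ih =>
      rw [eWord_cons, List.length_cons, add_comm]
      exact mul_mem_gradingB S k 1 _ _ (genB_mem_gradingB S k (.ee x)) _ ih
  have h3 : inclA' k S (MonoidAlgebra.of k _ a) ∈ gradingB k S 0 := by
    induction a using structureMonoid_induction with
    | one => rw [inclA'_one]; exact one_mem_gradingB S k
    | mul x a ih =>
      rw [inclA'_mkLetter_mul]
      exact mul_mem_gradingB S k 0 0 _ (genB_mem_gradingB S k (.pr x)) _ ih
  have := mul_mem_gradingB S k _ _ _ (mul_mem_gradingB S k _ _ _ h3 _ h2) _ h1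
  simpa [normalForm] using this

theorem gradingB_eq (n : ℕ) :
    gradingB k S n = basisGrading (basisB S k) (fun ω => ω.2.1.length) n := by
  apply le_antisymm
  · refine Submodule.span_le.2 ?_
    rintro _ ⟨l, hl, rfl⟩
    exact Submodule.subset_span ⟨_, (length_foldr_normalAct S l).trans hl, by
      rw [prod_genB_eq_normalForm, basisB_apply]⟩
  · refine Submodule.span_le.2 ?_
    rintro _ ⟨ω, rfl, rfl⟩
    rw [basisB_apply]
    exact normalForm_mem_gradingB S k ω

end NormalForm

/-! ### The algebra `B` as a differential graded algebra -/

section DifferentialB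

variable (k : Type u) [CommRing k] {X : Type v} (S : Solution X)

theorem diffMatrix_one_zero (b : AlgB k S) : diffMatrix k S b 1 0 = 0 := by
  induction b using algB_induction with
  | scalar r => rw [AlgHom.commutes]; simp [Matrix.algebraMap_matrix_apply]
  | gen g => rw [diffMatrix_genB]; cases g <;> rfl
  | mul a b ha hb => rw [map_mul, Matrix.mul_apply, Fin.sum_univ_two, ha, hb]; simp
  | add a b ha hb => rw [map_add, Matrix.add_apply, ha, hb, add_zero]

theorem diffMatrix_one_one (b : AlgB k S) : diffMatrix k S b 1 1 = b := by
  induction b using algB_induction with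
  | scalar r => rw [AlgHom.commutes]; simp [Matrix.algebraMap_matrix_apply]
  | gen g => rw [diffMatrix_genB]; cases g <;> rfl
  | mul a b ha hb =>
    rw [map_mul, Matrix.mul_apply, Fin.sum_univ_two, ha, hb, diffMatrix_one_zero, zero_mul,
      zero_add]
  | add a b ha hb => rw [map_add, Matrix.add_apply, ha, hb]

theorem diffMatrix_zero_zero (n : ℕ) (b : AlgB k S) (hb : b ∈ gradingB k S n) :
    diffMatrix k S b 0 0 = (-1 : k) ^ n • b := by
  induction hb using Submodule.span_induction with
  | mem b hb =>
    obtain ⟨l, rfl, rfl⟩ := hb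
    induction l with
    | nil => simp
    | cons g l ih =>
      rw [List.map_cons, List.prod_cons, map_mul, Matrix.mul_apply, Fin.sum_univ_two, ih,
        diffMatrix_one_zero, mul_zero, add_zero, diffMatrix_genB, List.map_cons, List.sum_cons,
        pow_add]
      cases g <;> simp [diffMatrixGen, Gen.deg]
  | zero => simp
  | add s t _ _ hs ht => rw [map_add, Matrix.add_apply, hs, ht, smul_add]
  | smul c t _ ht => rw [map_smul, Matrix.smul_apply, ht, smul_comm]

theorem diffB_mul (a b : AlgB k S) :
    diffB k S (a * b) = diffB k S a * b + diffMatrix k S a 0 0 * diffB k S b := by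
  change diffMatrix k S (a * b) 0 1 = diffMatrix k S a 0 1 * b + _ * diffMatrix k S b 0 1
  rw [map_mul, Matrix.mul_apply, Fin.sum_univ_two, diffMatrix_one_one, add_comm]

theorem diffB_pl (x : X) : diffB k S (genB k S (.pl x)) = 0 := by
  change diffMatrix k S _ 0 1 = _
  rw [diffMatrix_genB]
  rfl

theorem diffB_pr (x : X) : diffB k S (genB k S (.pr x)) = 0 := by
  change diffMatrix k S _ 0 1 = _
  rw [diffMatrix_genB]
  rfl

theorem diffB_pl_mul (x : X) (b : AlgB k S) :
    diffB k S (genB k S (.pl x) * b) = genB k S (.pl x) * diffB k S b := by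
  rw [diffB_mul, diffB_pl, zero_mul, zero_add, diffMatrix_genB]
  rfl

theorem diffB_pr_mul (x : X) (b : AlgB k S) :
    diffB k S (genB k S (.pr x) * b) = genB k S (.pr x) * diffB k S b := by
  rw [diffB_mul, diffB_pr, zero_mul, zero_add, diffMatrix_genB]
  rfl

theorem diffB_ee_mul (x : X) (b : AlgB k S) :
    diffB k S (genB k S (.ee x) * b) =
      (genB k S (.pl x) - genB k S (.pr x)) * b - genB k S (.ee x) * diffB k S b := by
  rw [diffB_mul, diffB_ee, diffMatrix_genB, sub_eq_add_neg _ (_ * diffB k S b), ← neg_mul]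
  rfl

theorem diffB_one : diffB k S 1 = 0 := by
  change diffMatrix k S 1 0 1 = 0
  rw [map_one]
  simp

/-- Induction on the elements of `B`: it suffices to treat the products of generators. -/
theorem algB_monomial_induction {P : AlgB k S → Prop} (b : AlgB k S) (one : P 1)
    (gen : ∀ g b, P b → P (genB k S g * b)) (add : ∀ a b, P a → P b → P (a + b))
    (smul : ∀ (c : k) b, P b → P (c • b)) : P b := by
  have zero : P 0 := by simpa using smul 0 1 one
  suffices h : ∀ c, P c → P (b * c) by simpa using h 1 one
  induction b using algB_induction with
  | scalar r => intro c hc; rw [← Algebra.smul_def]; exact smul r c hc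
  | gen g => exact gen g
  | mul a b ha hb => intro c hc; rw [mul_assoc]; exact ha _ (hb c hc)
  | add a b ha hb => intro c hc; rw [add_mul]; exact add _ _ (ha c hc) (hb c hc)

theorem diffB_diffB (b : AlgB k S) : diffB k S (diffB k S b) = 0 := by
  induction b using algB_monomial_induction with
  | one => rw [diffB_one, map_zero]
  | gen g b hb =>
    cases g with
    | pl x => rw [diffB_pl_mul, diffB_pl_mul, hb, mul_zero]
    | pr x => rw [diffB_pr_mul, diffB_pr_mul, hb, mul_zero]
    | ee x =>
      rw [diffB_ee_mul, map_sub, diffB_ee_mul, sub_mul, map_sub, diffB_pl_mul, diffB_pr_mul, hb,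
        sub_mul, mul_zero, sub_zero, sub_self]
  | add a b ha hb => rw [map_add, map_add, ha, hb, add_zero]
  | smul c b hb => rw [map_smul, map_smul, hb, smul_zero]

theorem diffB_prod_genB (l : List (Gen X)) :
    ((l.map Gen.deg).sum = 0 → diffB k S (l.map (genB k S)).prod = 0) ∧
      ∀ n, (l.map Gen.deg).sum = n + 1 → diffB k S (l.map (genB k S)).prod ∈ gradingB k S n := by
  induction l with
  | nil => exact ⟨fun _ => by simpa using diffB_one k S, fun n hn => by simp at hn⟩
  | cons g l ih =>
    have hl : (l.map (genB k S)).prod ∈ gradingB k S (l.map Gen.deg).sum :=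
      Submodule.subset_span ⟨l, rfl, rfl⟩
    simp only [List.map_cons, List.prod_cons, List.sum_cons]
    cases g with
    | pl x =>
      rw [diffB_pl_mul, Gen.deg, zero_add]
      refine ⟨fun h => by rw [ih.1 h, mul_zero], fun n hn => ?_⟩
      have := mul_mem_gradingB S k 0 n _ (genB_mem_gradingB S k (.pl x)) _ (ih.2 n hn)
      rwa [zero_add] at this
    | pr x =>
      rw [diffB_pr_mul, Gen.deg, zero_add]
      refine ⟨fun h => by rw [ih.1 h, mul_zero], fun n hn => ?_⟩
      have := mul_mem_gradingB S k 0 n _ (genB_mem_gradingB S k (.pr x)) _ (ih.2 n hn)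
      rwa [zero_add] at this
    | ee x =>
      rw [diffB_ee_mul, Gen.deg]
      refine ⟨fun h => by omega, fun n hn => ?_⟩
      obtain rfl : (l.map Gen.deg).sum = n := by omega
      refine sub_mem ?_ ?_
      · rw [sub_mul]
        have h1 := mul_mem_gradingB S k 0 _ _ (genB_mem_gradingB S k (.pl x)) _ hl
        have h2 := mul_mem_gradingB S k 0 _ _ (genB_mem_gradingB S k (.pr x)) _ hl
        rw [zero_add] at h1 h2
        exact sub_mem h1 h2
      · rcases h : (l.map Gen.deg).sum with _ | m
        · rw [ih.1 h, mul_zero]; exact zero_mem _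
        · rw [add_comm m 1]
          exact mul_mem_gradingB S k 1 m _ (genB_mem_gradingB S k (.ee x)) _ (ih.2 m h)

theorem diffB_of_mem_zero (b : AlgB k S) (hb : b ∈ gradingB k S 0) : diffB k S b = 0 := by
  induction hb using Submodule.span_induction with
  | mem b hb => obtain ⟨l, hl, rfl⟩ := hb; exact (diffB_prod_genB k S l).1 hl
  | zero => simp
  | add s t _ _ hs ht => rw [map_add, hs, ht, add_zero]
  | smul c t _ ht => rw [map_smul, ht, smul_zero]

theorem diffB_mem (n : ℕ) (b : AlgB k S) (hb : b ∈ gradingB k S (n + 1)) :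
    diffB k S b ∈ gradingB k S n := by
  induction hb using Submodule.span_induction with
  | mem b hb => obtain ⟨l, hl, rfl⟩ := hb; exact (diffB_prod_genB k S l).2 n hl
  | zero => simp
  | add s t _ _ hs ht => rw [map_add]; exact add_mem hs ht
  | smul c t _ ht => rw [map_smul]; exact Submodule.smul_mem _ _ ht

theorem isDGAlgebra_algB :
    IsDGAlgebra (LinearMap.mul k (AlgB k S)) 1 (gradingB k S) (-diffB k S) where
  mul_assoc := mul_assoc
  one_mul := one_mul
  mul_one := mul_one
  decomposition := by
    rw [funext (gradingB_eq S k)]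
    exact isInternal_basisGrading _ _
  one_mem := one_mem_gradingB S k
  mul_mem := mul_mem_gradingB S k
  d_zero a ha := by rw [LinearMap.neg_apply, diffB_of_mem_zero k S a ha, neg_zero]
  d_mem n a ha := neg_mem (diffB_mem k S n a ha)
  d_d a := by simp [diffB_diffB]
  leibniz n a ha b := by
    simp only [LinearMap.neg_apply, LinearMap.mul_apply']
    rw [diffB_mul, diffMatrix_zero_zero k S n a ha, smul_mul_assoc]
    simp only [neg_mul, mul_neg, smul_neg, neg_add]

end DifferentialB

/-! ### The comparison map from `B` to the bar resolution -/

section Comparison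

variable (k : Type u) [CommRing k] {X : Type v} (S : Solution X)

/-- The values of the comparison map on the generators of `B`. -/
def comparisonGen : Gen X → BarAlg k S
  | .pl x => barE k S 1 [] (mkLetter S x)
  | .pr x => barE k S (mkLetter S x) [] 1
  | .ee x => barE k S 1 [mkLetter S x] 1

theorem braidM_mkLetter (x y : X) : braidM S (mkLetter S x, mkLetter S y) =
    (mkLetter S (S.toEquiv (x, y)).1, mkLetter S (S.toEquiv (x, y)).2) := rfl

/-- The algebra map from `B` to the bar resolution with the braided product. -/
def comparison : AlgB k S →ₐ[k] BarAlg k S :=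
  liftB k S (FreeAlgebra.lift k (comparisonGen k S)) (by
    intro a b h
    induction h with
    | pl_pl x y =>
      simp only [map_mul, FreeAlgebra.lift_ι_apply, comparisonGen]
      rw [barE_mul_right, barE_mul_right, mkLetter_mul_mkLetter]
    | pl_pr x y =>
      simp only [map_mul, FreeAlgebra.lift_ι_apply, comparisonGen]
      rw [right_mul_barE, left_mul_barE, braidM_mkLetter, passLetter, mul_one, mul_one]
    | pr_pr x y =>
      simp only [map_mul, FreeAlgebra.lift_ι_apply, comparisonGen]
      rw [left_mul_barE, left_mul_barE, mkLetter_mul_mkLetter]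
    | pl_ee x y =>
      simp only [map_mul, FreeAlgebra.lift_ι_apply, comparisonGen]
      rw [right_mul_barE, barE_mul_right, braidM_one_right]
      simp only [passLetter, braidM_mkLetter, mul_one, one_mul]
    | ee_pr x y =>
      simp only [map_mul, FreeAlgebra.lift_ι_apply, comparisonGen]
      rw [barE_mul_left, left_mul_barE, braidM_one_left]
      simp only [passLetterLeft, braidM_mkLetter, mul_one, one_mul])

theorem comparison_genB (g : Gen X) : comparison k S (genB k S g) = comparisonGen k S g := by
  simp [comparison, genB, liftB_mkB]

theorem comparison_inclA' (a : StructureMonoid S) :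
    comparison k S (inclA' k S (MonoidAlgebra.of k _ a)) = barE k S a [] 1 := by
  induction a using structureMonoid_induction with
  | one => rw [inclA'_one, map_one, barE_one]
  | mul x a ih =>
    rw [inclA'_mkLetter_mul, map_mul, ih, comparison_genB, comparisonGen, left_mul_barE]

theorem comparison_inclA (a : StructureMonoid S) :
    comparison k S (inclA k S (MonoidAlgebra.of k _ a)) = barE k S 1 [] a := by
  induction a using structureMonoid_induction with
  | one => rw [inclA_one, map_one, barE_one]
  | mul x a ih =>
    rw [inclA_mkLetter_mul, map_mul, ih, comparison_genB, comparisonGen, barE_mul_right]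

theorem barE_mul_barMkE (x : StructureMonoid S) (t : TensorAlgebra k (AlgA k S)) :
    barE k S 1 [x] 1 * barMkE k S 1 1 t =
      barMkE k S 1 1 (shA k S (TensorAlgebra.ι k (basisA k S x)) t) := by
  rw [← wordBasis_singleton]
  induction t using basis_induction (wordBasis (basisA k S)) with
  | zero => simp
  | add s t hs ht => simp only [map_add, mul_add, hs, ht]
  | smul c t ht => simp only [map_smul, mul_smul_comm, ht]
  | basis l =>
    rw [barMkE_word, barE_mul, braidM_one_left, passLetter_one, passLetterLeft_one, mul_one]

theorem left_mul_barMkE (a b c : StructureMonoid S) (t : TensorAlgebra k (AlgA k S)) :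
    barE k S a [] 1 * barMkE k S b c t = barMkE k S (a * b) c t := by
  induction t using basis_induction (wordBasis (basisA k S)) with
  | zero => simp
  | add s t hs ht => simp only [map_add, mul_add, hs, ht]
  | smul c t ht => simp only [map_smul, mul_smul_comm, ht]
  | basis l => rw [barMkE_word, left_mul_barE, barMkE_word]

theorem barMkE_mul_right (a c d : StructureMonoid S) (t : TensorAlgebra k (AlgA k S)) :
    barMkE k S a c t * barE k S 1 [] d = barMkE k S a (c * d) t := by
  induction t using basis_induction (wordBasis (basisA k S)) with
  | zero => simp
  | add s t hs ht => simp only [map_add, add_mul, hs, ht]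
  | smul c t ht => simp only [map_smul, smul_mul_assoc, ht]
  | basis l => rw [barMkE_word, barE_mul_right, barMkE_word]

theorem comparison_eWord (l : List X) : comparison k S (eWord k S l) =
    barMkE k S 1 1 (iteratedShuffle (braidM S) (basisA k S) (l.map (mkLetter S))) := by
  induction l with
  | nil => rw [eWord_nil, map_one, ← barE_one, ← barMkE_word, wordA_nil]; rfl
  | cons x l ih =>
    rw [eWord_cons, map_mul, ih, comparison_genB, comparisonGen, barE_mul_barMkE]
    rfl

theorem comparison_normalForm (a c : StructureMonoid S) (l : List X) :
    comparison k S (normalForm S k (a, l, c)) =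
      barMkE k S a c (iteratedShuffle (braidM S) (basisA k S) (l.map (mkLetter S))) := by
  rw [normalForm, map_mul, map_mul, comparison_inclA', comparison_inclA, comparison_eWord,
    left_mul_barMkE, barMkE_mul_right, mul_one, one_mul]

/-- The linear map `B → A ⊗ T(A) ⊗ A` lifting the identity of `A`. -/
def liftId : AlgB k S →ₗ[k] Bar k S := (comparison k S).toLinearMap

theorem liftId_apply (a₁ : AlgA k S) (l : List X) (a₂ : AlgA k S) :
    liftId k S (inclA' k S a₁ * eWord k S l * inclA k S a₂) =
      (a₁ ⊗ₜ[k] iteratedShuffle (braidM S) (basisA k S) (l.map (mkLetter S))) ⊗ₜ[k] a₂ := by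
  induction a₁ using basis_induction (basisA k S) with
  | zero => simp
  | add s t hs ht => simp only [map_add, add_mul, TensorProduct.add_tmul, hs, ht]
  | smul c t ht => simp only [map_smul, smul_mul_assoc, ← TensorProduct.smul_tmul', ht]
  | basis a =>
    induction a₂ using basis_induction (basisA k S) with
    | zero => simp
    | add s t hs ht => simp only [map_add, mul_add, TensorProduct.tmul_add, hs, ht]
    | smul c t ht => simp only [map_smul, mul_smul_comm, TensorProduct.tmul_smul, ht]
    | basis c =>
      rw [basisA_apply, basisA_apply]
      exact comparison_normalForm k S a c l

theorem eq_of_eq_on_normalForms {E : Type*} [AddCommMonoid E] [Module k E]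
    {f g : AlgB k S →ₗ[k] E} (h : ∀ (a₁ : AlgA k S) (l : List X) (a₂ : AlgA k S),
      f (inclA' k S a₁ * eWord k S l * inclA k S a₂) =
        g (inclA' k S a₁ * eWord k S l * inclA k S a₂)) : f = g :=
  algB_hom_ext S k fun _ _ _ => h _ _ _

theorem liftId_bimodule (a₁ : AlgA k S) (b : AlgB k S) (a₂ : AlgA k S) :
    liftId k S (inclA' k S a₁ * b * inclA k S a₂) =
      TensorProduct.map (TensorProduct.map (LinearMap.mulLeft k a₁) LinearMap.id)
        (LinearMap.mulRight k a₂) (liftId k S b) := by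
  suffices h : liftId k S ∘ₗ LinearMap.mulRight k (inclA k S a₂) ∘ₗ
      LinearMap.mulLeft k (inclA' k S a₁) =
      TensorProduct.map (TensorProduct.map (LinearMap.mulLeft k a₁) LinearMap.id)
        (LinearMap.mulRight k a₂) ∘ₗ liftId k S from LinearMap.congr_fun h b
  refine eq_of_eq_on_normalForms k S fun b₁ l b₂ => ?_
  have h : inclA' k S a₁ * (inclA' k S b₁ * eWord k S l * inclA k S b₂) * inclA k S a₂ =
      inclA' k S (a₁ * b₁) * eWord k S l * inclA k S (b₂ * a₂) := by
    simp only [map_mul, mul_assoc]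
  simp only [LinearMap.comp_apply, LinearMap.mulRight_apply, LinearMap.mulLeft_apply, h,
    liftId_apply, TensorProduct.map_tmul, LinearMap.id_apply]

theorem augB_genB (g : Gen X) : augB k S (genB k S g) = augGen k S g := by
  simp [augB, genB, liftB_mkB]

theorem augB_inclA' (a : StructureMonoid S) :
    augB k S (inclA' k S (MonoidAlgebra.of k _ a)) = MonoidAlgebra.of k _ a := by
  induction a using structureMonoid_induction with
  | one => rw [inclA'_one, map_one, map_one]
  | mul x a ih => rw [inclA'_mkLetter_mul, map_mul, ih, augB_genB, augGen, ← map_mul]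

theorem augB_inclA (a : StructureMonoid S) :
    augB k S (inclA k S (MonoidAlgebra.of k _ a)) = MonoidAlgebra.of k _ a := by
  induction a using structureMonoid_induction with
  | one => rw [inclA_one, map_one, map_one]
  | mul x a ih => rw [inclA_mkLetter_mul, map_mul, ih, augB_genB, augGen, ← map_mul]

theorem barMkE_iteratedShuffle_mem (a c : StructureMonoid S) (l : List X) :
    barMkE k S a c (iteratedShuffle (braidM S) (basisA k S) (l.map (mkLetter S))) ∈
      barGradingE k S l.length := by
  refine barMk_mem k S a c _ _ ?_
  have := iteratedShuffle_mem (r := braidM S) (basisA k S) (l.map (mkLetter S))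
  rwa [List.length_map] at this

theorem barAug_liftId (b : AlgB k S) : barAug k S (liftId k S b) = augB k S b := by
  suffices h : barAugE k S ∘ₗ (comparison k S).toLinearMap = (augB k S).toLinearMap from
    LinearMap.congr_fun h b
  refine algB_hom_ext S k fun a l c => ?_
  simp only [LinearMap.comp_apply, AlgHom.toLinearMap_apply]
  rw [comparison_normalForm, normalForm, map_mul, map_mul, augB_inclA', augB_inclA]
  rcases l with _ | ⟨x, l⟩
  · rw [eWord_nil, map_one, mul_one, ← map_mul, ← barAug_bar_nil, ← barMkE_word, wordA_nil]
    rfl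
  · rw [eWord_cons, map_mul, augB_genB, augGen, zero_mul, mul_zero, zero_mul]
    exact barAug_of_mem k S _ _ (barMkE_iteratedShuffle_mem k S a c (x :: l))

theorem comparison_mem (n : ℕ) (b : AlgB k S) (hb : b ∈ gradingB k S n) :
    comparison k S b ∈ barGradingE k S n := by
  rw [gradingB_eq] at hb
  induction hb using Submodule.span_induction with
  | mem b hb =>
    obtain ⟨⟨a, l, c⟩, rfl, rfl⟩ := hb
    rw [basisB_apply, comparison_normalForm]
    exact barMkE_iteratedShuffle_mem k S a c l
  | zero => simp
  | add s t _ _ hs ht => rw [map_add]; exact add_mem hs ht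
  | smul c t _ ht => rw [map_smul]; exact Submodule.smul_mem _ _ ht

theorem barDiff_comparisonGen_mul (g : Gen X) (p : BarAlg k S) :
    barDiffE k S (comparisonGen k S g * p) = -comparison k S (diffB k S (genB k S g)) * p +
      comparison k S (diffMatrix k S (genB k S g) 0 0) * barDiffE k S p := by
  rw [diffMatrix_genB]
  cases g with
  | pl x =>
    rw [barDiff_barMul, comparisonGen, barParity_bar, barDiff_bar_nil, diffB_pl]
    simp [diffMatrixGen, comparison_genB, comparisonGen]
  | pr x =>
    rw [barDiff_barMul, comparisonGen, barParity_bar, barDiff_bar_nil, diffB_pr]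
    simp [diffMatrixGen, comparison_genB, comparisonGen]
  | ee x =>
    rw [barDiff_barMul, comparisonGen, barParity_bar, barDiff_bar_cons, diffB_ee]
    simp [diffMatrixGen, comparison_genB, comparisonGen, sub_eq_add_neg]

theorem comparison_diffB (b : AlgB k S) :
    comparison k S (-diffB k S b) = barDiffE k S (comparison k S b) := by
  induction b using algB_monomial_induction with
  | one => rw [diffB_one, neg_zero, map_zero, map_one, ← barE_one, barDiff_bar_nil]
  | gen g b hb =>
    rw [map_mul (comparison k S), comparison_genB, barDiff_comparisonGen_mul, ← hb, diffB_mul,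
      map_neg, map_add, map_mul, map_mul, map_neg, neg_mul, mul_neg, neg_add]
  | add a b ha hb => rw [map_add, neg_add, map_add, ha, hb, map_add, map_add]
  | smul c b hb => rw [map_smul, ← smul_neg, map_smul, hb, map_smul, map_smul]

theorem isDGAlgebraHom_liftId :
    IsDGAlgebraHom (LinearMap.mul k (AlgB k S)) 1 (gradingB k S) (-diffB k S)
      (barMul k S) (barOne k S) (barGrading k S) (barDiff k S) (liftId k S) where
  map_one := map_one (comparison k S)
  map_mul := map_mul (comparison k S)
  map_mem := comparison_mem k S
  map_d := comparison_diffB k S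

end Comparison

/-! ### The braided coproduct of the tensor algebra -/

section Coproduct

variable {k : Type u} [CommRing k] {Y : Type w} {V : Type*} [AddCommMonoid V] [Module k V]
variable {r : Y × Y → Y × Y} (b : Basis Y k V)

theorem tensor_word_ext {N : Type*} [AddCommMonoid N] [Module k N]
    {f g : TensorAlgebra k V ⊗[k] TensorAlgebra k V →ₗ[k] N}
    (h : ∀ c d : List Y, f (wordBasis b c ⊗ₜ[k] wordBasis b d) =
      g (wordBasis b c ⊗ₜ[k] wordBasis b d)) : f = g :=
  ((wordBasis b).tensorProduct (wordBasis b)).ext fun i => by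
    rw [Basis.tensorProduct_apply]; exact h i.1 i.2

variable (r) in
/-- Left multiplication by `1 ⊗ y` in the braided tensor product `T(V) ⊗ T(V)`. -/
def crossMul (y : Y) : TensorAlgebra k V ⊗[k] TensorAlgebra k V →ₗ[k]
    TensorAlgebra k V ⊗[k] TensorAlgebra k V :=
  ((wordBasis b).tensorProduct (wordBasis b)).constr k fun p =>
    (-1 : k) ^ p.1.length • (wordBasis b (passLetter r y p.1).1 ⊗ₜ[k]
      wordBasis b ((passLetter r y p.1).2 :: p.2))

theorem crossMul_word (y : Y) (c d : List Y) :
    crossMul r b y (wordBasis b c ⊗ₜ[k] wordBasis b d) =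
      (-1 : k) ^ c.length • (wordBasis b (passLetter r y c).1 ⊗ₜ[k]
        wordBasis b ((passLetter r y c).2 :: d)) := by
  have h : wordBasis b c ⊗ₜ[k] wordBasis b d =
      (wordBasis b).tensorProduct (wordBasis b) (c, d) := by
    rw [Basis.tensorProduct_apply]
  rw [crossMul, h, Basis.constr_basis]

theorem negBraiding_word (c d : List Y) :
    negBraiding r b (wordBasis b c ⊗ₜ[k] wordBasis b d) =
      (-1 : k) ^ (c.length * d.length) •
        (wordBasis b (passWord r c d).1 ⊗ₜ[k] wordBasis b (passWord r c d).2) := by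
  have h : wordBasis b c ⊗ₜ[k] wordBasis b d =
      (wordBasis b).tensorProduct (wordBasis b) (c, d) := by
    rw [Basis.tensorProduct_apply]
  rw [negBraiding, h, Basis.constr_basis]

theorem negBraidedMul_word (u v c d : List Y) :
    negBraidedMul r b (wordBasis b u ⊗ₜ[k] wordBasis b v) (wordBasis b c ⊗ₜ[k] wordBasis b d) =
      (-1 : k) ^ (v.length * c.length) • ((wordBasis b u * wordBasis b (passWord r v c).1) ⊗ₜ[k]
        (wordBasis b (passWord r v c).2 * wordBasis b d)) := by
  simp only [negBraidedMul, TensorProduct.assoc_tmul, TensorProduct.map_tmul, LinearMap.comp_apply,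
    LinearEquiv.coe_coe, TensorProduct.assoc_symm_tmul, negBraiding_word, LinearMap.id_apply,
    ← TensorProduct.smul_tmul', map_smul, TensorProduct.tmul_smul, LinearMap.mul'_apply]

variable (r) in
/-- The product of the braided tensor product `T(V) ⊗ T(V)` as a linear map in the second factor. -/
def negBraidedMulLeft (s : TensorAlgebra k V ⊗[k] TensorAlgebra k V) :
    TensorAlgebra k V ⊗[k] TensorAlgebra k V →ₗ[k] TensorAlgebra k V ⊗[k] TensorAlgebra k V where
  toFun := negBraidedMul r b s
  map_add' z z' := by simp only [negBraidedMul, TensorProduct.tmul_add, map_add]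
  map_smul' c z := by simp only [negBraidedMul, TensorProduct.tmul_smul, map_smul, RingHom.id_apply]

theorem negBraidedMul_left (y : Y) (z : TensorAlgebra k V ⊗[k] TensorAlgebra k V) :
    negBraidedMul r b (TensorAlgebra.ι k (b y) ⊗ₜ[k] 1) z =
      TensorProduct.map (LinearMap.mulLeft k (TensorAlgebra.ι k (b y))) LinearMap.id z := by
  rw [← wordBasis_singleton, ← wordBasis_nil b]
  refine LinearMap.congr_fun (f := negBraidedMulLeft r b _) (tensor_word_ext b fun c d => ?_) z
  refine (negBraidedMul_word (r := r) b [y] [] c d).trans ?_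
  simp [passWord, wordBasis_nil]

theorem negBraidedMul_right (y : Y) (z : TensorAlgebra k V ⊗[k] TensorAlgebra k V) :
    negBraidedMul r b (1 ⊗ₜ[k] TensorAlgebra.ι k (b y)) z = crossMul r b y z := by
  rw [← wordBasis_singleton, ← wordBasis_nil b]
  refine LinearMap.congr_fun (f := negBraidedMulLeft r b _) (tensor_word_ext b fun c d => ?_) z
  refine (negBraidedMul_word (r := r) b [] [y] c d).trans ?_
  rw [crossMul_word, passWord_singleton_left, ← wordBasis_append, ← wordBasis_append]
  simp only [List.length_singleton, one_mul, List.nil_append, List.singleton_append]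

theorem negCoproduct_nil : negCoproduct r b (wordBasis b []) = 1 ⊗ₜ[k] 1 := by
  simp [negCoproduct]

theorem negCoproduct_cons (y : Y) (l : List Y) :
    negCoproduct r b (wordBasis b (y :: l)) =
      TensorProduct.map (LinearMap.mulLeft k (TensorAlgebra.ι k (b y))) LinearMap.id
        (negCoproduct r b (wordBasis b l)) + crossMul r b y (negCoproduct r b (wordBasis b l)) := by
  rw [← negBraidedMul_left (r := r), ← negBraidedMul_right]
  simp only [negCoproduct, Basis.constr_basis, List.foldr_cons]
  simp only [negBraidedMul, TensorProduct.add_tmul, map_add]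

/-- The counit of the tensor algebra, with values in the scalars of an algebra `C`. -/
def counitT {C : Type*} [Ring C] [Algebra k C] : TensorAlgebra k V →ₗ[k] C :=
  (wordBasis b).constr k fun l => match l with
    | [] => 1
    | _ :: _ => 0

section Counit

variable {C : Type*} [Ring C] [Algebra k C]

theorem counitT_nil : counitT b (wordBasis b []) = (1 : C) := by simp [counitT]

theorem counitT_cons (y : Y) (l : List Y) : counitT b (wordBasis b (y :: l)) = (0 : C) := by
  simp [counitT]

theorem counitT_of_deg_two (t : TensorAlgebra k V) (ht : t ∈ ⨆ n : ℕ, tensorDeg k V (n + 2)) :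
    counitT b t = (0 : C) := by
  have : ⨆ n : ℕ, tensorDeg k V (n + 2) ≤ LinearMap.ker (counitT b : _ →ₗ[k] C) := by
    refine iSup_le fun n => ?_
    rw [tensorDeg_eq_span b, Submodule.span_le]
    rintro _ ⟨l, hl, rfl⟩
    rcases l with _ | ⟨y, l⟩
    · simp at hl
    · exact counitT_cons b y l
  exact this ht

end Counit

/-- The linear map which vanishes on all words except the letters, where it is given by `g`. -/
def letterPart {N : Type*} [AddCommMonoid N] [Module k N] (g : Y → N) :
    TensorAlgebra k V →ₗ[k] N :=
  (wordBasis b).constr k fun l => match l with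
    | [y] => g y
    | _ => 0

section LetterPart

variable {N : Type*} [AddCommMonoid N] [Module k N] (g : Y → N)

theorem letterPart_nil : letterPart b g (wordBasis b []) = 0 := by simp [letterPart]

theorem letterPart_singleton (y : Y) : letterPart b g (wordBasis b [y]) = g y := by
  simp [letterPart]

theorem letterPart_cons_cons (y z : Y) (l : List Y) :
    letterPart b g (wordBasis b (y :: z :: l)) = 0 := by simp [letterPart]

theorem letterPart_of_deg_two (t : TensorAlgebra k V) (ht : t ∈ ⨆ n : ℕ, tensorDeg k V (n + 2)) :
    letterPart b g t = 0 := by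
  have : ⨆ n : ℕ, tensorDeg k V (n + 2) ≤ LinearMap.ker (letterPart b g) := by
    refine iSup_le fun n => ?_
    rw [tensorDeg_eq_span b, Submodule.span_le]
    rintro _ ⟨l, hl, rfl⟩
    obtain ⟨y, z, l, rfl⟩ : ∃ y z m, l = y :: z :: m := by
      rcases l with _ | ⟨y, _ | ⟨z, l⟩⟩
      · simp at hl
      · simp at hl
      · exact ⟨y, z, l, rfl⟩
    exact letterPart_cons_cons b g y z l
  exact this ht

end LetterPart

/-- The linear map `c ⊗ d ↦ F c * G d`. -/
def mulMap {C : Type*} [Ring C] [Algebra k C] (F G : TensorAlgebra k V →ₗ[k] C) :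
    TensorAlgebra k V ⊗[k] TensorAlgebra k V →ₗ[k] C :=
  LinearMap.mul' k C ∘ₗ TensorProduct.map F G

theorem mulMap_tmul {C : Type*} [Ring C] [Algebra k C] (F G : TensorAlgebra k V →ₗ[k] C)
    (c d : TensorAlgebra k V) : mulMap F G (c ⊗ₜ[k] d) = F c * G d := by
  simp [mulMap]

theorem mulMap_mem_of_tensorLeft {C : Type*} [Ring C] [Algebra k C]
    {F G : TensorAlgebra k V →ₗ[k] C} {I : Ideal (TensorAlgebra k V)} {N : Submodule k C}
    (h : ∀ a ∈ I, ∀ c, F a * G c ∈ N) (z : TensorAlgebra k V ⊗[k] TensorAlgebra k V)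
    (hz : z ∈ tensorLeft I) : mulMap F G z ∈ N := by
  have h : tensorLeft I ≤ N.comap (mulMap F G) := by
    refine Submodule.span_le.2 ?_
    rintro _ ⟨a, ha, c, rfl⟩
    rw [SetLike.mem_coe, Submodule.mem_comap, mulMap_tmul]
    exact h a ha c
  exact h hz

theorem mulMap_mem_of_tensorRight {C : Type*} [Ring C] [Algebra k C]
    {F G : TensorAlgebra k V →ₗ[k] C} {I : Ideal (TensorAlgebra k V)} {N : Submodule k C}
    (h : ∀ c, ∀ a ∈ I, F c * G a ∈ N) (z : TensorAlgebra k V ⊗[k] TensorAlgebra k V)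
    (hz : z ∈ tensorRight I) : mulMap F G z ∈ N := by
  have h : tensorRight I ≤ N.comap (mulMap F G) := by
    refine Submodule.span_le.2 ?_
    rintro _ ⟨c, a, ha, rfl⟩
    rw [SetLike.mem_coe, Submodule.mem_comap, mulMap_tmul]
    exact h c a ha
  exact h hz

theorem mulMap_mem {C : Type*} [Ring C] [Algebra k C] {F G : TensorAlgebra k V →ₗ[k] C}
    {I : Ideal (TensorAlgebra k V)} {N : Submodule k C} (hl : ∀ a ∈ I, ∀ c, F a * G c ∈ N)
    (hr : ∀ c, ∀ a ∈ I, F c * G a ∈ N) (z : TensorAlgebra k V ⊗[k] TensorAlgebra k V)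
    (hz : z ∈ tensorLeft I ⊔ tensorRight I) : mulMap F G z ∈ N :=
  (sup_le (c := N.comap (mulMap F G)) (mulMap_mem_of_tensorLeft hl)
    (mulMap_mem_of_tensorRight hr)) hz

/-- The counit property `(Id ⊗ ε) Δ = Id`. -/
theorem counit_right (t : TensorAlgebra k V) :
    mulMap LinearMap.id (counitT b) (negCoproduct r b t) = t := by
  suffices h : mulMap LinearMap.id (counitT b) ∘ₗ negCoproduct r b = LinearMap.id from
    LinearMap.congr_fun h t
  refine (wordBasis b).ext fun l => ?_
  rw [LinearMap.comp_apply]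
  induction l with
  | nil =>
    rw [negCoproduct_nil, mulMap_tmul, ← wordBasis_nil b, counitT_nil, LinearMap.id_apply, mul_one]
  | cons y l ih =>
    have h1 : mulMap LinearMap.id (counitT b) ∘ₗ
        TensorProduct.map (LinearMap.mulLeft k (TensorAlgebra.ι k (b y))) LinearMap.id =
        LinearMap.mulLeft k (TensorAlgebra.ι k (b y)) ∘ₗ mulMap LinearMap.id (counitT b) :=
      tensor_word_ext b fun c d => by simp [mulMap_tmul, mul_assoc]
    have h2 : mulMap LinearMap.id (counitT b) ∘ₗ crossMul r b y = 0 :=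
      tensor_word_ext b fun c d => by simp [crossMul_word, mulMap_tmul, counitT_cons]
    have e1 := LinearMap.congr_fun h1 (negCoproduct r b (wordBasis b l))
    have e2 := LinearMap.congr_fun h2 (negCoproduct r b (wordBasis b l))
    rw [LinearMap.comp_apply] at e1 e2
    rw [negCoproduct_cons, map_add, e1, e2, LinearMap.comp_apply, ih, wordBasis_cons]
    simp

/-- The counit property `(ε ⊗ Id) Δ = Id`. -/
theorem counit_left (t : TensorAlgebra k V) :
    mulMap (counitT b) LinearMap.id (negCoproduct r b t) = t := by
  suffices h : mulMap (counitT b) LinearMap.id ∘ₗ negCoproduct r b = LinearMap.id from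
    LinearMap.congr_fun h t
  refine (wordBasis b).ext fun l => ?_
  rw [LinearMap.comp_apply]
  induction l with
  | nil =>
    rw [negCoproduct_nil, mulMap_tmul, ← wordBasis_nil b, counitT_nil, LinearMap.id_apply, one_mul]
  | cons y l ih =>
    have h1 : mulMap (counitT b) LinearMap.id ∘ₗ
        TensorProduct.map (LinearMap.mulLeft k (TensorAlgebra.ι k (b y))) LinearMap.id = 0 :=
      tensor_word_ext b fun c d => by simp [mulMap_tmul, ← wordBasis_cons, counitT_cons]
    have h2 : mulMap (counitT b) LinearMap.id ∘ₗ crossMul r b y =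
        LinearMap.mulLeft k (TensorAlgebra.ι k (b y)) ∘ₗ mulMap (counitT b) LinearMap.id :=
      tensor_word_ext b fun c d => by
        rcases c with _ | ⟨z, c⟩
        · simp [crossMul_word, mulMap_tmul, counitT_nil, passLetter, wordBasis_cons]
        · simp [crossMul_word, mulMap_tmul, counitT_cons, passLetter]
    have e1 := LinearMap.congr_fun h1 (negCoproduct r b (wordBasis b l))
    have e2 := LinearMap.congr_fun h2 (negCoproduct r b (wordBasis b l))
    rw [LinearMap.comp_apply] at e1 e2
    rw [negCoproduct_cons, map_add, e1, e2, LinearMap.comp_apply, ih, wordBasis_cons]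
    simp

/-- The parity automorphism of the tensor algebra. -/
def parityT : TensorAlgebra k V →ₗ[k] TensorAlgebra k V :=
  (wordBasis b).constr k fun l => (-1 : k) ^ l.length • wordBasis b l

theorem parityT_word (l : List Y) :
    parityT b (wordBasis b l) = (-1 : k) ^ l.length • wordBasis b l := by
  simp [parityT]

theorem parityT_of_mem (n : ℕ) (t : TensorAlgebra k V) (ht : t ∈ tensorDeg k V n) :
    parityT b t = (-1 : k) ^ n • t := by
  rw [tensorDeg_eq_span b] at ht
  induction ht using Submodule.span_induction with
  | mem t ht => obtain ⟨l, rfl, rfl⟩ := ht; exact parityT_word b l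
  | zero => simp
  | add s t _ _ hs ht => rw [map_add, hs, ht, smul_add]
  | smul c t _ ht => rw [map_smul, ht, smul_comm]

theorem parityT_mem {I : Ideal (TensorAlgebra k V)} (hI : IsBraidedHopfIdeal r b I)
    (t : TensorAlgebra k V) (ht : t ∈ I) : parityT b t ∈ I := by
  have h : Submodule.span k {c | c ∈ I ∧ ∃ n, c ∈ tensorDeg k V n} ≤
      (I.restrictScalars k).comap (parityT b) := by
    rw [Submodule.span_le]
    rintro c ⟨hc, n, hn⟩
    rw [SetLike.mem_coe, Submodule.mem_comap, parityT_of_mem b n c hn]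
    exact Submodule.smul_mem (I.restrictScalars k) _ hc
  exact h (hI.homogeneous t ht)

theorem basisProj_mem {I : Ideal (TensorAlgebra k V)} (hI : IsBraidedHopfIdeal r b I) (n : ℕ)
    (t : TensorAlgebra k V) (ht : t ∈ I) : basisProj (wordBasis b) List.length n t ∈ I := by
  have h : Submodule.span k {c | c ∈ I ∧ ∃ n, c ∈ tensorDeg k V n} ≤
      (I.restrictScalars k).comap (basisProj (wordBasis b) List.length n) := by
    rw [Submodule.span_le]
    rintro c ⟨hc, m, hm⟩
    rw [tensorDeg_eq_span b] at hm
    rw [SetLike.mem_coe, Submodule.mem_comap, basisProj_of_mem _ _ _ _ _ hm]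
    split_ifs
    · exact hc
    · exact zero_mem _
  exact h (hI.homogeneous t ht)

theorem basisProj_zero_ι_mul (y : Y) (t : TensorAlgebra k V) :
    basisProj (wordBasis b) List.length 0 (TensorAlgebra.ι k (b y) * t) = 0 := by
  induction t using basis_induction (wordBasis b) with
  | zero => simp
  | add s t hs ht => rw [mul_add, map_add, hs, ht, add_zero]
  | smul c t ht => rw [mul_smul_comm, map_smul, ht, smul_zero]
  | basis l => rw [← wordBasis_cons, basisProj_basis, if_neg (by simp)]

theorem basisProj_succ_ι_mul (n : ℕ) (y : Y) (t : TensorAlgebra k V) :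
    basisProj (wordBasis b) List.length (n + 1) (TensorAlgebra.ι k (b y) * t) =
      TensorAlgebra.ι k (b y) * basisProj (wordBasis b) List.length n t := by
  induction t using basis_induction (wordBasis b) with
  | zero => simp
  | add s t hs ht => rw [mul_add, map_add, hs, ht, map_add, mul_add]
  | smul c t ht => rw [mul_smul_comm, map_smul, ht, map_smul, mul_smul_comm]
  | basis l =>
    rw [← wordBasis_cons, basisProj_basis, basisProj_basis]
    by_cases h : l.length = n
    · rw [if_pos (by simpa using h), if_pos h, wordBasis_cons]
    · rw [if_neg (by simpa using h), if_neg h, mul_zero]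

theorem eq_zero_of_basisProj {ι E : Type*} [AddCommGroup E] [Module k E] (b : Basis ι k E)
    (deg : ι → ℕ) (x : E) (h : ∀ n, basisProj b deg n x = 0) : x = 0 := by
  have key : ∀ i, b.coord i (basisProj b deg (deg i) x) = b.coord i x := fun i => by
    refine LinearMap.congr_fun (f := b.coord i ∘ₗ basisProj b deg (deg i)) (b.ext fun j => ?_) x
    rw [LinearMap.comp_apply, basisProj_basis]
    split_ifs with hij
    · rfl
    · rw [map_zero, Basis.coord_apply, Basis.repr_self, Finsupp.single_eq_of_ne]
      rintro rfl
      exact hij rfl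
  refine b.ext_elem fun i => ?_
  rw [map_zero, Finsupp.zero_apply, ← Basis.coord_apply, ← key, h, map_zero]

/-- An additive property holds on the Nichols ideal if it holds on all braided Hopf ideals. -/
theorem nicholsIdeal_induction {P : TensorAlgebra k V → Prop}
    (mem : ∀ I, IsBraidedHopfIdeal r b I → ∀ t ∈ I, P t) (zero : P 0)
    (add : ∀ s t, P s → P t → P (s + t)) {t : TensorAlgebra k V} (ht : t ∈ nicholsIdeal r b) :
    P t := by
  rw [nicholsIdeal, sSup_eq_iSup'] at ht
  exact Submodule.iSup_induction (motive := P) _ ht (fun I t ht => mem I.1 I.2 t ht) zero add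

theorem le_nicholsIdeal {I : Ideal (TensorAlgebra k V)} (hI : IsBraidedHopfIdeal r b I) :
    I ≤ nicholsIdeal r b := le_sSup hI

theorem basisProj_mem_nicholsIdeal (n : ℕ) (t : TensorAlgebra k V) (ht : t ∈ nicholsIdeal r b) :
    basisProj (wordBasis b) List.length n t ∈ nicholsIdeal r b := by
  refine nicholsIdeal_induction (r := r) b
    (P := fun t => basisProj (wordBasis b) List.length n t ∈ nicholsIdeal r b)
    (fun I hI t ht => le_nicholsIdeal b hI (basisProj_mem b hI n t ht)) ?_
    (fun s t hs ht => ?_) ht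
  · rw [map_zero]; exact zero_mem _
  · rw [map_add]; exact add_mem hs ht

end Coproduct

/-! ### Quantum symmetrizers vanish on the Nichols ideal -/

section SymmetrizerNichols

variable (k : Type u) [CommRing k] {X : Type v} (S : Solution X)

/-- The tensor algebra of `V = ⊕ k e_x`. -/
abbrev TensorV (X : Type v) : Type (max u v) := TensorAlgebra k (X →₀ k)

/-- The iterated quantum shuffle product as a linear map `T(V) → T(A)`. -/
def shuffleMap : TensorV k X →ₗ[k] TensorAlgebra k (AlgA k S) :=
  (wordBasis (basisV k X)).constr k fun l =>
    iteratedShuffle (braidM S) (basisA k S) (l.map (mkLetter S))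

theorem shuffleMap_word (l : List X) : shuffleMap k S (wordBasis (basisV k X) l) =
    iteratedShuffle (braidM S) (basisA k S) (l.map (mkLetter S)) := by
  simp [shuffleMap]

theorem shuffleMap_nil : shuffleMap k S (wordBasis (basisV k X) []) = 1 := shuffleMap_word k S []

theorem shuffleMap_cons (x : X) (l : List X) :
    shuffleMap k S (wordBasis (basisV k X) (x :: l)) =
      shA k S (TensorAlgebra.ι k (basisA k S (mkLetter S x)))
        (shuffleMap k S (wordBasis (basisV k X) l)) := by
  rw [shuffleMap_word, shuffleMap_word]
  rfl

/-- The part `c ⊗ d ↦ c * (shuffle of d)`, for `c` of degree one, of the shuffle map composed with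
the coproduct. -/
def shufflePart : TensorV k X ⊗[k] TensorV k X →ₗ[k] TensorAlgebra k (AlgA k S) :=
  mulMap (letterPart (basisV k X) fun x => TensorAlgebra.ι k (basisA k S (mkLetter S x)))
    (shuffleMap k S)

theorem shA_ι_ι_mul (x y : X) (t : TensorAlgebra k (AlgA k S)) :
    shA k S (TensorAlgebra.ι k (basisA k S (mkLetter S x)))
        (TensorAlgebra.ι k (basisA k S (mkLetter S y)) * t) =
      TensorAlgebra.ι k (basisA k S (mkLetter S x)) *
          (TensorAlgebra.ι k (basisA k S (mkLetter S y)) * t) -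
        TensorAlgebra.ι k (basisA k S (mkLetter S (S.toEquiv (x, y)).1)) *
          shA k S (TensorAlgebra.ι k (basisA k S (mkLetter S (S.toEquiv (x, y)).2))) t := by
  have h := negShuffle_ι_mul_right (r := braidM S) (basisA k S) (mkLetter S x) (mkLetter S y) [] t
  rw [wordBasis_nil, negShuffle_one_left, wordBasis_singleton] at h
  rw [h, List.length_nil, zero_add, pow_one, neg_smul, one_smul, ← sub_eq_add_neg]
  simp only [passLetterLeft, wordBasis_singleton, braidM_mkLetter]

/-- The quantum symmetrizer factors through the coproduct. -/
theorem shuffleMap_eq (t : TensorV k X) : shuffleMap k S t =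
    counitT (basisV k X) t + shufflePart k S (negCoproduct S.toEquiv (basisV k X) t) := by
  suffices h : shuffleMap k S = counitT (basisV k X) +
      shufflePart k S ∘ₗ negCoproduct S.toEquiv (basisV k X) from LinearMap.congr_fun h t
  refine (wordBasis (basisV k X)).ext fun l => ?_
  rw [LinearMap.add_apply, LinearMap.comp_apply]
  induction l with
  | nil =>
    rw [negCoproduct_nil, counitT_nil, shuffleMap_nil, shufflePart, mulMap_tmul,
      ← wordBasis_nil (basisV k X), letterPart_nil, zero_mul, add_zero]
  | cons y l ih =>
    have h1 : shufflePart k S ∘ₗ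
        TensorProduct.map (LinearMap.mulLeft k (TensorAlgebra.ι k (basisV k X y))) LinearMap.id =
        LinearMap.mulLeft k (TensorAlgebra.ι k (basisA k S (mkLetter S y))) ∘ₗ shuffleMap k S ∘ₗ
          mulMap (counitT (basisV k X)) LinearMap.id := by
      refine tensor_word_ext (basisV k X) fun c d => ?_
      simp only [LinearMap.comp_apply, TensorProduct.map_tmul, LinearMap.mulLeft_apply,
        LinearMap.id_apply, shufflePart, mulMap_tmul, ← wordBasis_cons]
      rcases c with _ | ⟨z, c⟩
      · rw [letterPart_singleton, counitT_nil, one_mul]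
      · rw [letterPart_cons_cons, counitT_cons, zero_mul, zero_mul, map_zero, mul_zero]
    have h2 : shufflePart k S ∘ₗ crossMul S.toEquiv (basisV k X) y =
        (shA k S (TensorAlgebra.ι k (basisA k S (mkLetter S y))) -
          LinearMap.mulLeft k (TensorAlgebra.ι k (basisA k S (mkLetter S y)))) ∘ₗ
          shufflePart k S := by
      refine tensor_word_ext (basisV k X) fun c d => ?_
      simp only [LinearMap.comp_apply, LinearMap.sub_apply, LinearMap.mulLeft_apply, crossMul_word,
        shufflePart, map_smul, mulMap_tmul]
      rcases c with _ | ⟨z, _ | ⟨z', c⟩⟩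
      · simp only [passLetter, letterPart_nil, zero_mul, smul_zero, map_zero, mul_zero, sub_zero]
      · simp only [passLetter, letterPart_singleton, shuffleMap_cons]
        rw [shA_ι_ι_mul]
        simp
      · simp only [passLetter, letterPart_cons_cons, zero_mul, smul_zero, map_zero, mul_zero,
          sub_zero]
    have e1 := LinearMap.congr_fun h1
      (negCoproduct S.toEquiv (basisV k X) (wordBasis (basisV k X) l))
    have e2 := LinearMap.congr_fun h2
      (negCoproduct S.toEquiv (basisV k X) (wordBasis (basisV k X) l))
    simp only [LinearMap.comp_apply, LinearMap.sub_apply, LinearMap.mulLeft_apply] at e1 e2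
    rw [negCoproduct_cons, map_add, e1, e2, counit_left, counitT_cons, zero_add, shuffleMap_cons,
      ih]
    rcases l with _ | ⟨z, l⟩
    · simp only [counitT_nil, map_add, mul_add, negShuffle_one_right, mul_one]; abel
    · simp only [counitT_cons, map_add, mul_add, mul_zero, map_zero]; abel

/-- The projection onto the tensors of degree `n` in the tensor algebra of `A`. -/
abbrev projA (n : ℕ) : TensorAlgebra k (AlgA k S) →ₗ[k] TensorAlgebra k (AlgA k S) :=
  basisProj (wordBasis (basisA k S)) List.length n

theorem projA_zero_shufflePart (z : TensorV k X ⊗[k] TensorV k X) :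
    projA k S 0 (shufflePart k S z) = 0 := by
  refine LinearMap.congr_fun (f := projA k S 0 ∘ₗ shufflePart k S) (g := 0)
    (tensor_word_ext (basisV k X) fun c d => ?_) z
  rw [LinearMap.comp_apply, shufflePart, mulMap_tmul]
  rcases c with _ | ⟨z, _ | ⟨z', c⟩⟩
  · rw [letterPart_nil, zero_mul, map_zero]; rfl
  · rw [letterPart_singleton, basisProj_zero_ι_mul]; rfl
  · rw [letterPart_cons_cons, zero_mul, map_zero]; rfl

theorem projA_succ_shufflePart (n : ℕ) (z : TensorV k X ⊗[k] TensorV k X) :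
    projA k S (n + 1) (shufflePart k S z) =
      mulMap (letterPart (basisV k X) fun x => TensorAlgebra.ι k (basisA k S (mkLetter S x)))
        (projA k S n ∘ₗ shuffleMap k S) z := by
  refine LinearMap.congr_fun (f := projA k S (n + 1) ∘ₗ shufflePart k S)
    (tensor_word_ext (basisV k X) fun c d => ?_) z
  rw [LinearMap.comp_apply, shufflePart, mulMap_tmul, mulMap_tmul]
  rcases c with _ | ⟨z, _ | ⟨z', c⟩⟩
  · rw [letterPart_nil, zero_mul, zero_mul, map_zero]
  · rw [letterPart_singleton, basisProj_succ_ι_mul]; rfl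
  · rw [letterPart_cons_cons, zero_mul, zero_mul, map_zero]

/-- The quantum symmetrizer vanishes on the defining ideal of the Nichols algebra. -/
theorem shuffleMap_of_mem {t : TensorV k X}
    (ht : t ∈ nicholsIdeal (k := k) S.toEquiv (basisV k X)) : shuffleMap k S t = 0 := by
  refine nicholsIdeal_induction (r := S.toEquiv) (basisV k X) (P := fun t => shuffleMap k S t = 0)
    (fun I hI t ht => ?_) (map_zero _) (fun s t hs ht => by rw [map_add, hs, ht, add_zero]) ht
  refine eq_zero_of_basisProj (wordBasis (basisA k S)) List.length _ fun n => ?_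
  induction n generalizing t with
  | zero =>
    rw [shuffleMap_eq, map_add, counitT_of_deg_two _ _ (hI.deg_two t ht), map_zero, zero_add]
    exact projA_zero_shufflePart k S _
  | succ n ih =>
    rw [shuffleMap_eq, map_add, counitT_of_deg_two _ _ (hI.deg_two t ht), map_zero, zero_add]
    refine (projA_succ_shufflePart k S n _).trans ?_
    rw [← Submodule.mem_bot k]
    refine mulMap_mem (fun a ha c => ?_) (fun c a ha => ?_) _ (hI.coideal t ht)
    · rw [letterPart_of_deg_two _ _ _ (hI.deg_two a ha), zero_mul]
      exact zero_mem _
    · rw [LinearMap.comp_apply, ih a ha, mul_zero]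
      exact zero_mem _

end SymmetrizerNichols

/-! ### The ideal of `B` generated by the Nichols ideal -/

section NicholsKernel

variable (k : Type u) [CommRing k] {X : Type v} (S : Solution X)

/-- The algebra map `T(V) → B` which sends a letter `x` to `e_x`. -/
def eMap : TensorV k X →ₐ[k] AlgB k S :=
  TensorAlgebra.lift k ((basisV k X).constr k fun x => genB k S (.ee x))

/-- The algebra map `T(V) → A` which sends a letter `x` to `x`. -/
def letterA : TensorV k X →ₐ[k] AlgA k S :=
  TensorAlgebra.lift k ((basisV k X).constr k fun x =>
    MonoidAlgebra.of k (StructureMonoid S) (mkLetter S x))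

theorem eMap_ι (x : X) : eMap k S (TensorAlgebra.ι k (basisV k X x)) = genB k S (.ee x) := by
  rw [eMap, TensorAlgebra.lift_ι_apply, Basis.constr_basis]

theorem letterA_ι (x : X) : letterA k S (TensorAlgebra.ι k (basisV k X x)) =
    MonoidAlgebra.of k (StructureMonoid S) (mkLetter S x) := by
  rw [letterA, TensorAlgebra.lift_ι_apply, Basis.constr_basis]

theorem eMap_word (l : List X) : eMap k S (wordBasis (basisV k X) l) = eWord k S l := by
  induction l with
  | nil => rw [wordBasis_nil, map_one, eWord_nil]
  | cons x l ih => rw [wordBasis_cons, map_mul, ih, eMap_ι, eWord_cons]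

theorem inclA_letter (x : X) :
    inclA k S (MonoidAlgebra.of k _ (mkLetter S x)) = genB k S (.pl x) := by
  have := inclA_mkLetter_mul S k x 1
  rwa [mul_one, inclA_one, mul_one] at this

theorem inclA'_letter (x : X) :
    inclA' k S (MonoidAlgebra.of k _ (mkLetter S x)) = genB k S (.pr x) := by
  have := inclA'_mkLetter_mul S k x 1
  rwa [mul_one, inclA'_one, mul_one] at this

theorem eWord_mul_pr (w : List X) (y : X) :
    eWord k S w * genB k S (.pr y) =
      genB k S (.pr (passLetterLeft S.toEquiv w y).1) *
        eWord k S (passLetterLeft S.toEquiv w y).2 := by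
  induction w with
  | nil => simp [eWord, passLetterLeft]
  | cons x w ih =>
    rw [eWord_cons, mul_assoc, ih, ← mul_assoc, genB_rel k S (RelB.ee_pr _ _), passLetterLeft,
      eWord_cons, mul_assoc]

/-- Moving `x` to the right past `t` is an instance of the braiding of `T(V)`, up to the parity
automorphism. -/
theorem pl_mul_eMap (x : X) (t : TensorV k X) :
    genB k S (.pl x) * eMap k S t =
      mulMap (eMap k S).toLinearMap ((inclA k S).toLinearMap ∘ₗ (letterA k S).toLinearMap)
        (negBraiding S.toEquiv (basisV k X)
          (TensorAlgebra.ι k (basisV k X x) ⊗ₜ[k] parityT (basisV k X) t)) := by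
  refine LinearMap.congr_fun (f := LinearMap.mulLeft k (genB k S (.pl x)) ∘ₗ
      (eMap k S).toLinearMap)
    (g := mulMap _ _ ∘ₗ negBraiding S.toEquiv (basisV k X) ∘ₗ
      TensorProduct.mk k _ _ _ ∘ₗ parityT (basisV k X))
    ((wordBasis (basisV k X)).ext fun l => ?_) t
  simp only [LinearMap.comp_apply, LinearMap.mulLeft_apply, AlgHom.toLinearMap_apply,
    TensorProduct.mk_apply, parityT_word, map_smul,
    ← wordBasis_singleton, negBraiding_word, passWord_singleton_left, mulMap_tmul, eMap_word]
  rw [wordBasis_singleton, letterA_ι, inclA_letter, pl_mul_eWord, smul_smul, List.length_singleton,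
    one_mul, ← mul_pow, neg_one_mul, neg_neg, one_pow, one_smul]

/-- Moving `y'` to the left past `t` is an instance of the braiding of `T(V)`, up to the parity
automorphism. -/
theorem eMap_mul_pr (t : TensorV k X) (y : X) :
    eMap k S t * genB k S (.pr y) =
      mulMap ((inclA' k S).toLinearMap ∘ₗ (letterA k S).toLinearMap) (eMap k S).toLinearMap
        (negBraiding S.toEquiv (basisV k X)
          (parityT (basisV k X) t ⊗ₜ[k] TensorAlgebra.ι k (basisV k X y))) := by
  refine LinearMap.congr_fun (f := LinearMap.mulRight k (genB k S (.pr y)) ∘ₗ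
      (eMap k S).toLinearMap)
    (g := mulMap _ _ ∘ₗ negBraiding S.toEquiv (basisV k X) ∘ₗ
      (TensorProduct.mk k _ _).flip _ ∘ₗ parityT (basisV k X))
    ((wordBasis (basisV k X)).ext fun l => ?_) t
  simp only [LinearMap.comp_apply, LinearMap.mulRight_apply, AlgHom.toLinearMap_apply,
    LinearMap.flip_apply, TensorProduct.mk_apply, parityT_word,
    map_smul, ← wordBasis_singleton, negBraiding_word, passWord_singleton_right, mulMap_tmul,
    eMap_word]
  rw [wordBasis_singleton, letterA_ι, inclA'_letter, eWord_mul_pr, smul_smul,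
    List.length_singleton, mul_one, ← mul_pow, neg_one_mul, neg_neg, one_pow, one_smul]

/-- The part of the differential of `e_{x₁} ⋯ e_{xₙ}` with the terms in which some `e_x` is replaced
by `x`; it factors through the coproduct. -/
def diffRight : TensorV k X ⊗[k] TensorV k X →ₗ[k] AlgB k S :=
  mulMap ((eMap k S).toLinearMap ∘ₗ parityT (basisV k X))
    (letterPart (basisV k X) fun x => genB k S (.pl x))

/-- The part of the differential of `e_{x₁} ⋯ e_{xₙ}` with the terms in which some `e_x` is replaced
by `x'`; it factors through the coproduct. -/
def diffLeft : TensorV k X ⊗[k] TensorV k X →ₗ[k] AlgB k S :=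
  mulMap (letterPart (basisV k X) fun x => genB k S (.pr x)) (eMap k S).toLinearMap

theorem diffRight_mulLeft (y : X) (z : TensorV k X ⊗[k] TensorV k X) :
    diffRight k S (TensorProduct.map (LinearMap.mulLeft k (TensorAlgebra.ι k (basisV k X y)))
      LinearMap.id z) = -(genB k S (.ee y) * diffRight k S z) := by
  refine LinearMap.congr_fun (f := diffRight k S ∘ₗ TensorProduct.map _ LinearMap.id)
    (g := -(LinearMap.mulLeft k (genB k S (.ee y)) ∘ₗ diffRight k S))
    (tensor_word_ext (basisV k X) fun c d => ?_) z
  simp only [LinearMap.comp_apply, LinearMap.neg_apply, TensorProduct.map_tmul,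
    LinearMap.mulLeft_apply, LinearMap.id_apply, diffRight, mulMap_tmul, ← wordBasis_cons,
    parityT_word, map_smul, AlgHom.toLinearMap_apply, eMap_word, eWord_cons, List.length_cons,
    smul_mul_assoc, mul_assoc]
  rw [pow_succ, mul_neg_one, neg_smul]

theorem diffRight_crossMul (y : X) (z : TensorV k X ⊗[k] TensorV k X) :
    diffRight k S (crossMul S.toEquiv (basisV k X) y z) =
      genB k S (.pl y) * eMap k S (mulMap LinearMap.id (counitT (basisV k X)) z) := by
  refine LinearMap.congr_fun (f := diffRight k S ∘ₗ crossMul S.toEquiv (basisV k X) y)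
    (g := LinearMap.mulLeft k (genB k S (.pl y)) ∘ₗ (eMap k S).toLinearMap ∘ₗ
      mulMap LinearMap.id (counitT (basisV k X)))
    (tensor_word_ext (basisV k X) fun c d => ?_) z
  simp only [LinearMap.comp_apply, LinearMap.mulLeft_apply, LinearMap.id_apply, diffRight,
    crossMul_word, map_smul, mulMap_tmul, parityT_word, length_passLetter,
    AlgHom.toLinearMap_apply]
  rcases d with _ | ⟨z, d⟩
  · rw [letterPart_singleton, counitT_nil, mul_one, eMap_word, eMap_word, pl_mul_eWord,
      smul_mul_assoc, smul_smul, ← mul_pow, neg_one_mul, neg_neg, one_pow, one_smul]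
  · rw [letterPart_cons_cons, counitT_cons, mul_zero, mul_zero, map_zero, mul_zero, smul_zero]

theorem diffLeft_mulLeft (y : X) (z : TensorV k X ⊗[k] TensorV k X) :
    diffLeft k S (TensorProduct.map (LinearMap.mulLeft k (TensorAlgebra.ι k (basisV k X y)))
      LinearMap.id z) =
        genB k S (.pr y) * eMap k S (mulMap (counitT (basisV k X)) LinearMap.id z) := by
  refine LinearMap.congr_fun (f := diffLeft k S ∘ₗ TensorProduct.map _ LinearMap.id)
    (g := LinearMap.mulLeft k (genB k S (.pr y)) ∘ₗ (eMap k S).toLinearMap ∘ₗ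
      mulMap (counitT (basisV k X)) LinearMap.id)
    (tensor_word_ext (basisV k X) fun c d => ?_) z
  simp only [LinearMap.comp_apply, TensorProduct.map_tmul, LinearMap.mulLeft_apply,
    LinearMap.id_apply, diffLeft, mulMap_tmul, ← wordBasis_cons, AlgHom.toLinearMap_apply]
  rcases c with _ | ⟨z, c⟩
  · rw [letterPart_singleton, counitT_nil, one_mul]
  · rw [letterPart_cons_cons, counitT_cons, zero_mul, zero_mul, map_zero, mul_zero]

theorem diffLeft_crossMul (y : X) (z : TensorV k X ⊗[k] TensorV k X) :
    diffLeft k S (crossMul S.toEquiv (basisV k X) y z) =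
      -(genB k S (.ee y) * diffLeft k S z) := by
  refine LinearMap.congr_fun (f := diffLeft k S ∘ₗ crossMul S.toEquiv (basisV k X) y)
    (g := -(LinearMap.mulLeft k (genB k S (.ee y)) ∘ₗ diffLeft k S))
    (tensor_word_ext (basisV k X) fun c d => ?_) z
  simp only [LinearMap.comp_apply, LinearMap.neg_apply, LinearMap.mulLeft_apply, diffLeft,
    crossMul_word, map_smul, mulMap_tmul, AlgHom.toLinearMap_apply]
  rcases c with _ | ⟨z, _ | ⟨z', c⟩⟩
  · simp only [passLetter, letterPart_nil, zero_mul, smul_zero, mul_zero, neg_zero]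
  · simp only [passLetter, letterPart_singleton, List.length_singleton, pow_one, neg_smul, one_smul,
      eMap_word, eWord_cons]
    rw [← mul_assoc, ← mul_assoc, genB_rel k S (RelB.ee_pr y z)]
  · simp only [passLetter, letterPart_cons_cons, zero_mul, smul_zero, mul_zero, neg_zero]

/-- The differential of `B` on the subalgebra generated by the `e_x` factors through the braided
coproduct of `T(V)`. -/
theorem diffB_eMap (t : TensorV k X) : diffB k S (eMap k S t) =
    diffRight k S (negCoproduct S.toEquiv (basisV k X) t) -
      diffLeft k S (negCoproduct S.toEquiv (basisV k X) t) := by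
  refine LinearMap.congr_fun (f := diffB k S ∘ₗ (eMap k S).toLinearMap)
    (g := diffRight k S ∘ₗ negCoproduct S.toEquiv (basisV k X) -
      diffLeft k S ∘ₗ negCoproduct S.toEquiv (basisV k X))
    ((wordBasis (basisV k X)).ext fun l => ?_) t
  simp only [LinearMap.comp_apply, LinearMap.sub_apply, AlgHom.toLinearMap_apply]
  induction l with
  | nil =>
    rw [negCoproduct_nil, diffRight, diffLeft, mulMap_tmul, mulMap_tmul,
      ← wordBasis_nil (basisV k X), letterPart_nil, letterPart_nil, mul_zero, zero_mul, sub_zero,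
      wordBasis_nil, map_one, diffB_one]
  | cons y l ih =>
    rw [wordBasis_cons, map_mul, eMap_ι, diffB_ee_mul, ih, ← wordBasis_cons, negCoproduct_cons,
      map_add, map_add, diffRight_mulLeft, diffRight_crossMul, diffLeft_mulLeft, diffLeft_crossMul,
      counit_left, counit_right, sub_mul, mul_sub]
    abel

/-- The span of the elements `a' i c` of `B` with `i` in an ideal of `T(V)`. -/
def sandwichSpan (I : Ideal (TensorV k X)) : Submodule k (AlgB k S) :=
  Submodule.span k {z | ∃ a, ∃ i ∈ I, ∃ c, z = inclA' k S a * eMap k S i * inclA k S c}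

/-- The span of the elements `a' i` of `B` with `i` in an ideal of `T(V)`. -/
def leftSpan (I : Ideal (TensorV k X)) : Submodule k (AlgB k S) :=
  Submodule.span k {z | ∃ a, ∃ i ∈ I, z = inclA' k S a * eMap k S i}

/-- The kernel of the map from `B` to `A ⊗ 𝔅 ⊗ A`. -/
abbrev nicholsKernel : Submodule k (AlgB k S) :=
  sandwichSpan k S (nicholsIdeal (k := k) S.toEquiv (basisV k X))

variable {k S}

theorem sandwichSpan_mono {I J : Ideal (TensorV k X)} (h : I ≤ J) :
    sandwichSpan k S I ≤ sandwichSpan k S J :=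
  Submodule.span_mono fun _ ⟨a, i, hi, c, hz⟩ => ⟨a, i, h hi, c, hz⟩

theorem leftSpan_mono {I J : Ideal (TensorV k X)} (h : I ≤ J) :
    leftSpan k S I ≤ leftSpan k S J :=
  Submodule.span_mono fun _ ⟨a, i, hi, hz⟩ => ⟨a, i, h hi, hz⟩

variable {I : Ideal (TensorV k X)}

theorem sandwich_mem (a c : AlgA k S) {z : AlgB k S} (hz : z ∈ sandwichSpan k S I) :
    inclA' k S a * z * inclA k S c ∈ sandwichSpan k S I := by
  induction hz using Submodule.span_induction with
  | mem z hz =>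
    obtain ⟨a₁, i, hi, c₁, rfl⟩ := hz
    exact Submodule.subset_span ⟨a * a₁, i, hi, c₁ * c, by simp only [map_mul, mul_assoc]⟩
  | zero => simp
  | add s t _ _ hs ht => rw [mul_add, add_mul]; exact add_mem hs ht
  | smul r t _ ht => rw [mul_smul_comm, smul_mul_assoc]; exact Submodule.smul_mem _ _ ht

theorem leftSpan_mul_inclA (c : AlgA k S) {z : AlgB k S} (hz : z ∈ leftSpan k S I) :
    z * inclA k S c ∈ sandwichSpan k S I := by
  induction hz using Submodule.span_induction with
  | mem z hz =>
    obtain ⟨a, i, hi, rfl⟩ := hz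
    exact Submodule.subset_span ⟨a, i, hi, c, rfl⟩
  | zero => simp
  | add s t _ _ hs ht => rw [add_mul]; exact add_mem hs ht
  | smul r t _ ht => rw [smul_mul_assoc]; exact Submodule.smul_mem _ _ ht

theorem eMap_mul_inclA_mem {i : TensorV k X} (hi : i ∈ I) (c : AlgA k S) :
    eMap k S i * inclA k S c ∈ sandwichSpan k S I :=
  Submodule.subset_span ⟨1, i, hi, c, by rw [map_one, one_mul]⟩

theorem inclA'_mul_eMap_mem {i : TensorV k X} (hi : i ∈ I) (a : AlgA k S) :
    inclA' k S a * eMap k S i ∈ leftSpan k S I :=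
  Submodule.subset_span ⟨a, i, hi, rfl⟩

variable (k S)

theorem pl_mul_eMap_mem (x : X) {i : TensorV k X}
    (hi : i ∈ nicholsIdeal (k := k) S.toEquiv (basisV k X)) :
    genB k S (.pl x) * eMap k S i ∈ nicholsKernel k S := by
  refine nicholsIdeal_induction (r := S.toEquiv) (basisV k X)
    (P := fun i => genB k S (.pl x) * eMap k S i ∈ nicholsKernel k S)
    (fun I hI i hi => ?_) (by simp) (fun s t hs ht => by rw [map_add, mul_add]; exact add_mem hs ht)
    hi
  refine sandwichSpan_mono (le_nicholsIdeal (basisV k X) hI) ?_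
  rw [pl_mul_eMap]
  refine mulMap_mem_of_tensorLeft (fun a ha c => eMap_mul_inclA_mem ha _) _ (hI.braid_right _
    (Submodule.subset_span ⟨_, _, parityT_mem (basisV k X) hI i hi, rfl⟩))

theorem eMap_mul_pr_mem (y : X) {i : TensorV k X}
    (hi : i ∈ nicholsIdeal (k := k) S.toEquiv (basisV k X)) :
    eMap k S i * genB k S (.pr y) ∈
      leftSpan k S (nicholsIdeal (k := k) S.toEquiv (basisV k X)) := by
  refine nicholsIdeal_induction (r := S.toEquiv) (basisV k X)
    (P := fun i => eMap k S i * genB k S (.pr y) ∈ leftSpan k S _)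
    (fun I hI i hi => ?_) (by simp) (fun s t hs ht => by rw [map_add, add_mul]; exact add_mem hs ht)
    hi
  refine leftSpan_mono (le_nicholsIdeal (basisV k X) hI) ?_
  rw [eMap_mul_pr]
  refine mulMap_mem_of_tensorRight (fun c a ha => inclA'_mul_eMap_mem ha _) _ (hI.braid_left _
    (Submodule.subset_span ⟨_, parityT_mem (basisV k X) hI i hi, _, rfl⟩))

theorem letterPart_pl_mem (t : TensorV k X) :
    ∃ c, letterPart (basisV k X) (fun x => genB k S (.pl x)) t = inclA k S c := by
  refine ⟨letterPart (basisV k X) (fun x => MonoidAlgebra.of k _ (mkLetter S x)) t, ?_⟩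
  refine LinearMap.congr_fun (g := (inclA k S).toLinearMap ∘ₗ letterPart (basisV k X)
    (fun x => MonoidAlgebra.of k _ (mkLetter S x))) ((wordBasis (basisV k X)).ext fun l => ?_) t
  rw [LinearMap.comp_apply]
  rcases l with _ | ⟨x, _ | ⟨y, l⟩⟩
  · rw [letterPart_nil, letterPart_nil, map_zero]
  · rw [letterPart_singleton, letterPart_singleton, AlgHom.toLinearMap_apply, inclA_letter]
  · rw [letterPart_cons_cons, letterPart_cons_cons, map_zero]

theorem letterPart_pr_mem (t : TensorV k X) :
    ∃ a, letterPart (basisV k X) (fun x => genB k S (.pr x)) t = inclA' k S a := by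
  refine ⟨letterPart (basisV k X) (fun x => MonoidAlgebra.of k _ (mkLetter S x)) t, ?_⟩
  refine LinearMap.congr_fun (g := (inclA' k S).toLinearMap ∘ₗ letterPart (basisV k X)
    (fun x => MonoidAlgebra.of k _ (mkLetter S x))) ((wordBasis (basisV k X)).ext fun l => ?_) t
  rw [LinearMap.comp_apply]
  rcases l with _ | ⟨x, _ | ⟨y, l⟩⟩
  · rw [letterPart_nil, letterPart_nil, map_zero]
  · rw [letterPart_singleton, letterPart_singleton, AlgHom.toLinearMap_apply, inclA'_letter]
  · rw [letterPart_cons_cons, letterPart_cons_cons, map_zero]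

theorem diffB_eMap_mem {i : TensorV k X}
    (hi : i ∈ nicholsIdeal (k := k) S.toEquiv (basisV k X)) :
    diffB k S (eMap k S i) ∈ nicholsKernel k S := by
  refine nicholsIdeal_induction (r := S.toEquiv) (basisV k X)
    (P := fun i => diffB k S (eMap k S i) ∈ nicholsKernel k S)
    (fun I hI i hi => ?_) (by simp) (fun s t hs ht => by rw [map_add, map_add]; exact add_mem hs ht)
    hi
  refine sandwichSpan_mono (le_nicholsIdeal (basisV k X) hI) ?_
  rw [diffB_eMap]
  refine sub_mem (mulMap_mem (fun a ha c => ?_) (fun c a ha => ?_) _ (hI.coideal i hi))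
    (mulMap_mem (fun a ha c => ?_) (fun c a ha => ?_) _ (hI.coideal i hi))
  · obtain ⟨c', hc'⟩ := letterPart_pl_mem k S c
    rw [hc']
    exact eMap_mul_inclA_mem (parityT_mem (basisV k X) hI a ha) c'
  · rw [letterPart_of_deg_two _ _ _ (hI.deg_two a ha), mul_zero]
    exact zero_mem _
  · rw [letterPart_of_deg_two _ _ _ (hI.deg_two a ha), zero_mul]
    exact zero_mem _
  · obtain ⟨c', hc'⟩ := letterPart_pr_mem k S c
    rw [hc']
    exact Submodule.subset_span ⟨c', a, ha, 1, by rw [map_one, mul_one]; rfl⟩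

theorem mul_mem_nicholsKernel_left (b : AlgB k S) {z : AlgB k S} (hz : z ∈ nicholsKernel k S) :
    b * z ∈ nicholsKernel k S := by
  induction b using algB_induction generalizing z with
  | scalar r => rw [← Algebra.smul_def]; exact Submodule.smul_mem _ _ hz
  | mul a b ha hb => rw [mul_assoc]; exact ha (hb hz)
  | add a b ha hb => rw [add_mul]; exact add_mem (ha hz) (hb hz)
  | gen g =>
    induction hz using Submodule.span_induction with
    | zero => simp
    | add s t _ _ hs ht => rw [mul_add]; exact add_mem hs ht
    | smul r t _ ht => rw [mul_smul_comm]; exact Submodule.smul_mem _ _ ht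
    | mem z hz =>
      obtain ⟨a, i, hi, c, rfl⟩ := hz
      induction a using basis_induction (basisA k S) with
      | zero => simp
      | add s t hs ht => rw [map_add, add_mul, add_mul, mul_add]; exact add_mem hs ht
      | smul r t ht =>
        rw [map_smul, smul_mul_assoc, smul_mul_assoc, mul_smul_comm]
        exact Submodule.smul_mem _ _ ht
      | basis a =>
        rw [basisA_apply]
        cases g with
        | pr x =>
          rw [← mul_assoc, ← mul_assoc, ← inclA'_mkLetter_mul]
          exact Submodule.subset_span ⟨_, i, hi, c, rfl⟩
        | ee x =>
          rw [← mul_assoc, ← mul_assoc, ee_mul_inclA', mul_assoc _ (genB k S _), ← eMap_ι,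
            ← map_mul (eMap k S)]
          exact Submodule.subset_span ⟨_, _, Ideal.mul_mem_left _ _ hi, c, rfl⟩
        | pl x =>
          rw [← mul_assoc, ← mul_assoc, pl_mul_inclA', mul_assoc _ (genB k S _)]
          exact sandwich_mem _ _ (pl_mul_eMap_mem k S _ hi)

theorem leftSpan_mul_pr {z : AlgB k S}
    (hz : z ∈ leftSpan k S (nicholsIdeal (k := k) S.toEquiv (basisV k X))) (y : X) :
    z * genB k S (.pr y) ∈ leftSpan k S (nicholsIdeal (k := k) S.toEquiv (basisV k X)) := by
  induction hz using Submodule.span_induction with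
  | zero => simp
  | add s t _ _ hs ht => rw [add_mul]; exact add_mem hs ht
  | smul r t _ ht => rw [smul_mul_assoc]; exact Submodule.smul_mem _ _ ht
  | mem z hz =>
    obtain ⟨a, i, hi, rfl⟩ := hz
    rw [mul_assoc]
    have h := eMap_mul_pr_mem k S y hi
    generalize eMap k S i * genB k S (.pr y) = w at h
    induction h using Submodule.span_induction with
    | zero => simp
    | add s t _ _ hs ht => rw [mul_add]; exact add_mem hs ht
    | smul r t _ ht => rw [mul_smul_comm]; exact Submodule.smul_mem _ _ ht
    | mem w hw =>
      obtain ⟨a', j, hj, rfl⟩ := hw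
      rw [← mul_assoc, ← map_mul]
      exact inclA'_mul_eMap_mem hj _

theorem leftSpan_mul_inclA' {z : AlgB k S}
    (hz : z ∈ leftSpan k S (nicholsIdeal (k := k) S.toEquiv (basisV k X)))
    (a : StructureMonoid S) : z * inclA' k S (MonoidAlgebra.of k _ a) ∈
      leftSpan k S (nicholsIdeal (k := k) S.toEquiv (basisV k X)) := by
  induction a using structureMonoid_induction generalizing z with
  | one => rwa [inclA'_one, mul_one]
  | mul x a ih =>
    rw [inclA'_mkLetter_mul, ← mul_assoc]
    exact ih (leftSpan_mul_pr k S hz x)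

theorem leftSpan_mul_eWord {z : AlgB k S}
    (hz : z ∈ leftSpan k S (nicholsIdeal (k := k) S.toEquiv (basisV k X))) (l : List X) :
    z * eWord k S l ∈ leftSpan k S (nicholsIdeal (k := k) S.toEquiv (basisV k X)) := by
  induction hz using Submodule.span_induction with
  | zero => simp
  | add s t _ _ hs ht => rw [add_mul]; exact add_mem hs ht
  | smul r t _ ht => rw [smul_mul_assoc]; exact Submodule.smul_mem _ _ ht
  | mem z hz =>
    obtain ⟨a, i, hi, rfl⟩ := hz
    rw [mul_assoc, ← eMap_word, ← map_mul]
    exact inclA'_mul_eMap_mem (Ideal.mul_mem_right _ _ hi) _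

theorem leftSpan_mul {z : AlgB k S}
    (hz : z ∈ leftSpan k S (nicholsIdeal (k := k) S.toEquiv (basisV k X))) (b : AlgB k S) :
    z * b ∈ nicholsKernel k S := by
  induction b using basis_induction (basisB S k) with
  | zero => simp
  | add s t hs ht => rw [mul_add]; exact add_mem hs ht
  | smul r t ht => rw [mul_smul_comm]; exact Submodule.smul_mem _ _ ht
  | basis ω =>
    rw [basisB_apply, normalForm, ← mul_assoc, ← mul_assoc]
    exact leftSpan_mul_inclA _ (leftSpan_mul_eWord k S (leftSpan_mul_inclA' k S hz _) _)

theorem mul_mem_nicholsKernel_right {z : AlgB k S} (hz : z ∈ nicholsKernel k S) (b : AlgB k S) :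
    z * b ∈ nicholsKernel k S := by
  induction hz using Submodule.span_induction with
  | zero => simp
  | add s t _ _ hs ht => rw [add_mul]; exact add_mem hs ht
  | smul r t _ ht => rw [smul_mul_assoc]; exact Submodule.smul_mem _ _ ht
  | mem z hz =>
    obtain ⟨a, i, hi, c, rfl⟩ := hz
    rw [mul_assoc]
    exact leftSpan_mul k S (inclA'_mul_eMap_mem hi a) _

theorem diffB_inclA'_mul (a : AlgA k S) (b : AlgB k S) :
    diffB k S (inclA' k S a * b) = inclA' k S a * diffB k S b := by
  induction a using basis_induction (basisA k S) with
  | zero => simp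
  | add s t hs ht => simp only [map_add, add_mul, hs, ht]
  | smul r t ht => simp only [map_smul, smul_mul_assoc, ht]
  | basis a =>
    rw [basisA_apply]
    induction a using structureMonoid_induction with
    | one => rw [inclA'_one, one_mul, one_mul]
    | mul x a ih => rw [inclA'_mkLetter_mul, mul_assoc, mul_assoc, diffB_pr_mul, ih]

theorem diffB_mul_inclA (b : AlgB k S) (c : AlgA k S) :
    diffB k S (b * inclA k S c) = diffB k S b * inclA k S c := by
  have h : diffB k S (inclA k S c) = 0 := by
    induction c using basis_induction (basisA k S) with
    | zero => simp
    | add s t hs ht => simp only [map_add, hs, ht, add_zero]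
    | smul r t ht => simp only [map_smul, ht, smul_zero]
    | basis c =>
      rw [basisA_apply]
      induction c using structureMonoid_induction with
      | one => rw [inclA_one, diffB_one]
      | mul x c ih => rw [inclA_mkLetter_mul, diffB_pl_mul, ih, mul_zero]
  rw [diffB_mul, h, mul_zero, add_zero]

theorem diffB_mem_nicholsKernel {z : AlgB k S} (hz : z ∈ nicholsKernel k S) :
    diffB k S z ∈ nicholsKernel k S := by
  induction hz using Submodule.span_induction with
  | zero => simp
  | add s t _ _ hs ht => rw [map_add]; exact add_mem hs ht
  | smul r t _ ht => rw [map_smul]; exact Submodule.smul_mem _ _ ht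
  | mem z hz =>
    obtain ⟨a, i, hi, c, rfl⟩ := hz
    rw [diffB_mul_inclA, diffB_inclA'_mul]
    exact sandwich_mem a c (diffB_eMap_mem k S hi)

theorem basisProj_sandwich (n : ℕ) (a c : AlgA k S) (t : TensorV k X) :
    basisProj (basisB S k) (fun ω => ω.2.1.length) n (inclA' k S a * eMap k S t * inclA k S c) =
      inclA' k S a * eMap k S (basisProj (wordBasis (basisV k X)) List.length n t) *
        inclA k S c := by
  induction a using basis_induction (basisA k S) with
  | zero => simp
  | add s t hs ht => simp only [map_add, add_mul, hs, ht]
  | smul r t ht => simp only [map_smul, smul_mul_assoc, ht]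
  | basis a =>
    induction c using basis_induction (basisA k S) with
    | zero => simp
    | add s t hs ht => simp only [map_add, mul_add, hs, ht]
    | smul r t ht => simp only [map_smul, mul_smul_comm, ht]
    | basis c =>
      induction t using basis_induction (wordBasis (basisV k X)) with
      | zero => simp
      | add s t hs ht => simp only [map_add, mul_add, add_mul, hs, ht]
      | smul r t ht => simp only [map_smul, mul_smul_comm, smul_mul_assoc, ht]
      | basis l =>
        rw [basisA_apply, basisA_apply, basisProj_basis, eMap_word]
        refine (congrArg _ (basisB_apply S k (a, l, c)).symm).trans ?_
        rw [basisProj_basis, basisB_apply]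
        split_ifs
        · rw [eMap_word]; rfl
        · simp

theorem basisProj_mem_nicholsKernel (n : ℕ) {z : AlgB k S} (hz : z ∈ nicholsKernel k S) :
    basisProj (basisB S k) (fun ω => ω.2.1.length) n z ∈ nicholsKernel k S := by
  induction hz using Submodule.span_induction with
  | zero => simp
  | add s t _ _ hs ht => rw [map_add]; exact add_mem hs ht
  | smul r t _ ht => rw [map_smul]; exact Submodule.smul_mem _ _ ht
  | mem z hz =>
    obtain ⟨a, i, hi, c, rfl⟩ := hz
    rw [basisProj_sandwich]
    exact Submodule.subset_span ⟨a, _, basisProj_mem_nicholsIdeal _ n i hi, c, rfl⟩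

theorem liftId_sandwich (a c : AlgA k S) (t : TensorV k X) :
    liftId k S (inclA' k S a * eMap k S t * inclA k S c) =
      (a ⊗ₜ[k] shuffleMap k S t) ⊗ₜ[k] c := by
  induction t using basis_induction (wordBasis (basisV k X)) with
  | zero => simp
  | add s t hs ht =>
    simp only [map_add, mul_add, add_mul, hs, ht, TensorProduct.tmul_add, TensorProduct.add_tmul]
  | smul r t ht =>
    simp only [map_smul, mul_smul_comm, smul_mul_assoc, ht, TensorProduct.tmul_smul,
      ← TensorProduct.smul_tmul']
  | basis l => rw [eMap_word, liftId_apply, shuffleMap_word]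

theorem liftId_of_mem_nicholsKernel {z : AlgB k S} (hz : z ∈ nicholsKernel k S) :
    liftId k S z = 0 := by
  induction hz using Submodule.span_induction with
  | zero => simp
  | add s t _ _ hs ht => rw [map_add, hs, ht, add_zero]
  | smul r t _ ht => rw [map_smul, ht, smul_zero]
  | mem z hz =>
    obtain ⟨a, i, hi, c, rfl⟩ := hz
    rw [liftId_sandwich, shuffleMap_of_mem k S hi, TensorProduct.tmul_zero, TensorProduct.zero_tmul]

end NicholsKernel

/-! ### Quotients of differential graded algebras -/

section Quotient

variable {k : Type u} [CommRing k]

/-- A linear map which vanishes on the kernel of a surjection factors through it. -/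
theorem exists_factor {E F G : Type*} [AddCommGroup E] [Module k E] [AddCommGroup F] [Module k F]
    [AddCommGroup G] [Module k G] {p : E →ₗ[k] F} (hp : Function.Surjective p) (f : E →ₗ[k] G)
    (h : ∀ x, p x = 0 → f x = 0) : ∃ g : F →ₗ[k] G, ∀ x, g (p x) = f x := by
  refine ⟨(LinearMap.ker p).liftQ f (fun x hx => h x hx) ∘ₗ
    (p.quotKerEquivOfSurjective hp).symm.toLinearMap, fun x => ?_⟩
  have : (p.quotKerEquivOfSurjective hp).symm (p x) = (LinearMap.ker p).mkQ x := by
    rw [LinearEquiv.symm_apply_eq]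
    rfl
  rw [LinearMap.comp_apply, LinearEquiv.coe_coe, this]
  rfl

/-- The image of a differential graded algebra under a linear surjection whose kernel is a
homogeneous differential ideal. -/
theorem exists_isDGAlgebra_of_surjective {E F : Type*} [Ring E] [Algebra k E] [AddCommGroup F]
    [Module k F] {gr : ℕ → Submodule k E} {d : E →ₗ[k] E}
    (hE : IsDGAlgebra (LinearMap.mul k E) 1 gr d) {p : E →ₗ[k] F} (hp : Function.Surjective p)
    (hl : ∀ a b, p b = 0 → p (a * b) = 0) (hr : ∀ a b, p a = 0 → p (a * b) = 0)
    (hd : ∀ a, p a = 0 → p (d a) = 0) (π : ℕ → E →ₗ[k] E) (h1 : ∀ n, ∀ x ∈ gr n, π n x = x)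
    (h0 : ∀ n m, m ≠ n → ∀ x ∈ gr m, π n x = 0) (hπ : ∀ n a, p a = 0 → p (π n a) = 0) :
    ∃ (mul : F →ₗ[k] F →ₗ[k] F) (dF : F →ₗ[k] F),
      IsDGAlgebra mul (p 1) (fun n => (gr n).map p) dF ∧ (∀ a b, mul (p a) (p b) = p (a * b)) ∧
        ∀ a, dF (p a) = p (d a) := by
  obtain ⟨m₁, hm₁⟩ := exists_factor hp ((LinearMap.mul k E).compr₂ p) (fun a ha => by
    ext b; exact hr a b ha)
  obtain ⟨m₂, hm₂⟩ := exists_factor hp m₁.flip (fun b hb => by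
    ext y
    obtain ⟨a, rfl⟩ := hp y
    rw [LinearMap.flip_apply, hm₁]
    exact hl a b hb)
  obtain ⟨dF, hdF⟩ := exists_factor hp (p ∘ₗ d) hd
  choose ρ hρ using fun n => exists_factor hp (p ∘ₗ π n) (hπ n)
  have hmul : ∀ a b, m₂.flip (p a) (p b) = p (a * b) := fun a b => by
    rw [LinearMap.flip_apply, hm₂, LinearMap.flip_apply, hm₁]; rfl
  have hdF' : ∀ a, dF (p a) = p (d a) := hdF
  refine ⟨m₂.flip, dF, ?_, hmul, hdF'⟩
  exact
    { mul_assoc := fun a b c => by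
        obtain ⟨a, rfl⟩ := hp a
        obtain ⟨b, rfl⟩ := hp b
        obtain ⟨c, rfl⟩ := hp c
        rw [hmul, hmul, hmul, hmul, mul_assoc]
      one_mul := fun a => by
        obtain ⟨a, rfl⟩ := hp a
        rw [hmul, one_mul]
      mul_one := fun a => by
        obtain ⟨a, rfl⟩ := hp a
        rw [hmul, mul_one]
      decomposition := by
        refine isInternal_of_projections _ ρ ?_ ?_ ?_
        · rintro n _ ⟨a, ha, rfl⟩
          rw [hρ, LinearMap.comp_apply, h1 n a ha]
        · rintro n m hnm _ ⟨a, ha, rfl⟩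
          rw [hρ, LinearMap.comp_apply, h0 n m hnm a ha, map_zero]
        · rw [← Submodule.map_iSup, hE.decomposition.submodule_iSup_eq_top, Submodule.map_top,
            LinearMap.range_eq_top.2 hp]
      one_mem := ⟨1, hE.one_mem, rfl⟩
      mul_mem := by
        rintro m n _ ⟨a, ha, rfl⟩ _ ⟨b, hb, rfl⟩
        exact ⟨a * b, hE.mul_mem m n a ha b hb, (hmul a b).symm⟩
      d_zero := by
        rintro _ ⟨a, ha, rfl⟩
        rw [hdF', hE.d_zero a ha, map_zero]
      d_mem := by
        rintro n _ ⟨a, ha, rfl⟩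
        exact ⟨d a, hE.d_mem n a ha, (hdF' a).symm⟩
      d_d := fun a => by
        obtain ⟨a, rfl⟩ := hp a
        rw [hdF', hdF', hE.d_d, map_zero]
      leibniz := by
        rintro n _ ⟨a, ha, rfl⟩ b
        obtain ⟨b, rfl⟩ := hp b
        have h := hE.leibniz n a ha b
        simp only [LinearMap.mul_apply'] at h
        rw [hmul, hdF', hdF', hdF', hmul, hmul, h, map_add, map_smul] }

end Quotient

/-! ### The factorization through the Nichols algebra -/

section NicholsFactor

variable (k : Type u) [CommRing k] {X : Type v} (S : Solution X)

/-- The quotient map from the tensor algebra to the Nichols algebra. -/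
def nicholsMk : TensorV k X →ₗ[k] Nichols k S :=
  (Ideal.Quotient.mkₐ k (nicholsIdeal (k := k) S.toEquiv (basisV k X))).toLinearMap

theorem nicholsMk_surjective : Function.Surjective (nicholsMk k S) := Ideal.Quotient.mk_surjective

theorem nicholsMk_eq_zero_iff (t : TensorV k X) : nicholsMk k S t = 0 ↔
    t ∈ nicholsIdeal (k := k) S.toEquiv (basisV k X) := Ideal.Quotient.eq_zero_iff_mem

theorem nicholsMk_word (l : List X) :
    nicholsMk k S (wordBasis (basisV k X) l) = nicholsWord k S l := rfl

/-- The map `a' e_{x₁} ⋯ e_{xₙ} c ↦ a ⊗ [x₁ ⊗ ⋯ ⊗ xₙ] ⊗ c` from `B` to `A ⊗ 𝔅 ⊗ A`. -/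
def nicholsProj : AlgB k S →ₗ[k] NicholsBar k S :=
  (basisB S k).constr k fun ω =>
    (MonoidAlgebra.of k (StructureMonoid S) ω.1 ⊗ₜ[k] nicholsWord k S ω.2.1) ⊗ₜ[k]
      MonoidAlgebra.of k (StructureMonoid S) ω.2.2

theorem nicholsProj_apply (a₁ : AlgA k S) (l : List X) (a₂ : AlgA k S) :
    nicholsProj k S (inclA' k S a₁ * eWord k S l * inclA k S a₂) =
      (a₁ ⊗ₜ[k] nicholsWord k S l) ⊗ₜ[k] a₂ := by
  induction a₁ using basis_induction (basisA k S) with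
  | zero => simp
  | add s t hs ht => simp only [map_add, add_mul, TensorProduct.add_tmul, hs, ht]
  | smul c t ht => simp only [map_smul, smul_mul_assoc, ← TensorProduct.smul_tmul', ht]
  | basis a =>
    induction a₂ using basis_induction (basisA k S) with
    | zero => simp
    | add s t hs ht => simp only [map_add, mul_add, TensorProduct.tmul_add, hs, ht]
    | smul c t ht => simp only [map_smul, mul_smul_comm, TensorProduct.tmul_smul, ht]
    | basis c =>
      rw [basisA_apply, basisA_apply]
      refine (congrArg _ (basisB_apply S k (a, l, c)).symm).trans ?_
      rw [nicholsProj, Basis.constr_basis]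

theorem nicholsProj_sandwich (a c : AlgA k S) (t : TensorV k X) :
    nicholsProj k S (inclA' k S a * eMap k S t * inclA k S c) =
      (a ⊗ₜ[k] nicholsMk k S t) ⊗ₜ[k] c := by
  induction t using basis_induction (wordBasis (basisV k X)) with
  | zero => simp
  | add s t hs ht =>
    simp only [map_add, mul_add, add_mul, hs, ht, TensorProduct.tmul_add, TensorProduct.add_tmul]
  | smul r t ht =>
    simp only [map_smul, mul_smul_comm, smul_mul_assoc, ht, TensorProduct.tmul_smul,
      ← TensorProduct.smul_tmul']
  | basis l => rw [eMap_word, nicholsProj_apply, nicholsMk_word]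

theorem nicholsProj_surjective : Function.Surjective (nicholsProj k S) := by
  rw [← LinearMap.range_eq_top, eq_top_iff]
  rintro z -
  induction z using TensorProduct.induction_on with
  | zero => exact zero_mem _
  | add s t hs ht => exact add_mem hs ht
  | tmul z c =>
    induction z using TensorProduct.induction_on with
    | zero => rw [TensorProduct.zero_tmul]; exact zero_mem _
    | add s t hs ht => rw [TensorProduct.add_tmul]; exact add_mem hs ht
    | tmul a n =>
      obtain ⟨t, rfl⟩ := nicholsMk_surjective k S n
      exact ⟨_, nicholsProj_sandwich k S a c t⟩

theorem nicholsProj_eq_zero_of_mem {z : AlgB k S} (hz : z ∈ nicholsKernel k S) :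
    nicholsProj k S z = 0 := by
  induction hz using Submodule.span_induction with
  | zero => simp
  | add s t _ _ hs ht => rw [map_add, hs, ht, add_zero]
  | smul r t _ ht => rw [map_smul, ht, smul_zero]
  | mem z hz =>
    obtain ⟨a, i, hi, c, rfl⟩ := hz
    rw [nicholsProj_sandwich, (nicholsMk_eq_zero_iff k S i).2 hi, TensorProduct.tmul_zero,
      TensorProduct.zero_tmul]

/-- The inverse of the map from the quotient of `B` by `nicholsKernel` to `A ⊗ 𝔅 ⊗ A` shows that the
kernel is not larger. -/
theorem mem_of_nicholsProj_eq_zero {z : AlgB k S} (hz : nicholsProj k S z = 0) :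
    z ∈ nicholsKernel k S := by
  let W : AlgB k S →ₗ[k] AlgA k S →ₗ[k] AlgB k S ⧸ nicholsKernel k S :=
    ((LinearMap.mul k (AlgB k S)).compr₂ (nicholsKernel k S).mkQ).compl₂ (inclA k S).toLinearMap
  let Φ : TensorV k X →ₗ[k] AlgA k S →ₗ[k] AlgA k S →ₗ[k] AlgB k S ⧸ nicholsKernel k S :=
    ((LinearMap.mul k (AlgB k S)).compl₁₂ (inclA' k S).toLinearMap
      (eMap k S).toLinearMap).flip.compr₂ W
  have hΦ : ∀ t a c, Φ t a c =
      (nicholsKernel k S).mkQ (inclA' k S a * eMap k S t * inclA k S c) := fun _ _ _ => rfl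
  obtain ⟨Ψ, hΨ⟩ := exists_factor (E := TensorV k X) (F := Nichols k S)
    (G := AlgA k S →ₗ[k] AlgA k S →ₗ[k] AlgB k S ⧸ nicholsKernel k S)
    (nicholsMk_surjective k S) Φ (fun t ht => by
    refine LinearMap.ext fun a => LinearMap.ext fun c => ?_
    rw [hΦ]
    refine (Submodule.Quotient.mk_eq_zero _).2 (Submodule.subset_span ⟨a, t, ?_, c, rfl⟩)
    exact (nicholsMk_eq_zero_iff k S t).1 ht)
  have h : TensorProduct.lift (TensorProduct.lift Ψ.flip) ∘ₗ nicholsProj k S =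
      (nicholsKernel k S).mkQ := by
    refine eq_of_eq_on_normalForms k S fun a l c => ?_
    rw [LinearMap.comp_apply, nicholsProj_apply, TensorProduct.lift.tmul, TensorProduct.lift.tmul,
      LinearMap.flip_apply, ← nicholsMk_word, hΨ, hΦ, eMap_word]
  have hz' := LinearMap.congr_fun h z
  rw [LinearMap.comp_apply, hz, map_zero] at hz'
  exact (Submodule.Quotient.mk_eq_zero _).1 hz'.symm

theorem nicholsProj_eq_zero_iff {z : AlgB k S} : nicholsProj k S z = 0 ↔ z ∈ nicholsKernel k S :=
  ⟨mem_of_nicholsProj_eq_zero k S, nicholsProj_eq_zero_of_mem k S⟩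

theorem nicholsProj_one : nicholsProj k S 1 = nicholsBarOne k S := by
  have h := nicholsProj_apply k S 1 [] 1
  rw [map_one, map_one, eWord_nil, one_mul, one_mul, ← nicholsMk_word, wordBasis_nil] at h
  exact h

theorem nicholsBarGrading_eq (n : ℕ) :
    nicholsBarGrading k S n = (gradingB k S n).map (nicholsProj k S) := by
  have hG : (tensorDeg k (X →₀ k) n).map (nicholsMk k S) =
      Submodule.span k {t | ∃ l : List X, l.length = n ∧ t = nicholsWord k S l} := by
    rw [tensorDeg_eq_span (basisV k X), Submodule.map_span]
    congr 1
    ext t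
    constructor
    · rintro ⟨_, ⟨l, hl, rfl⟩, rfl⟩; exact ⟨l, hl, rfl⟩
    · rintro ⟨l, hl, rfl⟩; exact ⟨_, ⟨l, hl, rfl⟩, rfl⟩
  refine (sandwichGrading_eq_span (AlgA k S) (basisA k S) _ n _ hG).trans ?_
  rw [gradingB_eq, basisGrading, Submodule.map_span]
  congr 1
  ext z
  constructor
  · rintro ⟨a, c, _, ⟨l, hl, rfl⟩, rfl⟩
    refine ⟨_, ⟨(a, l, c), hl, rfl⟩, ?_⟩
    rw [nicholsProj, Basis.constr_basis, basisA_apply, basisA_apply]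
  · rintro ⟨_, ⟨⟨a, l, c⟩, hl, rfl⟩, rfl⟩
    refine ⟨a, c, _, ⟨l, hl, rfl⟩, ?_⟩
    rw [nicholsProj, Basis.constr_basis, basisA_apply, basisA_apply]

/-- The comparison map factors, as a morphism of differential graded algebras, through
`A ⊗ 𝔅 ⊗ A`. -/
theorem exists_nichols_factorization :
    ∃ (mulN : NicholsBar k S →ₗ[k] NicholsBar k S →ₗ[k] NicholsBar k S)
      (dN : NicholsBar k S →ₗ[k] NicholsBar k S)
      (p : AlgB k S →ₗ[k] NicholsBar k S) (g : NicholsBar k S →ₗ[k] Bar k S),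
      IsDGAlgebra mulN (nicholsBarOne k S) (nicholsBarGrading k S) dN ∧
      (∀ (a₁ : AlgA k S) (l : List X) (a₂ : AlgA k S),
        p (inclA' k S a₁ * eWord k S l * inclA k S a₂) =
          (a₁ ⊗ₜ[k] nicholsWord k S l) ⊗ₜ[k] a₂) ∧
      IsDGAlgebraHom (LinearMap.mul k (AlgB k S)) 1 (gradingB k S) (-diffB k S)
        mulN (nicholsBarOne k S) (nicholsBarGrading k S) dN p ∧
      IsDGAlgebraHom mulN (nicholsBarOne k S) (nicholsBarGrading k S) dN
        (barMul k S) (barOne k S) (barGrading k S) (barDiff k S) g ∧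
      liftId k S = g ∘ₗ p := by
  have hp := nicholsProj_surjective k S
  obtain ⟨mulN, dN, hDG, hmul, hd⟩ := exists_isDGAlgebra_of_surjective (F := NicholsBar k S)
    (p := nicholsProj k S) (isDGAlgebra_algB k S) hp
    (fun a b hb => by
      rw [nicholsProj_eq_zero_iff] at hb ⊢; exact mul_mem_nicholsKernel_left k S a hb)
    (fun a b ha => by
      rw [nicholsProj_eq_zero_iff] at ha ⊢; exact mul_mem_nicholsKernel_right k S ha b)
    (fun a ha => by
      rw [nicholsProj_eq_zero_iff] at ha ⊢; exact neg_mem (diffB_mem_nicholsKernel k S ha))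
    (basisProj (basisB S k) fun ω => ω.2.1.length)
    (fun n x hx => by
      rw [gradingB_eq] at hx
      rw [basisProj_of_mem _ _ _ _ _ hx, if_pos rfl])
    (fun n m hnm x hx => by
      rw [gradingB_eq] at hx
      rw [basisProj_of_mem _ _ _ _ _ hx, if_neg hnm])
    (fun n a ha => by
      rw [nicholsProj_eq_zero_iff] at ha ⊢; exact basisProj_mem_nicholsKernel k S n ha)
  rw [nicholsProj_one, ← funext (nicholsBarGrading_eq k S)] at hDG
  obtain ⟨g, hg⟩ := exists_factor (F := NicholsBar k S) (G := Bar k S) hp (liftId k S) fun z hz =>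
    liftId_of_mem_nicholsKernel k S ((nicholsProj_eq_zero_iff k S).1 hz)
  have hf := isDGAlgebraHom_liftId k S
  refine ⟨mulN, dN, nicholsProj k S, g, hDG, nicholsProj_apply k S, ?_, ?_,
    LinearMap.ext fun z => (hg z).symm⟩
  · exact
      { map_one := nicholsProj_one k S
        map_mul := fun a b => (hmul a b).symm
        map_mem := fun n a ha => by
          rw [nicholsBarGrading_eq]
          exact Submodule.mem_map_of_mem ha
        map_d := fun a => (hd a).symm }
  · exact
      { map_one := by rw [← nicholsProj_one, hg, hf.map_one]
        map_mul := fun a b => by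
          obtain ⟨a, rfl⟩ := hp a
          obtain ⟨b, rfl⟩ := hp b
          rw [hmul, hg, hg, hg]
          exact hf.map_mul a b
        map_mem := fun n a ha => by
          rw [nicholsBarGrading_eq] at ha
          obtain ⟨a, ha, rfl⟩ := ha
          rw [hg]
          exact hf.map_mem n a ha
        map_d := fun a => by
          obtain ⟨a, rfl⟩ := hp a
          rw [hd, hg, hg]
          exact hf.map_d a }

end NicholsFactor

end YangBaxter

end

theorem mainTheorem5 {k : Type*} [CommRing k] {X : Type*} (S : Solution X) :
    -- the source `(B, -d)`, where `d e_x = x - x'`, and the target, the bar resolution with the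
    -- braided tensor product, are differential graded algebras
    IsDGAlgebra (LinearMap.mul k (AlgB k S)) 1 (gradingB k S) (-diffB k S) ∧
    IsDGAlgebra (barMul k S) (barOne k S) (barGrading k S) (barDiff k S) ∧
    -- iterated quantum shuffles are given by the quantum symmetrizer
    (∀ l : List X,
      iteratedShuffle (braidM S) (basisA k S) (l.map (mkLetter S)) =
        negSymmetrizer (braidM S) (basisA k S) (l.map (mkLetter S))) ∧
    ∃ f : AlgB k S →ₗ[k] Bar k S,
      -- the formula for the map, which determines it
      (∀ (a₁ : AlgA k S) (l : List X) (a₂ : AlgA k S),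
        f (inclA' k S a₁ * eWord k S l * inclA k S a₂) =
          (a₁ ⊗ₜ[k] iteratedShuffle (braidM S) (basisA k S) (l.map (mkLetter S))) ⊗ₜ[k] a₂) ∧
      (∀ g : AlgB k S →ₗ[k] Bar k S,
        (∀ (a₁ : AlgA k S) (l : List X) (a₂ : AlgA k S),
          g (inclA' k S a₁ * eWord k S l * inclA k S a₂) =
            (a₁ ⊗ₜ[k] iteratedShuffle (braidM S) (basisA k S) (l.map (mkLetter S))) ⊗ₜ[k] a₂) →
        g = f) ∧
      -- it is `A'`-`A`-linear
      (∀ (a₁ : AlgA k S) (b : AlgB k S) (a₂ : AlgA k S),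
        f (inclA' k S a₁ * b * inclA k S a₂) =
          TensorProduct.map (TensorProduct.map (LinearMap.mulLeft k a₁) LinearMap.id)
            (LinearMap.mulRight k a₂) (f b)) ∧
      -- it lifts the identity of `A`
      (∀ b : AlgB k S, barAug k S (f b) = augB k S b) ∧
      -- it is a morphism of differential graded algebras (in particular, a chain map)
      IsDGAlgebraHom (LinearMap.mul k (AlgB k S)) 1 (gradingB k S) (-diffB k S)
        (barMul k S) (barOne k S) (barGrading k S) (barDiff k S) f ∧
      -- it factors through `A ⊗ 𝔅 ⊗ A`, as a morphism of differential graded algebras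
      ∃ (mulN : NicholsBar k S →ₗ[k] NicholsBar k S →ₗ[k] NicholsBar k S)
        (dN : NicholsBar k S →ₗ[k] NicholsBar k S)
        (p : AlgB k S →ₗ[k] NicholsBar k S) (g : NicholsBar k S →ₗ[k] Bar k S),
        IsDGAlgebra mulN (nicholsBarOne k S) (nicholsBarGrading k S) dN ∧
        (∀ (a₁ : AlgA k S) (l : List X) (a₂ : AlgA k S),
          p (inclA' k S a₁ * eWord k S l * inclA k S a₂) =
            (a₁ ⊗ₜ[k] nicholsWord k S l) ⊗ₜ[k] a₂) ∧
        IsDGAlgebraHom (LinearMap.mul k (AlgB k S)) 1 (gradingB k S) (-diffB k S)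
          mulN (nicholsBarOne k S) (nicholsBarGrading k S) dN p ∧
        IsDGAlgebraHom mulN (nicholsBarOne k S) (nicholsBarGrading k S) dN
          (barMul k S) (barOne k S) (barGrading k S) (barDiff k S) g ∧
        f = g ∘ₗ p := by
  exact ⟨isDGAlgebra_algB k S, isDGAlgebra_bar k S,
    fun l => iteratedShuffle_eq_negSymmetrizer _ _, liftId k S, liftId_apply k S,
    fun g hg => eq_of_eq_on_normalForms k S fun a₁ l a₂ => by rw [hg, liftId_apply],
    liftId_bimodule k S, barAug_liftId k S, isDGAlgebraHom_liftId k S,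
    exists_nichols_factorization k S⟩
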